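/- **Theorem (FCC local minimizer).** For $N$ atoms at positions $p_1,\dots,p_N\in\mathbb{R}^3$, write $p=(p_1,\dots,p_N)\in\mathbb{R}^{3N}$, let $\|p\|_\infty$ be the maximum of the absolute values of all $3N$ coordinates, and let $$E_{\mathrm{LJ}}(p)=\frac4N\sum_{1\le i<j\le N}\left(\frac1{r_{ij}^{12}}-\frac1{r_{ij}^{6}}\right),\qquad r_{ij}=\|p_i-p_j\|_2 ,$$ be the nondimensional Lennard–Jones energy per atom. Let $N=864$ and let $\bar p\in\mathbb{R}^{3\cdot 864}$ be the following numerically computed approximate local minimizer of $E_{\mathrm{LJ}}$, a relaxed fcc block of $6\times6\times6$ conventional cubic cells. Its atoms are indexed (in lexicographic order) by the $864$ fcc sites $s=(s_1,s_2,s_3)\in\{0,\dots,11\}^3$ with $s_1+s_2+s_3$ even. For $m\in\{0,\dots,11\}$ put $\sigma(m)=-1$, $\lambda(m)=5-m$ if $m\le 5$, and $\sigma(m)=1$, $\lambda(m)=m-6$ if $m\ge 6$. The atom of the site $s$ has the coordinates $$(\bar p_s)_d=\sigma(s_d)\,G\bigl(\lambda(s_d);\lambda(s_{d'}),\lambda(s_{d''})\bigr),\qquad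 \{d,d',d''\}=\{1,2,3\},$$ where $G(a;b,c)=G(a;c,b)$, and where the values $G(a;0,c),G(a;1,c),\dots,G(a;c,c)$ are listed below, in this order, after the label $(a,c)$. Then there exists a local minimizer $p\in\mathbb{R}^{3\cdot864}$ of $E_{\mathrm{LJ}}$ such that $$\|p-\bar p\|_\infty\le 1.4797\cdot10^{-11},$$ and this minimizer is unique, up to rotations and translations of the whole configuration, within distance $9.9994\cdot10^{-8}$ of $\bar p$ in the norm $\|\cdot\|_\infty$: for every local minimizer $q$ of $E_{\mathrm{LJ}}$ with $\|q-\bar p\|_\infty\le 9.9994\cdot10^{-8}$ there are $A\in SO(3)$ and $t\in\mathbb{R}^3$ with $q_i=Ap_i+t$ for all $i$. Values of $G$, labelled by $(a,c)$: $(0,0)$: $0.3849426184898984$; $(0,1)$: $0.3848627460507180,\ 0.3847907700457540$; $(0,2)$: $0.3847713512895136,\ 0.3846717954879955,\ 0.3845804692365439$; $(0,3)$: $0.3847118836844932,\ 0.3846327074348055,\ 0.3845172499394523,\ 0.3844962390208536$; $(0,4)$: $0.3847537094062465,\ 0.3846219274255771,\ 0.3845487322346263,\ 0.3847040449357993,\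 0.3848592020247903$; $(0,5)$: $0.3847893392611961,\ 0.3846977864944941,\ 0.3847965461740165,\ 0.3849061380623312,\ 0.3851192840922582,\ 0.3853039259522221$; $(1,0)$: $1.1551573530943767$; $(1,1)$: $1.1549182963570795,\ 1.1546531825440037$; $(1,2)$: $1.1545764016152725,\ 1.1543143757609824,\ 1.1539090431451857$; $(1,3)$: $1.1543821741842030,\ 1.1540532288560635,\ 1.1536999932553914,\ 1.1535274407868081$; $(1,4)$: $1.1544423636919881,\ 1.1541135570328105,\ 1.1537119019530589,\ 1.1537866003456509,\ 1.1544271591846722$; $(1,5)$: $1.1548445486862348,\ 1.1542367286067416,\ 1.1540780336776820,\ 1.1545706729305875,\ 1.1551231460803776,\ 1.1558038048860202$; $(2,0)$: $1.9263242990077989$; $(2,1)$: $1.9259038300046776,\ 1.9254737803503389$; $(2,2)$: $1.9252621447970953,\ 1.9247669947014816,\ 1.9240561825007900$; $(2,3)$: $1.9247198346131642,\ 1.9242036261623347,\ 1.9233638936869276,\ 1.9228178577027275$; $(2,4)$: $1.9247380877336715,\ 1.9240752059101993,\ 1.9232762594435220,\ 1.9226716181148292,\ 1.9230873867411201$; $(2,5)$: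 $1.9255844405719693,\ 1.9246618963574254,\ 1.9233422327083804,\ 1.9233196226414331,\ 1.9246191530683896,\ 1.9258407300176738$; $(3,0)$: $2.6990993358136527$; $(3,1)$: $2.6985599701840541,\ 2.6979808943548463$; $(3,2)$: $2.6975765271691017,\ 2.6969643643154593,\ 2.6958202807254399$; $(3,3)$: $2.6965239492214699,\ 2.6958225891688441,\ 2.6946458019915932,\ 2.6932469608947926$; $(3,4)$: $2.6960119864591883,\ 2.6952148116627276,\ 2.6938033891309940,\ 2.6925375449362400,\ 2.6915604171754186$; $(3,5)$: $2.6968879203619982,\ 2.6961488370625363,\ 2.6942711680224063,\ 2.6921168420523699,\ 2.6924091236050401,\ 2.6952911034412245$; $(4,0)$: $3.4754239233826643$; $(4,1)$: $3.4748303369240888,\ 3.4742099740264527$; $(4,2)$: $3.4736542146555715,\ 3.4729708490761269,\ 3.4716747430266232$; $(4,3)$: $3.4719302341945808,\ 3.4712180481736101,\ 3.4698328840034248,\ 3.4678985378624827$; $(4,4)$: $3.4703785759329813,\ 3.4697669892552242,\ 3.4682517331619479,\ 3.4658965926684304,\ 3.4640237570606491$; $(4,5)$: $3.4703050663983860,\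 3.4697043883079822,\ 3.4683923976917207,\ 3.4652926208791163,\ 3.4617252551270935,\ 3.4622022500246708$; $(5,0)$: $4.2672259029717849$; $(5,1)$: $4.2665802055781913,\ 4.2659377928559930$; $(5,2)$: $4.2652317140220278,\ 4.2646063419901482,\ 4.2633489709261545$; $(5,3)$: $4.2630795775761171,\ 4.2625584204139551,\ 4.2612907331907803,\ 4.2592050767793356$; $(5,4)$: $4.2596537405273516,\ 4.2591739462834071,\ 4.2580650680182703,\ 4.2557372397634487,\ 4.2515660849379749$; $(5,5)$: $4.2585939190407126,\ 4.2581907365689878,\ 4.2571928234020778,\ 4.2551399870852881,\ 4.2496259026803501,\ 4.2424232325413997$. -/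

import Mathlib

/-- A cloud of `N` atoms in space. The norm of this type is the maximum of the absolute values of
all `3 * N` coordinates. -/
abbrev AtomCloud (N : ℕ) : Type := Fin N → Fin 3 → ℝ

/-- The Euclidean distance between the atoms `i` and `j`. -/
noncomputable def atomDist {N : ℕ} (p : AtomCloud N) (i j : Fin N) : ℝ :=
  ‖WithLp.toLp 2 (p i - p j)‖

/-- The nondimensional Lennard-Jones energy per atom. -/
noncomputable def ljEnergy {N : ℕ} (p : AtomCloud N) : ℝ :=
  4 / (N : ℝ) * ∑ i : Fin N, ∑ j ∈ Finset.Ioi i,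
    (1 / atomDist p i j ^ 12 - 1 / atomDist p i j ^ 6)

/-- `q` arises from `p` by one of the continuous invariances of the energy: a rotation followed by
a translation of the whole cloud. -/
def RigidlyEquivalent {N : ℕ} (p q : AtomCloud N) : Prop :=
  ∃ A ∈ Matrix.specialOrthogonalGroup (Fin 3) ℝ, ∃ t : Fin 3 → ℝ,
    ∀ i, q i = A.mulVec (p i) + t

/-- The sites of the fcc block of `6 × 6 × 6` conventional cubic cells with four atoms each, in
units of half the cell edge: the points of `{0, …, 11} ^ 3` with even coordinate sum, listed
lexicographically. -/
def fccSite (n : Fin 864) : Fin 3 → ℕ :=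
  ![n.val / 72, n.val / 6 % 12, 2 * (n.val % 6) + (n.val / 72 + n.val / 6 % 12) % 2]

/-- The side (`-1` or `1`) of the midplane of the block on which the layer `m ∈ {0, …, 11}` lies. -/
def layerSide (m : ℕ) : ℤ := if m < 6 then -1 else 1

/-- The position `0, …, 5` of the layer `m ∈ {0, …, 11}`, counted outwards from the midplane. -/
def layerIndex (m : ℕ) : ℕ := if m < 6 then 5 - m else m - 6

/-- Numerically computed data, in units of `10 ^ (-16)`: the entries `G a b c` with
`0 ≤ a ≤ 5` and `0 ≤ b ≤ c ≤ 5`, ordered by `a`, then `c`, then `b`. -/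
def relaxedTable : List ℕ :=
  [
    3849426184898984,
    3848627460507180, 3847907700457540,
    3847713512895136, 3846717954879955, 3845804692365439,
    3847118836844932, 3846327074348055, 3845172499394523, 3844962390208536,
    3847537094062465, 3846219274255771, 3845487322346263, 3847040449357993, 3848592020247903,
    3847893392611961, 3846977864944941, 3847965461740165, 3849061380623312, 3851192840922582, 3853039259522221,
    11551573530943767,
    11549182963570795, 11546531825440037,
    11545764016152725, 11543143757609824, 11539090431451857,
    11543821741842030, 11540532288560635, 11536999932553914, 11535274407868081,
    11544423636919881, 11541135570328105, 11537119019530589, 11537866003456509, 11544271591846722,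
    11548445486862348, 11542367286067416, 11540780336776820, 11545706729305875, 11551231460803776, 11558038048860202,
    19263242990077989,
    19259038300046776, 19254737803503389,
    19252621447970953, 19247669947014816, 19240561825007900,
    19247198346131642, 19242036261623347, 19233638936869276, 19228178577027275,
    19247380877336715, 19240752059101993, 19232762594435220, 19226716181148292, 19230873867411201,
    19255844405719693, 19246618963574254, 19233422327083804, 19233196226414331, 19246191530683896, 19258407300176738,
    26990993358136527,
    26985599701840541, 26979808943548463,
    26975765271691017, 26969643643154593, 26958202807254399,
    26965239492214699, 26958225891688441, 26946458019915932, 26932469608947926,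
    26960119864591883, 26952148116627276, 26938033891309940, 26925375449362400, 26915604171754186,
    26968879203619982, 26961488370625363, 26942711680224063, 26921168420523699, 26924091236050401, 26952911034412245,
    34754239233826643,
    34748303369240888, 34742099740264527,
    34736542146555715, 34729708490761269, 34716747430266232,
    34719302341945808, 34712180481736101, 34698328840034248, 34678985378624827,
    34703785759329813, 34697669892552242, 34682517331619479, 34658965926684304, 34640237570606491,
    34703050663983860, 34697043883079822, 34683923976917207, 34652926208791163, 34617252551270935, 34622022500246708,
    42672259029717849,
    42665802055781913, 42659377928559930,
    42652317140220278, 42646063419901482, 42633489709261545,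
    42630795775761171, 42625584204139551, 42612907331907803, 42592050767793356,
    42596537405273516, 42591739462834071, 42580650680182703, 42557372397634487, 42515660849379749,
    42585939190407126, 42581907365689878, 42571928234020778, 42551399870852881, 42496259026803501, 42424232325413997]

/-- The distance, in units of `10 ^ (-16)`, from a midplane of the relaxed block to an atom whose
layer in that coordinate direction has index `a` and whose layers in the two other directions have
the indices `b` and `c` (in either order). -/
def relaxedOffset (a b c : ℕ) : ℕ :=
  relaxedTable.getD (21 * a + max b c * (max b c + 1) / 2 + min b c) 0

/-- The numerically computed approximate minimizer: the relaxed fcc block of 864 atoms, centred at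
the origin with its cell edges parallel to the coordinate axes. -/
noncomputable def fccApprox : AtomCloud 864 := fun n d =>
  (layerSide (fccSite n d) : ℝ) *
    (relaxedOffset (layerIndex (fccSite n d)) (layerIndex (fccSite n (d + 1)))
      (layerIndex (fccSite n (d + 2))) : ℝ) / 10 ^ 16

/-! The gradient of the energy at `fccApprox` is tiny, and modulo rigid motions the Hessian is
positive definite, uniformly on a small ball about `fccApprox`. Both facts are certified by exact
integer arithmetic; strong convexity then gives existence and uniqueness.

Analysis. Up to the factor `2 / 864` the energy is `pairSum`, a sum over ordered pairs. Rigid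
motions are removed by the slice `fccSlice`: clouds near `fccApprox` whose displacement satisfies
the linear conditions of zero mean and zero torque. The rotation of maximal overlap brings every
nearby cloud into the slice without moving it away from `fccApprox` (`exists_rigid_alignment`). On
the slice `pairSum` is strongly convex (`pairSum_strongly_convex`). With the gradient bound
`abs_gradient_le` this puts the minimizer over the compact slice deep inside the ball, so by rigid
invariance it is a local minimizer of the energy. Any other nearby local minimizer, once moved into
the slice, is a critical point there and coincides with it by strong convexity.

Curvature. The second derivative of the pair potential along a line is an isotropic term plus a
directional one. Lowering the isotropic coefficient from 6 to 95/16 leaves a slack that absorbs both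
the motion of the atoms within the ball and the rounding of inverse squared distances
(`ljCurvature_near_ge`). A single integer quadratic form thus bounds the Hessian from below on the
whole ball.

Symmetry. The atoms lie over 216 triples of layer indices, four over each, distinguished by sign
patterns of fixed product. The half-turns about the axes form a Klein four-group, whose characters
split the form on 2592 coordinates into four forms on 648 coordinates (`sum_bondForm_eq`). The
trivial component contains no rigid motion. The component of the character `s ↦ s f` contains the
translation along and the rotation about the axis `f`; these are handled by a penalty that vanishes
on aligned displacements. Cyclic permutation of the axes identifies the three nontrivial components,
so two matrices remain.

Certificates. Each matrix, lowered by a spectral bound on the diagonal, is compared with the Gram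
matrix of an integer Cholesky factor. Only the size of the residual matters (`acceptRow_sound`,
`cholesky_sound`), so the factor may be computed by any heuristic. Whole rows are packed into single
natural numbers with digits in base `2 ^ 64`; signed entries are residues modulo `2 ^ 384` and
become nonnegative digits through fixed offsets. -/

/-! ### Packed integer arithmetic

The definitions of this section are evaluated by the kernel, hence the plain `Nat` operations. -/

/-- The relaxed offsets of the lattice site with layer indices `q / 6`, `q % 6` and `c`. -/
def siteX (q c : ℕ) : ℕ := relaxedOffset (Nat.div q 6) (Nat.mod q 6) c

def siteY (q c : ℕ) : ℕ := relaxedOffset (Nat.mod q 6) c (Nat.div q 6)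

def siteZ (q c : ℕ) : ℕ := relaxedOffset c (Nat.div q 6) (Nat.mod q 6)

def sqAdd (a b : ℕ) : ℕ := Nat.mul (Nat.add a b) (Nat.add a b)

/-- The square of the difference as `(a + b) ^ 2 - 4 * a * b`, where the subtraction of natural
numbers is never truncated. -/
def sqSub (a b : ℕ) : ℕ := Nat.sub (sqAdd a b) (Nat.mul 4 (Nat.mul a b))

/-- `horner6 Y f = ∑ i < 6, f i * Y ^ i`. -/
def horner6 (Y : ℕ) (f : ℕ → ℕ) : ℕ :=
  Nat.add (f 0) (Nat.mul Y (Nat.add (f 1) (Nat.mul Y (Nat.add (f 2) (Nat.mul Y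
    (Nat.add (f 3) (Nat.mul Y (Nat.add (f 4) (Nat.mul Y (f 5))))))))))

/-- The values of `f` at all sites, as digits in base `2 ^ w`. -/
def siteSum (w : ℕ) (f : ℕ → ℕ → ℕ) : ℕ :=
  horner6 (Nat.pow 2 (Nat.mul w 36)) fun a => horner6 (Nat.pow 2 (Nat.mul w 6)) fun b =>
    horner6 (Nat.pow 2 w) fun c => f (Nat.add (Nat.mul 6 a) b) c

/-- The lowest `n` digits of `x` in base `2 ^ 64`. -/
def low (n x : ℕ) : ℕ := Nat.land x (Nat.sub (Nat.pow 2 (Nat.mul 64 n)) 1)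

/-- The number all of whose lowest `n` digits in base `2 ^ 64` are one. -/
def ones (n : ℕ) : ℕ := Nat.div (Nat.sub (Nat.pow 2 (Nat.mul 64 n)) 1) 18446744073709551615

/-- The number all of whose lowest `n` digits in base `2 ^ 64` are `c`. -/
def constDigits (n c : ℕ) : ℕ := Nat.mul c (ones n)

def consDigit (x y : ℕ) : ℕ := Nat.add x (Nat.mul 18446744073709551616 y)

/-- Signed integers are represented by natural numbers modulo `2 ^ 384`. -/
def hessModulus : ℕ := Nat.pow 2 384

def hessMask : ℕ := Nat.sub hessModulus 1

def negMod (m x : ℕ) : ℕ := Nat.sub m x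

def subMod (m x y : ℕ) : ℕ := Nat.add x (negMod m y)

/-- Squared lengths are in units of `10 ^ (-32)`, so dividing by them gives inverse squares in units
of `2 ^ (-32)`. -/
def inverseScale : ℕ := Nat.mul (Nat.pow 2 32) (Nat.pow 10 32)

def inverseSq (a b c : ℕ) : ℕ := Nat.div inverseScale (Nat.add (Nat.add a b) c)

/-- The factor 95 encodes `95 / 16` in place of the true coefficient `6 = 96 / 16`. The difference
is the slack for displacements and rounding. -/
def isoCoeff₁ : ℕ := Nat.mul (Nat.mul (Nat.pow 10 32) (Nat.pow 2 124)) 95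

def isoCoeff₂ : ℕ := negMod hessModulus (Nat.mul (Nat.mul (Nat.pow 10 32) (Nat.pow 2 32)) 12)

def dirCoeff : ℕ := negMod hessModulus (Nat.mul 48 (Nat.pow 2 96))

def isoOfPowers (y4 y3 : ℕ) : ℕ :=
  Nat.land (Nat.mul y4 (Nat.add isoCoeff₁ (Nat.mul isoCoeff₂ y3))) hessMask

def dirOfPowers (y5 y3 : ℕ) : ℕ :=
  Nat.land (Nat.mul y5 (Nat.add (Nat.mul 168 y3) dirCoeff)) hessMask

/-- The isotropic part of the bond stiffness for the scaled inverse square distance `y`. -/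
def isoMod (y : ℕ) : ℕ :=
  isoOfPowers (Nat.mul (Nat.mul y y) (Nat.mul y y)) (Nat.mul (Nat.mul y y) y)

/-- The directional part of the bond stiffness for the scaled inverse square distance `y`. -/
def dirMod (y : ℕ) : ℕ :=
  dirOfPowers (Nat.mul (Nat.mul (Nat.mul y y) (Nat.mul y y)) y) (Nat.mul (Nat.mul y y) y)

/-- The rounded digit of a signed integer. -/
def digitOf (sh E : ℕ) : ℕ :=
  Nat.shiftRight (Nat.land (Nat.add E (Nat.pow 2 382)) hessMask) sh

def add4 (a b c d : ℕ) : ℕ := Nat.add (Nat.add a b) (Nat.add c d)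

/-- Each coordinate of the bond vector is the difference of the two offsets for two of the four sign
patterns and their sum for the other two; `f` and `g` stand for these two values. -/
def mix (f g a b c d : ℕ) : ℕ := Nat.add (Nat.mul f (Nat.add a b)) (Nat.mul g (Nat.add c d))

/-- The nine rounded entries of a `3 × 3` matrix. -/
def packMatrix (sh f1 f2 f3 g1 g2 g3 B0 B1 B2 B3 C0 C1 C2 C3 D0 D1 D2 D3
    p11 p12 p21 p22 p33 : ℕ) : ℕ :=
  consDigit (digitOf sh (Nat.add p11 (mix f1 g1 B0 B1 B2 B3)))
  (consDigit (digitOf sh (Nat.add p12 (mix f1 g1 C0 C1 C2 C3)))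
  (consDigit (digitOf sh (mix f1 g1 D0 D1 D2 D3))
  (consDigit (digitOf sh (Nat.add p21 (mix f2 g2 B0 B2 B1 B3)))
  (consDigit (digitOf sh (Nat.add p22 (mix f2 g2 C0 C2 C1 C3)))
  (consDigit (digitOf sh (mix f2 g2 D0 D2 D1 D3))
  (consDigit (digitOf sh (mix f3 g3 B0 B3 B1 B2))
  (consDigit (digitOf sh (mix f3 g3 C0 C3 C1 C2))
  (digitOf sh (Nat.add p33 (mix f3 g3 D0 D3 D1 D2))))))))))

def packInvariant (f1 f2 f3 g1 g2 g3 a1 a2 a3 na0 na1 na2 na3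
    b1 b2 b3 nb0 nb1 nb2 nb3 : ℕ) : ℕ :=
  packMatrix 322 f1 f2 f3 g1 g2 g3
    (Nat.mul nb0 f1) (Nat.mul nb1 f1) (Nat.mul b2 g1) (Nat.mul b3 g1)
    (Nat.mul nb0 f2) (Nat.mul b1 g2) (Nat.mul nb2 f2) (Nat.mul b3 g2)
    (Nat.mul nb0 f3) (Nat.mul b1 g3) (Nat.mul b2 g3) (Nat.mul nb3 f3)
    (add4 na0 na1 a2 a3) 0 0 (add4 na0 a1 na2 a3) (add4 na0 a1 a2 na3)

def invariantEven (f1 f2 f3 g1 g2 g3 a0 a1 a2 a3 b0 b1 b2 b3 : ℕ) : ℕ :=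
  packInvariant f1 f2 f3 g1 g2 g3 a1 a2 a3
    (negMod hessModulus a0) (negMod hessModulus a1) (negMod hessModulus a2)
    (negMod hessModulus a3) b1 b2 b3
    (negMod hessModulus b0) (negMod hessModulus b1) (negMod hessModulus b2)
    (negMod hessModulus b3)

def invariantOdd (f1 f2 f3 g1 g2 g3 a0 a1 a2 a3 b0 b1 b2 b3 : ℕ) : ℕ :=
  packInvariant f1 f2 f3 g1 g2 g3
    (negMod hessModulus a1) (negMod hessModulus a2) (negMod hessModulus a3) a0 a1 a2 a3
    (negMod hessModulus b1) (negMod hessModulus b2) (negMod hessModulus b3) b0 b1 b2 b3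

def packAxial (p11 p12 p21 p22 f1 f2 f3 g1 g2 g3 a1 a2 a3 na0 na1 na2 na3
    b1 b2 b3 nb0 nb1 nb2 nb3 : ℕ) : ℕ :=
  packMatrix 322 f1 f2 f3 g1 g2 g3
    (Nat.mul nb0 f1) (Nat.mul b1 f1) (Nat.mul nb2 g1) (Nat.mul b3 g1)
    (Nat.mul nb0 f2) (Nat.mul nb1 g2) (Nat.mul b2 f2) (Nat.mul b3 g2)
    (Nat.mul nb0 f3) (Nat.mul nb1 g3) (Nat.mul nb2 g3) (Nat.mul nb3 f3)
    (Nat.add p11 (add4 na0 a1 na2 a3)) p12 p21 (Nat.add p22 (add4 na0 na1 a2 a3))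
    (Nat.add (Nat.pow 2 358) (add4 na0 na1 na2 na3))

/-- `c` is the weight of the penalty for infinitesimal rotations, `nc` its negative. -/
def axialBlock (c nc x1 x2 y1 y2 f1 f2 f3 g1 g2 g3 a0 a1 a2 a3 b0 b1 b2 b3 : ℕ) : ℕ :=
  packAxial (Nat.mul c (Nat.mul x2 y2)) (Nat.mul nc (Nat.mul x2 y1))
    (Nat.mul nc (Nat.mul x1 y2)) (Nat.mul c (Nat.mul x1 y1))
    f1 f2 f3 g1 g2 g3 a1 a2 a3
    (negMod hessModulus a0) (negMod hessModulus a1) (negMod hessModulus a2)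
    (negMod hessModulus a3) b1 b2 b3
    (negMod hessModulus b0) (negMod hessModulus b1) (negMod hessModulus b2)
    (negMod hessModulus b3)

def selfBlock (f1 f2 f3 g1 g2 g3 a0 a1 a2 a3 b0 b1 b2 b3 : ℕ) : ℕ :=
  packMatrix 334 f1 f2 f3 g1 g2 g3
    (Nat.mul b0 f1) (Nat.mul b1 f1) (Nat.mul b2 g1) (Nat.mul b3 g1)
    (Nat.mul b0 f2) (Nat.mul b1 g2) (Nat.mul b2 f2) (Nat.mul b3 g2)
    (Nat.mul b0 f3) (Nat.mul b1 g3) (Nat.mul b2 g3) (Nat.mul b3 f3)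
    (add4 a0 a1 a2 a3) 0 0 (add4 a0 a1 a2 a3) (add4 a0 a1 a2 a3)

abbrev BlockFn : Type := ℕ → ℕ → ℕ → ℕ → ℕ → ℕ → ℕ → ℕ → ℕ → ℕ → ℕ → ℕ → ℕ → ℕ → ℕ

def withInverses (k : BlockFn) (f1 f2 f3 g1 g2 g3 y0 y1 y2 y3 : ℕ) : ℕ :=
  k f1 f2 f3 g1 g2 g3 (isoMod y0) (isoMod y1) (isoMod y2) (isoMod y3)
    (dirMod y0) (dirMod y1) (dirMod y2) (dirMod y3)

def withSquares (k : BlockFn) (f1 f2 f3 g1 g2 g3 q1 q2 q3 r1 r2 r3 : ℕ) : ℕ :=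
  withInverses k f1 f2 f3 g1 g2 g3
    (inverseSq q1 q2 q3) (inverseSq q1 r2 r3) (inverseSq r1 q2 r3) (inverseSq r1 r2 q3)

def blockEven (k : BlockFn) (x1 x2 x3 y1 y2 y3 : ℕ) : ℕ :=
  withSquares k (subMod hessModulus x1 y1) (subMod hessModulus x2 y2) (subMod hessModulus x3 y3)
    (Nat.add x1 y1) (Nat.add x2 y2) (Nat.add x3 y3)
    (sqSub x1 y1) (sqSub x2 y2) (sqSub x3 y3) (sqAdd x1 y1) (sqAdd x2 y2) (sqAdd x3 y3)

def blockOdd (k : BlockFn) (x1 x2 x3 y1 y2 y3 : ℕ) : ℕ :=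
  withSquares k (Nat.add x1 y1) (Nat.add x2 y2) (Nat.add x3 y3)
    (subMod hessModulus x1 y1) (subMod hessModulus x2 y2) (subMod hessModulus x3 y3)
    (sqAdd x1 y1) (sqAdd x2 y2) (sqAdd x3 y3) (sqSub x1 y1) (sqSub x2 y2) (sqSub x3 y3)

/-- Whether two sites lie on the same of the two sublattices. -/
def sameParity (q c q' c' : ℕ) : Bool :=
  Nat.beq (Nat.mod (Nat.add (Nat.add (Nat.div q 6) (Nat.add q c))
    (Nat.add (Nat.div q' 6) (Nat.add q' c'))) 2) 0

def onPair (f g : ℕ → ℕ → ℕ → ℕ → ℕ → ℕ → ℕ) (q c q' c' : ℕ) : ℕ :=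
  bif sameParity q c q' c' then
    f (siteX q c) (siteY q c) (siteZ q c) (siteX q' c') (siteY q' c') (siteZ q' c')
  else
    g (siteX q c) (siteY q c) (siteZ q c) (siteX q' c') (siteY q' c') (siteZ q' c')

def invariantPair (q c q' c' : ℕ) : ℕ :=
  onPair (blockEven invariantEven) (blockOdd invariantOdd) q c q' c'

/-- Any weight is sound, since the penalty vanishes on the displacements to which the bound is
applied. Its size matters only for the success of the factorization and for the bounds on the
entries. -/
def rotationWeight : ℕ := Nat.pow 2 249

def axialPair (q c q' c' : ℕ) : ℕ :=
  onPair
    (fun x1 x2 x3 y1 y2 y3 => blockEven (axialBlock rotationWeight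
      (negMod hessModulus rotationWeight) x1 x2 y1 y2) x1 x2 x3 y1 y2 y3)
    (fun x1 x2 x3 y1 y2 y3 => blockOdd (axialBlock (negMod hessModulus rotationWeight)
      rotationWeight x1 x2 y1 y2) x1 x2 x3 y1 y2 y3)
    q c q' c'

def selfPair (q c q' c' : ℕ) : ℕ :=
  onPair (blockEven selfBlock) (blockOdd selfBlock) q c q' c'

/-- Approximate on-site stiffness matrices: for each site the six entries on and above the
diagonal, with 24 bits each. -/
def selfTable : List ℕ := [
    0xacfbcf80172fd2a34d80172f803617d2a34de7af2c8021c7ed9f0c8021c7801389ed9f0cf13302803317f3dbf5803317801855f3dbf5f41d77803631f578b3803631800fb4f578b3f584b4802b29f601d2802b2980128ff601d2f62cbd800f31f62cbd800f31800f31f62cbd,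
    0xad00d28030d6d2376780176f805ccad24359e79cd0806c62ed40ad802f25804149ed9638f126f1809813f377338036b1803498f3c868f41122809fdef4fbbd803c6d803397f55b35f5683580743bf56835802b9d802b9df5db0af601d2802b29f584b480128f802b29f601d2,
    0xacfa21803e0dd19d0e800618803dfcd1bafae770fd80c50cec8dcc80307c804ae3ed2eebf100f58104c4f28c03803e72804474f364caf3cbf780ed13f3cbf7803f43803f43f4e6e1f4fbbd809fdef41122803397803c6df55b35f578b3803631f41d77800fb4803631f578b3,
    0xacbb9c807d76d07ea87ffc09802789d092d1e6f173814eeeead73e80185880289bebc424f019598152a6f01959803e3c803e3cf1edb6f28c038104c4f100f5804474803e72f364caf37733809813f126f18034988036b1f3c868f3dbf5803317f13302801855803317f3dbf5,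
    0xabaa8181f1f1cb3ce17ffb97800e2ccabe5ae2b9ee817eb8e2b9ee800e57800e57e6424dead73e814eeee6f17380289b801858ebc424ec8dcc80c50ce770fd804ae380307ced2eebed40ad806c62e79cd0804149802f25ed9638ed9f0c8021c7e7af2c8013898021c7ed9f0c,
    0xa1a903898167a1a90380000b80000badd7d5cb3ce181f1f1abaa81800e2c7ffb97cabe5ad07ea8807d76acbb9c8027897ffc09d092d1d19d0e803e0dacfa21803dfc800618d1bafad237678030d6ad00d2805cca80176fd24359d2a34d80172facfbcf80361780172fd2a34d,
    0xad00d280176fd243598030d6805ccad23767e79cd0802f25ed9638806c62804149ed40adf126f18036b1f3c868809813803498f37733f41122803c6df55b35809fde803397f4fbbdf56835802b9df5db0a80743b802b9df56835f601d280128ff601d2802b29802b29f584b4,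
    0xacf79e8042bed25a748042be80e7f3d25a74e791b58080e4ed53668080e480a452ed5366f121d480a9f4f3805680a9f480965ef38056f40acf80a9daf4ee1b80a9da8085d0f4ee1bf55248807df1f55248807df1807df1f55248f5db0a802b9df56835802b9d80743bf56835,
    0xacec0a805a9fd1f4e88031fd80e7bfd20a62e7747680d1e8ecbdc1808fd780d04ded587df109148119b3f2a81a80b84680c445f34370f3d40e80ff9df3d40e80bcb080bcb0f4a4b8f4ee1b80a9daf40acf8085d080a9daf4ee1bf55b35803c6df41122803397809fdef4fbbd,
    0xacb5a2808290d0a9e98001d9807e91d0c2dfe6ff99815b89eb012080743a80a3cdec22c3f0345c8159e4f0345c80b93780b937f220aef2a81a8119b3f1091480c44580b846f34370f3805680a9f4f121d480965e80a9f4f38056f3c8688036b1f126f1803498809813f37733,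
    0xaba9b881eb3fcb50567ff19c80329fcadd1de2bff7817938e2bff7803b9a803b9ae6844eeb0120815b89e6ff9980a3cd80743aec22c3ecbdc180d1e8e7747680d04d808fd7ed587ded53668080e4e791b580a4528080e4ed5366ed9638802f25e79cd0804149806c62ed40ad,
    0xa1a957897553a1a9578001f18001f1addef3cb505681eb3faba9b880329f7ff19ccadd1dd0a9e9808290acb5a2807e918001d9d0c2dfd1f4e8805a9facec0a80e7bf8031fdd20a62d25a748042beacf79e80e7f38042bed25a74d2435980176fad00d2805cca8030d6d23767,
    0xacfa21800618d1bafa803e0d803dfcd19d0ee770fd80307ced2eeb80c50c804ae3ec8dccf100f5803e72f364ca8104c4804474f28c03f3cbf7803f43f4e6e180ed13803f43f3cbf7f4fbbd803397f55b35809fde803c6df41122f578b3800fb4f578b3803631803631f41d77,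
    0xacec0a8031fdd20a62805a9f80e7bfd1f4e8e77476808fd7ed587d80d1e880d04decbdc1f1091480b846f343708119b380c445f2a81af3d40e80bcb0f4a4b880ff9d80bcb0f3d40ef4ee1b8085d0f4ee1b80a9da80a9daf40acff55b35803397f4fbbd803c6d809fdef41122,
    0xacd045807cecd25156807cec817dd6d25156e76e0980ec91ecfe2380ec9181248fecfe23f10caa8134f1f2b51d8134f18127aaf2b51df3b421811358f3b421811358811358f3b421f4a4b880bcb0f3d40e80bcb080ff9df3d40ef4e6e1803f43f3cbf7803f4380ed13f3cbf7,
    0xac946880bc84d14997805959814bc7d158e6e701f5817157eb490a81009081450dec7f08f05ac581783df05ac5813947813947f1e239f2b51d8134f1f10caa8127aa8134f1f2b51df3437080b846f1091480c4458119b3f2a81af364ca803e72f100f58044748104c4f28c03,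
    0xab9d4081ebfdcb7cf4800729807a8ecb1a68e2df97819ae8e2df9780d20a80d20ae739b3eb490a817157e701f581450d810090ec7f08ecfe2380ec91e76e0981248f80ec91ecfe23ed587d808fd7e7747680d04d80d1e8ecbdc1ed2eeb80307ce770fd804ae380c50cec8dcc,
    0xa1aabd895870a1aabd800aca800acaade39bcb7cf481ebfdab9d40807a8e800729cb1a68d1499780bc84ac9468814bc7805959d158e6d25156807cecacd045817dd6807cecd25156d20a628031fdacec0a80e7bf805a9fd1f4e8d1bafa800618acfa21803dfc803e0dd19d0e,
    0xacbb9c7ffc09d092d1807d76802789d07ea8e6f173801858ebc424814eee80289bead73ef01959803e3cf1edb68152a6803e3cf01959f28c03804474f364ca8104c4803e72f100f5f37733803498f3c8688098138036b1f126f1f3dbf5801855f3dbf5803317803317f13302,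
    0xacb5a28001d9d0c2df808290807e91d0a9e9e6ff9980743aec22c3815b8980a3cdeb0120f0345c80b937f220ae8159e480b937f0345cf2a81a80c445f343708119b380b846f10914f3805680965ef3805680a9f480a9f4f121d4f3c868803498f377338036b1809813f126f1,
    0xac9468805959d158e680bc84814bc7d14997e701f5810090ec7f0881715781450deb490af05ac5813947f1e23981783d813947f05ac5f2b51d8127aaf2b51d8134f18134f1f10caaf3437080c445f2a81a80b8468119b3f10914f364ca804474f28c03803e728104c4f100f5,
    0xac3f8280fd31d161a980fd318221d8d161a9e6d51981a206eb120681a20681a0a6eb1206efea6081a59befea6081a59b81a59befea60f1e239813947f05ac581394781783df05ac5f220ae80b937f0345c80b9378159e4f0345cf1edb6803e3cf01959803e3c8152a6f01959,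
    0xab41458266ddcc0f8380c79f81d25acbbf81e2bc3881d9e1e2bc3881e2c981e2c9e743c0eb120681a206e6d51981a0a681a206eb1206ec7f08810090e701f581450d817157eb490aec22c380743ae6ff9980a3cd815b89eb0120ebc424801858e6f17380289b814eeeead73e,
    0xa18397894f1fa183978058bf8058bfadd337cc0f838266ddab414581d25a80c79fcbbf81d161a980fd31ac3f828221d880fd31d161a9d158e6805959ac9468814bc780bc84d14997d0c2df8001d9acb5a2807e91808290d0a9e9d092d17ffc09acbb9c802789807d76d07ea8,
    0xabaa817ffb97cabe5a81f1f1800e2ccb3ce1e2b9ee800e57e6424d817eb8800e57e2b9eeead73e80289bebc424814eee801858e6f173ec8dcc804ae3ed2eeb80c50c80307ce770fded40ad804149ed9638806c62802f25e79cd0ed9f0c801389ed9f0c8021c78021c7e7af2c,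
    0xaba9b87ff19ccadd1d81eb3f80329fcb5056e2bff7803b9ae6844e817938803b9ae2bff7eb012080a3cdec22c3815b8980743ae6ff99ecbdc180d04ded587d80d1e8808fd7e77476ed536680a452ed53668080e48080e4e791b5ed9638804149ed40ad802f25806c62e79cd0,
    0xab9d40800729cb1a6881ebfd807a8ecb7cf4e2df9780d20ae739b3819ae880d20ae2df97eb490a81450dec7f08817157810090e701f5ecfe2381248fecfe2380ec9180ec91e76e09ed587d80d04decbdc1808fd780d1e8e77476ed2eeb804ae3ec8dcc80307c80c50ce770fd,
    0xab414580c79fcbbf818266dd81d25acc0f83e2bc3881e2c9e743c081d9e181e2c9e2bc38eb120681a0a6eb120681a20681a206e6d519ec7f0881450deb490a810090817157e701f5ec22c380a3cdeb012080743a815b89e6ff99ebc42480289bead73e801858814eeee6f173,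
    0xaa152182e8f5c8c8a082e8f5837644c8c8a0df6aef8231e1df6aef8231e18231e1df6aefe743c081e2c9e2bc3881e2c981d9e1e2bc38e739b380d20ae2df9780d20a819ae8e2df97e6844e803b9ae2bff7803b9a817938e2bff7e6424d800e57e2b9ee800e57817eb8e2b9ee,
    0xa078848a29d3a0788482ebad82ebadacf8a1c8c8a082e8f5aa152183764482e8f5c8c8a0cbbf8180c79fab414581d25a8266ddcc0f83cb1a68800729ab9d40807a8e81ebfdcb7cf4cadd1d7ff19caba9b880329f81eb3fcb5056cabe5a7ffb97abaa81800e2c81f1f1cb3ce1,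
    0xa1a90380000badd7d589816780000ba1a903cb3ce1800e2ccabe5a81f1f17ffb97abaa81d07ea8802789d092d1807d767ffc09acbb9cd19d0e803dfcd1bafa803e0d800618acfa21d23767805ccad243598030d680176fad00d2d2a34d803617d2a34d80172f80172facfbcf,
    0xa1a9578001f1addef38975538001f1a1a957cb505680329fcadd1d81eb3f7ff19caba9b8d0a9e9807e91d0c2df8082908001d9acb5a2d1f4e880e7bfd20a62805a9f8031fdacec0ad25a7480e7f3d25a748042be8042beacf79ed24359805ccad2376780176f8030d6ad00d2,
    0xa1aabd800acaade39b895870800acaa1aabdcb7cf4807a8ecb1a6881ebfd800729ab9d40d14997814bc7d158e680bc84805959ac9468d25156817dd6d25156807cec807cecacd045d20a6280e7bfd1f4e88031fd805a9facec0ad1bafa803dfcd19d0e800618803e0dacfa21,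
    0xa183978058bfadd337894f1f8058bfa18397cc0f8381d25acbbf818266dd80c79fab4145d161a98221d8d161a980fd3180fd31ac3f82d158e6814bc7d1499780595980bc84ac9468d0c2df807e91d0a9e98001d9808290acb5a2d092d1802789d07ea87ffc09807d76acbb9c,
    0xa0788482ebadacf8a18a29d382ebada07884c8c8a0837644c8c8a082e8f582e8f5aa1521cbbf8181d25acc0f8380c79f8266ddab4145cb1a68807a8ecb7cf480072981ebfdab9d40cadd1d80329fcb50567ff19c81eb3faba9b8cabe5a800e2ccb3ce17ffb9781f1f1abaa81,
    0x96adfa8bd27d96adfa8bd27d8bd27d96adfaacf8a182ebada0788482ebad8a29d3a07884add3378058bfa183978058bf894f1fa18397ade39b800acaa1aabd800aca895870a1aabdaddef38001f1a1a9578001f1897553a1a957add7d580000ba1a90380000b898167a1a903]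

def selfEntry (q c i : ℕ) : ℕ :=
  Nat.land (Nat.shiftRight (List.getD selfTable q 0) (Nat.add (Nat.mul 144 c) (Nat.mul 24 i)))
    16777215

def selfMatrix (q c : ℕ) : ℕ :=
  consDigit (selfEntry q c 0) (consDigit (selfEntry q c 1) (consDigit (selfEntry q c 2)
  (consDigit (selfEntry q c 1) (consDigit (selfEntry q c 3) (consDigit (selfEntry q c 4)
  (consDigit (selfEntry q c 2) (consDigit (selfEntry q c 4) (selfEntry q c 5))))))))

/-- All digits of a `3 × 3` matrix are `a`, and `b` is added on the diagonal. -/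
def diagShiftOf (a b : ℕ) : ℕ :=
  Nat.add (constDigits 9 a) (Nat.mul b (Nat.add 1 (Nat.add (Nat.pow 2 256) (Nat.pow 2 512))))

/-- The digit offset, and the spectral bound that is subtracted on the diagonal. -/
def diagShift : ℕ := diagShiftOf (Nat.pow 2 47) 339000000000

def rowPart (x d : ℕ) : ℕ := low 3 (Nat.shiftRight x (Nat.mul 192 d))

/-- Three consecutive digits of a row of the reduced Hessian, left of or on the diagonal. -/
def rowTerm (blk : ℕ → ℕ → ℕ → ℕ → ℕ) (q c d q' c' : ℕ) : ℕ :=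
  bif Nat.ble q' q then
    bif Nat.beq q' q then
      bif Nat.ble c' c then
        bif Nat.beq c' c then
          rowPart (Nat.sub (Nat.add (blk q c q' c') (Nat.mul 16777216 (selfMatrix q c)))
            diagShift) d
        else rowPart (blk q c q' c') d
      else 0
    else rowPart (blk q c q' c') d
  else 0

/-- A row of the reduced Hessian, packed in base `2 ^ 64`. -/
def hessRow (blk : ℕ → ℕ → ℕ → ℕ → ℕ) (q c d : ℕ) : ℕ := siteSum 192 (rowTerm blk q c d)

def chunk (U q : ℕ) : ℕ := low 18 (Nat.shiftRight U (Nat.mul 1152 q))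

/-- The digit of `U` at position `18 * q + r` in base `2 ^ 64`. -/
def digitAt (U q r : ℕ) : ℕ := low 1 (Nat.shiftRight (chunk U q) (Nat.mul 64 r))

def gramRow (q r M : ℕ) (Us : List ℕ) : ℕ :=
  Us.rec 0 fun U _ ih => Nat.add (Nat.mul (digitAt U q r) (Nat.land U M)) ih

def newtonSqrt (n x : ℕ) : ℕ := Nat.shiftRight (Nat.add x (Nat.div n x)) 1

/-- The bits of all digits from `2 ^ 26` upwards. -/
def highMask : ℕ := constDigits 648 18446744073642442752

def digitOffset : ℕ := 33554432

/-- The next row of the Cholesky factor. No property of this function is needed. -/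
def factorRow (j t N e : ℕ) : ℕ :=
  let n := Nat.sub t (Nat.pow 2 50)
  let p := newtonSqrt n (newtonSqrt n (newtonSqrt n (newtonSqrt n (newtonSqrt n
    (newtonSqrt n (Nat.pow 2 22))))))
  -- All digits are divided by the pivot `p` at once, by multiplication with the fixed-point
  -- reciprocal `m`: `q0` is a first quotient, `q1` the quotient of the remainder. The `2 ^ 50`
  -- contained in each digit of `N` contributes `m` to the quotient, which is exchanged for
  -- `digitOffset`.
  let m := Nat.div (Nat.pow 2 50) p
  let hi := Nat.land (Nat.shiftRight N 24) (Nat.mul e 134217727)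
  let q0 := Nat.land (Nat.shiftRight (Nat.mul hi m) 26) (Nat.mul e 274877906943)
  let R := Nat.sub N (Nat.mul p q0)
  let q1 := Nat.land (Nat.shiftRight (Nat.mul R m) 50) (Nat.mul e 16383)
  let q := Nat.sub (Nat.add q0 q1) (Nat.mul e (Nat.sub m digitOffset))
  Nat.add (low j q) (Nat.mul (Nat.add p digitOffset) (Nat.pow 2 (Nat.mul 64 j)))

/-- The digits of row `j` of the matrix, up to products of digit offsets. -/
def rowSide (e M A SU s x : ℕ) : ℕ :=
  Nat.add (Nat.land A M) (Nat.add (Nat.mul digitOffset (Nat.land SU M))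
    (Nat.mul (Nat.add (Nat.mul digitOffset s) x) e))

/-- The digits of row `j` of the Gram matrix, up to products of digit offsets. -/
def gramSide (e T κ : ℕ) : ℕ :=
  Nat.add T (Nat.mul (Nat.add (Nat.pow 2 60) (Nat.mul κ (Nat.mul digitOffset digitOffset))) e)

/-- Whether `U` is an admissible next row of the Cholesky factor. -/
def acceptRow (P e q r A SU κ T U : ℕ) : Bool :=
  let Z := rowSide e (Nat.sub P 1) A (Nat.add SU U) (digitAt (Nat.add SU U) q r) digitOffset
  let Y := gramSide e (Nat.add T (Nat.mul (digitAt U q r) U)) (Nat.succ κ)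
  bif Nat.ble Y Z then
    bif Nat.beq (Nat.land (Nat.sub Z Y) highMask) 0 then
      bif Nat.beq (Nat.land U highMask) 0 then
        bif Nat.ble P U then false else bif Nat.ble P (Nat.sub Z Y) then false else true
      else false
    else false
  else false

/-- The `2 ^ 50` added to every digit is meant to keep the signed entries of the Schur complement
nonnegative; `factorRow` removes it again. -/
def nextRow (P e q r j A SU κ T : ℕ) : ℕ :=
  let N := Nat.sub (rowSide e (Nat.sub P 1) A SU (digitAt SU q r) (Nat.pow 2 50)) (gramSide e T κ)
  factorRow j (digitAt N q r) N e

def choleskyStep (q r j A SU κ : ℕ) (Us : List ℕ) (k : ℕ → Bool) : Bool :=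
  let P := Nat.pow 2 (Nat.mul 64 (Nat.succ j))
  let e := ones (Nat.succ j)
  let T := gramRow q r (Nat.sub P 1) Us
  let U := nextRow P e q r j A SU κ T
  bif acceptRow P e q r A SU κ T U then k U else false

/-- Cholesky factorization of the reduced Hessian, from the last row to the first. The number of
known rows of the factor is `κ`, their sum is `SU`, their list `Us`. -/
def cholesky (blk : ℕ → ℕ → ℕ → ℕ → ℕ) (n : ℕ) : ℕ → ℕ → List ℕ → Bool :=
  n.rec (fun _ _ _ => true) fun q ihq =>
    (nat_lit 6).rec ihq fun c ihc => (nat_lit 3).rec ihc fun d ihd κ SU Us =>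
      choleskyStep q (Nat.add (Nat.mul 3 c) d) (Nat.add (Nat.mul 18 q) (Nat.add (Nat.mul 3 c) d))
        (hessRow blk q c d) SU κ Us fun U => ihd (Nat.succ κ) (Nat.add SU U) (U :: Us)

def allSites (f : ℕ → ℕ → Bool) : Bool :=
  (nat_lit 36).rec true fun q ih => (nat_lit 6).rec ih fun c ihc => bif f q c then ihc else false

/-- Whether every digit of `x - y` in base `2 ^ w` is below `2 ^ b`; `m` holds the other bits. -/
def digitsBelow (P m x y : ℕ) : Bool :=
  bif Nat.ble y x then
    bif Nat.ble P (Nat.sub x y) then false else Nat.beq (Nat.land (Nat.sub x y) m) 0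
  else false

/-- Whether the table of on-site stiffness matrices is correct up to rounding. -/
def selfCheck (q c : ℕ) : Bool :=
  digitsBelow (Nat.pow 2 576) (constDigits 9 18446744073709547520)
    (siteSum 0 (selfPair q c))
    (Nat.add (Nat.mul 4096 (selfMatrix q c))
      (constDigits 9 (Nat.sub (Nat.mul 216 (Nat.pow 2 48)) (Nat.pow 2 35))))

/-! The gradient, with 72 binary places. -/

def gradModulus : ℕ := Nat.pow 2 640

def gradMask : ℕ := Nat.sub gradModulus 1

def gradScale : ℕ := Nat.mul (Nat.pow 2 72) (Nat.pow 10 32)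

def gradCoeff₁ : ℕ := Nat.mul 6 (Nat.pow 2 216)

def forceOfPowers (y4 y3 : ℕ) : ℕ :=
  Nat.mul y4 (Nat.add gradCoeff₁ (negMod gradModulus (Nat.mul 12 y3)))

def forceOfInverse (y : ℕ) : ℕ :=
  forceOfPowers (Nat.mul (Nat.mul y y) (Nat.mul y y)) (Nat.mul (Nat.mul y y) y)

def gradInverse (a b c : ℕ) : ℕ := Nat.div gradScale (Nat.add (Nat.add a b) c)

def forceMod (a b c : ℕ) : ℕ := forceOfInverse (gradInverse a b c)

def gradDigit (E : ℕ) : ℕ := Nat.land (Nat.add E (Nat.pow 2 630)) gradMask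

def packForce (f1 f2 f3 g1 g2 g3 a0 a1 a2 a3 : ℕ) : ℕ :=
  Nat.add (gradDigit (mix f1 g1 a0 a1 a2 a3)) (Nat.mul (Nat.pow 2 704)
    (Nat.add (gradDigit (mix f2 g2 a0 a2 a1 a3)) (Nat.mul (Nat.pow 2 704)
      (gradDigit (mix f3 g3 a0 a3 a1 a2)))))

def forceBlock (f1 f2 f3 g1 g2 g3 q1 q2 q3 r1 r2 r3 : ℕ) : ℕ :=
  packForce f1 f2 f3 g1 g2 g3
    (forceMod q1 q2 q3) (forceMod q1 r2 r3) (forceMod r1 q2 r3) (forceMod r1 r2 q3)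

def forceEven (x1 x2 x3 y1 y2 y3 : ℕ) : ℕ :=
  forceBlock (subMod gradModulus x1 y1) (subMod gradModulus x2 y2) (subMod gradModulus x3 y3)
    (Nat.add x1 y1) (Nat.add x2 y2) (Nat.add x3 y3)
    (sqSub x1 y1) (sqSub x2 y2) (sqSub x3 y3) (sqAdd x1 y1) (sqAdd x2 y2) (sqAdd x3 y3)

def forceOdd (x1 x2 x3 y1 y2 y3 : ℕ) : ℕ :=
  forceBlock (Nat.add x1 y1) (Nat.add x2 y2) (Nat.add x3 y3)
    (subMod gradModulus x1 y1) (subMod gradModulus x2 y2) (subMod gradModulus x3 y3)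
    (sqAdd x1 y1) (sqAdd x2 y2) (sqAdd x3 y3) (sqSub x1 y1) (sqSub x2 y2) (sqSub x3 y3)

def threeOnes (B : ℕ) : ℕ := Nat.add 1 (Nat.mul B (Nat.add 1 B))

def forceOnes : ℕ := threeOnes (Nat.pow 2 704)

/-- Whether the net force on the atoms over a site is below the tolerance. -/
def forceCheck (q c : ℕ) : Bool :=
  digitsBelow (Nat.pow 2 2112) (Nat.mul forceOnes (Nat.sub (Nat.pow 2 704) (Nat.pow 2 512)))
    (siteSum 0 (onPair forceEven forceOdd q c))
    (Nat.mul (Nat.sub (Nat.mul 216 (Nat.pow 2 630)) (Nat.pow 2 511)) forceOnes)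

/-! The distances of the atoms are at least one. -/

def farEnough (a b c : ℕ) : Bool := Nat.ble (Nat.pow 10 32) (Nat.add (Nat.add a b) c)

def separatedBlock (same : Bool) (q1 q2 q3 r1 r2 r3 : ℕ) : Bool :=
  bif (bif same then true else farEnough q1 q2 q3) then
    bif farEnough q1 r2 r3 then bif farEnough r1 q2 r3 then farEnough r1 r2 q3 else false else false
  else false

def separatedPair (q c q' c' : ℕ) : Bool :=
  bif sameParity q c q' c' then
    separatedBlock (bif Nat.beq q q' then Nat.beq c c' else false)
      (sqSub (siteX q c) (siteX q' c')) (sqSub (siteY q c) (siteY q' c'))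
      (sqSub (siteZ q c) (siteZ q' c')) (sqAdd (siteX q c) (siteX q' c'))
      (sqAdd (siteY q c) (siteY q' c')) (sqAdd (siteZ q c) (siteZ q' c'))
  else
    separatedBlock false
      (sqAdd (siteX q c) (siteX q' c')) (sqAdd (siteY q c) (siteY q' c'))
      (sqAdd (siteZ q c) (siteZ q' c')) (sqSub (siteX q c) (siteX q' c'))
      (sqSub (siteY q c) (siteY q' c')) (sqSub (siteZ q c) (siteZ q' c'))

def separationCheck (q c : ℕ) : Bool := allSites (separatedPair q c)

/-! ### Digits -/

section Digits

open Finset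

/-- The digit of `x` at position `l` in base `b`. -/
def digit (b x l : ℕ) : ℕ := x / b ^ l % b

theorem digit_lt {b : ℕ} (hb : 0 < b) (x l : ℕ) : digit b x l < b := Nat.mod_lt _ hb

theorem mod_pow_eq_sum_digit (b x n : ℕ) :
    x % b ^ n = ∑ l ∈ range n, digit b x l * b ^ l := by
  induction n with
  | zero => simp [Nat.mod_one]
  | succ n ih => rw [sum_range_succ, ← ih, Nat.mod_pow_succ, digit]; ring

theorem sum_digit_lt {b n : ℕ} {z : ℕ → ℕ} (hz : ∀ l < n, z l < b) :
    ∑ l ∈ range n, z l * b ^ l < b ^ n := by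
  induction n with
  | zero => simp
  | succ n ih =>
    rw [sum_range_succ, pow_succ]
    have h1 := ih fun l hl => hz l (by omega)
    have h2 := hz n (by omega)
    nlinarith [Nat.mul_le_mul_right (b ^ n) h2]

theorem digit_sum {b n : ℕ} {z : ℕ → ℕ} (hz : ∀ l < n, z l < b) {k : ℕ} (hk : k < n) :
    digit b (∑ l ∈ range n, z l * b ^ l) k = z k := by
  have hb : 0 < b := by have := hz k hk; omega
  have h1 : ∑ l ∈ range n, z l * b ^ l =
      (∑ l ∈ range k, z l * b ^ l) + b ^ k * (z k + b * ∑ l ∈ range (n - k - 1),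
        z (k + 1 + l) * b ^ l) := by
    obtain ⟨m, rfl⟩ : ∃ m, n = k + 1 + m := ⟨n - k - 1, by omega⟩
    rw [sum_range_add, sum_range_succ, show k + 1 + m - k - 1 = m by omega, mul_add, mul_sum,
      mul_sum, add_assoc]
    congr 1
    rw [mul_comm (z k)]
    congr 1
    refine sum_congr rfl fun l _ => ?_
    rw [pow_add, pow_succ]; ring
  rw [h1, digit, Nat.add_mul_div_left _ _ (pow_pos hb k),
    Nat.div_eq_of_lt (sum_digit_lt fun l hl => hz l (by omega)), zero_add, Nat.add_mul_mod_self_left,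
    Nat.mod_eq_of_lt (hz k hk)]

theorem digit_ext {b n : ℕ} {z y : ℕ → ℕ} (hz : ∀ l < n, z l < b) (hy : ∀ l < n, y l < b)
    (h : ∑ l ∈ range n, z l * b ^ l = ∑ l ∈ range n, y l * b ^ l) {k : ℕ} (hk : k < n) :
    z k = y k := by
  rw [← digit_sum hz hk, h, digit_sum hy hk]

theorem digit_digit (b m x i e : ℕ) (he : e < m) :
    digit b (digit (b ^ m) x i) e = digit b x (m * i + e) := by
  obtain ⟨k, rfl⟩ : ∃ k, m = e + 1 + k := ⟨m - e - 1, by omega⟩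
  unfold digit
  rw [pow_add b (e + 1), pow_succ b e, mul_assoc (b ^ e), Nat.mod_mul_right_div_self,
    Nat.mod_mul_right_mod, Nat.div_div_eq_div_mul, ← mul_assoc, ← pow_succ, ← pow_add, ← pow_mul,
    ← pow_add]

/-- In each digit the mask has exactly the bits from `b` to `w - 1` set, so one bitwise operation
tests all digits. -/
theorem digit_lt_of_land_eq_zero {w b n x : ℕ} (hbw : b ≤ w)
    (h : x &&& ((2 ^ w - 2 ^ b) * ∑ l ∈ range n, (2 ^ w) ^ l) = 0) {l : ℕ} (hl : l < n) :
    digit (2 ^ w) x l < 2 ^ b := by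
  refine Nat.lt_pow_two_of_testBit _ fun i hi => ?_
  rw [digit, ← pow_mul, Nat.testBit_mod_two_pow, Nat.testBit_div_two_pow]
  by_cases hiw : i < w
  · have hm : digit (2 ^ w) ((2 ^ w - 2 ^ b) * ∑ l ∈ range n, (2 ^ w) ^ l) l = 2 ^ w - 2 ^ b := by
      rw [mul_sum]
      exact digit_sum (z := fun _ => 2 ^ w - 2 ^ b)
        (fun _ _ => Nat.sub_lt (by positivity) (by positivity)) hl
    have ht : (digit (2 ^ w) ((2 ^ w - 2 ^ b) * ∑ l ∈ range n, (2 ^ w) ^ l) l).testBit i = true := by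
      obtain ⟨k, rfl⟩ : ∃ k, w = b + k := ⟨w - b, by omega⟩
      rw [hm, pow_add, show 2 ^ b * 2 ^ k - 2 ^ b = 2 ^ b * (2 ^ k - 1) by
        rw [Nat.mul_sub_one], Nat.testBit_two_pow_mul, Nat.testBit_two_pow_sub_one]
      simp; omega
    rw [digit, ← pow_mul, Nat.testBit_mod_two_pow, Nat.testBit_div_two_pow] at ht
    have h0 := congrArg (fun y => y.testBit (i + w * l)) h
    simp only [Nat.testBit_and, Nat.zero_testBit] at h0
    simp only [Bool.and_eq_true] at ht
    rw [ht.2, Bool.and_true] at h0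
    simp [h0]
  · simp [hiw]

theorem ones_eq (n : ℕ) : ones n = ∑ l ∈ range n, (2 ^ 64) ^ l := by
  have : (∑ l ∈ range n, (2 ^ 64) ^ l) * (2 ^ 64 - 1) = (2 ^ 64) ^ n - 1 :=
    Nat.geomSum_eq (m := 2 ^ 64) (by norm_num) n ▸ Nat.div_mul_cancel
      (by simpa only [one_pow] using Nat.sub_dvd_pow_sub_pow (2 ^ 64) 1 n)
  have h : ones n = ((2 ^ 64) ^ n - 1) / (2 ^ 64 - 1) := by
    rw [← pow_mul]; rfl
  rw [h, ← this, Nat.mul_div_cancel _ (by norm_num)]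

theorem low_eq (n x : ℕ) : low n x = x % (2 ^ 64) ^ n := by
  rw [← pow_mul, ← Nat.and_two_pow_sub_one_eq_mod]; rfl

theorem digitAt_eq (U q r : ℕ) (hr : r < 18) : digitAt U q r = digit (2 ^ 64) U (18 * q + r) := by
  rw [← digit_digit (2 ^ 64) 18 U q r hr]
  simp only [digitAt, chunk, low_eq, digit, pow_one]
  change (U >>> (1152 * q) % (2 ^ 64) ^ 18) >>> (64 * r) % 2 ^ 64 = _
  rw [Nat.shiftRight_eq_div_pow, Nat.shiftRight_eq_div_pow, pow_mul 2 64 r,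
    show 2 ^ (1152 * q) = ((2 ^ 64) ^ 18) ^ q by
      rw [show 1152 = 64 * 18 from rfl, pow_mul, pow_mul]]

end Digits

/-! ### Soundness of the packed Cholesky factorization -/

section Cholesky

open Finset

/-- Admissible packed rows: `648` digits below `2 ^ 26`. -/
def IsFactorRow (U : ℕ) : Prop :=
  U < (2 ^ 64) ^ 648 ∧ ∀ l < 648, digit (2 ^ 64) U l < 2 ^ 26

theorem sum_digit_le (Us : List ℕ) (h : ∀ U ∈ Us, IsFactorRow U) {l : ℕ} (hl : l < 648) :
    (Us.map fun U => digit (2 ^ 64) U l).sum ≤ Us.length * 2 ^ 26 := by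
  induction Us with
  | nil => simp
  | cons U Us ih =>
    have h1 := (h U (by simp)).2 l hl
    have h2 := ih fun V hV => h V (by simp [hV])
    simp only [List.map_cons, List.sum_cons, List.length_cons]
    omega

theorem sum_mul_digit_le (Us : List ℕ) (h : ∀ U ∈ Us, IsFactorRow U) {j l : ℕ} (hj : j < 648)
    (hl : l < 648) :
    (Us.map fun U => digit (2 ^ 64) U j * digit (2 ^ 64) U l).sum ≤ Us.length * 2 ^ 52 := by
  induction Us with
  | nil => simp
  | cons U Us ih =>
    have h1 := Nat.mul_le_mul ((h U (by simp)).2 j hj).le ((h U (by simp)).2 l hl).le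
    have h2 := ih fun V hV => h V (by simp [hV])
    simp only [List.map_cons, List.sum_cons, List.length_cons]
    omega

theorem sum_factorRows (Us : List ℕ) (h : ∀ U ∈ Us, IsFactorRow U) :
    Us.sum = ∑ l ∈ range 648, (Us.map fun U => digit (2 ^ 64) U l).sum * (2 ^ 64) ^ l := by
  induction Us with
  | nil => simp
  | cons U Us ih =>
    rw [List.sum_cons, ih fun V hV => h V (by simp [hV])]
    simp only [List.map_cons, List.sum_cons, add_mul, sum_add_distrib]
    rw [← mod_pow_eq_sum_digit, Nat.mod_eq_of_lt (h U (by simp)).1]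

/-- At most 648 digits below `2 ^ 26` are added, so no carry occurs. -/
theorem digit_sum_factorRows (Us : List ℕ) (h : ∀ U ∈ Us, IsFactorRow U) (hlen : Us.length ≤ 648)
    {l : ℕ} (hl : l < 648) :
    digit (2 ^ 64) Us.sum l = (Us.map fun U => digit (2 ^ 64) U l).sum := by
  rw [sum_factorRows Us h]
  refine digit_sum (fun k hk => ?_) hl
  have := sum_digit_le Us h hk
  omega

theorem gramRow_eq (q r j : ℕ) (Us : List ℕ) (hr : r < 18) (hj : j = 18 * q + r) :
    gramRow q r (2 ^ (64 * (j + 1)) - 1) Us = ∑ l ∈ range (j + 1),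
      (Us.map fun U => digit (2 ^ 64) U j * digit (2 ^ 64) U l).sum * (2 ^ 64) ^ l := by
  induction Us with
  | nil => simp [gramRow]
  | cons U Us ih =>
    change digitAt U q r * (U &&& (2 ^ (64 * (j + 1)) - 1)) +
      gramRow q r (2 ^ (64 * (j + 1)) - 1) Us = _
    rw [ih, digitAt_eq U q r hr, ← hj, Nat.and_two_pow_sub_one_eq_mod, pow_mul,
      mod_pow_eq_sum_digit, mul_sum, ← sum_add_distrib]
    refine sum_congr rfl fun l _ => ?_
    simp only [List.map_cons, List.sum_cons]
    ring

/-- Gram entries of signed factor entries are recovered from the unsigned digits; besides products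
of digits only the digit sums and the number of rows are needed, which the algorithm carries along
as `SU` and `κ`. -/
theorem sum_sub_mul_sub (C : ℤ) (f g : ℕ → ℕ) (Us : List ℕ) :
    (Us.map fun U => ((f U : ℤ) - C) * ((g U : ℤ) - C)).sum =
      ((Us.map fun U => f U * g U).sum : ℕ) - C * ((Us.map f).sum : ℕ) - C * ((Us.map g).sum : ℕ)
        + Us.length * C ^ 2 := by
  induction Us with
  | nil => simp
  | cons U Us ih =>
    simp only [List.map_cons, List.sum_cons, List.length_cons, ih]
    push_cast
    ring

theorem constDigits_eq (n c : ℕ) : constDigits n c = c * ∑ l ∈ range n, (2 ^ 64) ^ l := by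
  rw [← ones_eq]; rfl

theorem highMask_eq : highMask = (2 ^ 64 - 2 ^ 26) * ∑ l ∈ range 648, (2 ^ 64) ^ l := by
  rw [show 2 ^ 64 - 2 ^ 26 = 18446744073642442752 by norm_num, ← constDigits_eq, highMask]

/-- With `C = 2 ^ 25`, the digits of `rowSide` and `gramSide` are the two sides of the equation that
`sum_sub_mul_sub` gives for the signed Gram entry, arranged without subtraction and with one extra
`C` on the first side. If the digits of their difference lie below `2 ^ 26 = 2 * C`, the residual
lies between `-C` and `C`. -/
theorem acceptRow_sound {q r j A κ U : ℕ} {Us : List ℕ} (hr : r < 18) (hj : j = 18 * q + r)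
    (hj' : j < 648) (hlen : Us.length = κ) (hκ : κ < 648) (hUs : ∀ V ∈ Us, IsFactorRow V)
    (hA : ∀ l ≤ j, digit (2 ^ 64) A l < 2 ^ 62)
    (h : acceptRow (2 ^ (64 * (j + 1))) (ones (j + 1)) q r A Us.sum κ
      (gramRow q r (2 ^ (64 * (j + 1)) - 1) Us) U = true) :
    IsFactorRow U ∧ ∀ l ≤ j,
      |(digit (2 ^ 64) A l : ℤ) - 2 ^ 60 - ((U :: Us).map fun V =>
        ((digit (2 ^ 64) V j : ℤ) - 2 ^ 25) * ((digit (2 ^ 64) V l : ℤ) - 2 ^ 25)).sum| ≤ 2 ^ 25 := by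
  unfold acceptRow at h
  set T := gramRow q r (2 ^ (64 * (j + 1)) - 1) Us with hT
  set Z := rowSide (ones (j + 1)) (Nat.sub (2 ^ (64 * (j + 1))) 1) A (Nat.add Us.sum U)
    (digitAt (Nat.add Us.sum U) q r) digitOffset with hZ
  set Y := gramSide (ones (j + 1)) (Nat.add T (Nat.mul (digitAt U q r) U)) (Nat.succ κ) with hY
  have hcond : ∀ {a b : Bool}, (bif a then b else false) = true → a = true ∧ b = true := by
    intro a b; cases a <;> simp
  have hcond' : ∀ {a b : Bool}, (bif a then false else b) = true → a = false ∧ b = true := by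
    intro a b; cases a <;> simp
  obtain ⟨h1, h⟩ := hcond h
  obtain ⟨h2, h⟩ := hcond h
  obtain ⟨h3, h⟩ := hcond h
  obtain ⟨h4, h⟩ := hcond' h
  obtain ⟨h5, -⟩ := hcond' h
  replace h1 : Y ≤ Z := Nat.le_of_ble_eq_true h1
  replace h2 : (Z - Y) &&& highMask = 0 := Nat.eq_of_beq_eq_true h2
  replace h3 : U &&& highMask = 0 := Nat.eq_of_beq_eq_true h3
  replace h4 : U < (2 ^ 64) ^ (j + 1) := by
    rw [← pow_mul]; exact not_le.mp fun hc => by rw [Nat.ble_eq_true_of_le hc] at h4; cases h4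
  replace h5 : Z - Y < (2 ^ 64) ^ (j + 1) := by
    rw [← pow_mul]; exact not_le.mp fun hc => by
      have h5' : Nat.ble (2 ^ (64 * (j + 1))) (Z - Y) = false := h5
      rw [Nat.ble_eq_true_of_le hc] at h5'; cases h5'
  have hU : IsFactorRow U := by
    refine ⟨h4.trans_le (Nat.pow_le_pow_right (Nat.two_pow_pos 64) (by omega)), fun l hl => ?_⟩
    rw [highMask_eq] at h3
    exact digit_lt_of_land_eq_zero (by norm_num) h3 hl
  refine ⟨hU, fun l hl => ?_⟩
  have hV : ∀ V ∈ U :: Us, IsFactorRow V := by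
    intro V hV
    rcases List.mem_cons.mp hV with rfl | hV
    exacts [hU, hUs V hV]
  have hlen' : (U :: Us).length = κ + 1 := by simp [hlen]
  set s : ℕ → ℕ := fun l => ((U :: Us).map fun V => digit (2 ^ 64) V l).sum with hs
  set t : ℕ → ℕ := fun l =>
    ((U :: Us).map fun V => digit (2 ^ 64) V j * digit (2 ^ 64) V l).sum with ht
  have hsum : Nat.add Us.sum U = (U :: Us).sum := by rw [List.sum_cons, add_comm]; rfl
  have hdig : ∀ k < 648, digit (2 ^ 64) (U :: Us).sum k = s k := fun k hk =>
    digit_sum_factorRows _ hV (by omega) hk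
  have hZ' : Z = ∑ l ∈ range (j + 1),
      (digit (2 ^ 64) A l + 2 ^ 25 * s l + (2 ^ 25 * s j + 2 ^ 25)) * (2 ^ 64) ^ l := by
    rw [hZ, hsum, digitAt_eq _ _ _ hr, ← hj, hdig j hj']
    change (A &&& (2 ^ (64 * (j + 1)) - 1)) + (2 ^ 25 * ((U :: Us).sum &&& (2 ^ (64 * (j + 1)) - 1))
      + (2 ^ 25 * s j + 2 ^ 25) * ones (j + 1)) = _
    rw [Nat.and_two_pow_sub_one_eq_mod, Nat.and_two_pow_sub_one_eq_mod, pow_mul,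
      mod_pow_eq_sum_digit, mod_pow_eq_sum_digit, ones_eq, mul_sum, mul_sum, ← sum_add_distrib,
      ← sum_add_distrib]
    refine sum_congr rfl fun l hl => ?_
    rw [hdig l (by have := mem_range.mp hl; omega)]
    ring
  have hY' : Y = ∑ l ∈ range (j + 1), (t l + (2 ^ 60 + (κ + 1) * 2 ^ 50)) * (2 ^ 64) ^ l := by
    rw [hY, digitAt_eq _ _ _ hr, ← hj, hT, gramRow_eq q r j Us hr hj]
    change (_ + digit (2 ^ 64) U j * U) + (2 ^ 60 + (κ + 1) * 2 ^ 50) * ones (j + 1) = _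
    conv_lhs => rw [← Nat.mod_eq_of_lt h4]
    rw [mod_pow_eq_sum_digit, ones_eq, mul_sum, mul_sum, ← sum_add_distrib, ← sum_add_distrib]
    refine sum_congr rfl fun l hl => ?_
    have h6 : digit (2 ^ 64) (∑ l ∈ range (j + 1), digit (2 ^ 64) U l * (2 ^ 64) ^ l) j =
        digit (2 ^ 64) U j := digit_sum (fun l _ => digit_lt (by norm_num) U l) (by omega)
    simp only [ht, List.map_cons, List.sum_cons, h6]
    ring
  have hW : Z - Y = ∑ l ∈ range (j + 1), digit (2 ^ 64) (Z - Y) l * (2 ^ 64) ^ l := by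
    rw [← mod_pow_eq_sum_digit, Nat.mod_eq_of_lt h5]
  have hw : ∀ l < j + 1, digit (2 ^ 64) (Z - Y) l < 2 ^ 26 := fun l hl => by
    rw [highMask_eq] at h2
    exact digit_lt_of_land_eq_zero (by norm_num) h2 (by omega)
  have hsb : ∀ l < 648, s l ≤ 648 * 2 ^ 26 := fun l hl =>
    (sum_digit_le _ hV hl).trans (by rw [hlen']; exact Nat.mul_le_mul_right _ (by omega))
  have htb : ∀ l < 648, t l ≤ 648 * 2 ^ 52 := fun l hl =>
    (sum_mul_digit_le _ hV hj' hl).trans (by rw [hlen']; exact Nat.mul_le_mul_right _ (by omega))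
  -- All combined digits stay below `2 ^ 64`, so the equality of the packed numbers splits into
  -- equalities of digits, without carries or borrows.
  have key := digit_ext (b := 2 ^ 64) (n := j + 1)
    (z := fun l => digit (2 ^ 64) A l + 2 ^ 25 * s l + (2 ^ 25 * s j + 2 ^ 25))
    (y := fun l => t l + (2 ^ 60 + (κ + 1) * 2 ^ 50) + digit (2 ^ 64) (Z - Y) l)
    (fun l hl => by
      have h1 := hA l (by omega)
      have h2 := hsb l (by omega)
      have h3 := hsb j hj'
      omega)
    (fun l hl => by
      have h1 := htb l (by omega)
      have h2 := hw l hl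
      omega)
    (by
      rw [← hZ']
      simp only [add_mul _ (digit (2 ^ 64) (Z - Y) _), sum_add_distrib (f := fun l =>
        (t l + (2 ^ 60 + (κ + 1) * 2 ^ 50)) * (2 ^ 64) ^ l)]
      rw [← hY', ← hW]
      omega) (show l < j + 1 by omega)
  beta_reduce at key
  rw [sum_sub_mul_sub, hlen']
  change |(digit (2 ^ 64) A l : ℤ) - 2 ^ 60 - ((t l : ℕ) - 2 ^ 25 * (s j : ℕ) - 2 ^ 25 * (s l : ℕ) +
    ((κ + 1 : ℕ) : ℤ) * (2 ^ 25) ^ 2)| ≤ 2 ^ 25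
  have := hw l (by omega)
  generalize digit (2 ^ 64) A l = x at key ⊢
  generalize digit (2 ^ 64) (Z - Y) l = w at key this
  rw [abs_le]
  constructor <;> push_cast <;> omega

end Cholesky

/-! ### Lower bounds for quadratic forms from approximate Gram factorizations. -/

section Cholesky

open Finset

theorem sum_map_add_mul_sq {α : Type*} (L c : α → ℝ) (t : ℝ) (Us : List α) :
    (Us.map fun V => (L V + c V * t) ^ 2).sum = (Us.map fun V => L V ^ 2).sum +
      2 * t * (Us.map fun V => c V * L V).sum + t ^ 2 * (Us.map fun V => c V * c V).sum := by
  induction Us with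
  | nil => simp
  | cons U Us ih =>
    simp only [List.map_cons, List.sum_cons, ih]
    ring

theorem sum_map_mul_sum {α : Type*} (c : α → ℝ) (g : α → ℕ → ℝ) (x : ℕ → ℝ) (n : ℕ)
    (Us : List α) :
    (Us.map fun V => c V * ∑ l ∈ range n, g V l * x l).sum =
      ∑ l ∈ range n, (Us.map fun V => c V * g V l).sum * x l := by
  induction Us with
  | nil => simp
  | cons U Us ih =>
    simp only [List.map_cons, List.sum_cons, add_mul, sum_add_distrib]
    rw [ih, mul_sum]
    simp only [mul_assoc]

theorem sum_sum_range_succ (A : ℕ → ℕ → ℝ) (hA : ∀ j l, A j l = A l j) (x : ℕ → ℝ) (n : ℕ) :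
    ∑ j ∈ range (n + 1), ∑ l ∈ range (n + 1), A j l * x j * x l =
      ∑ j ∈ range n, ∑ l ∈ range n, A j l * x j * x l +
        2 * x n * ∑ l ∈ range n, A n l * x l + A n n * x n ^ 2 := by
  simp only [sum_range_succ, sum_add_distrib]
  have h1 : ∑ j ∈ range n, A j n * x j * x n = x n * ∑ l ∈ range n, A n l * x l := by
    rw [mul_sum]
    exact sum_congr rfl fun j _ => by rw [hA j n]; ring
  have h2 : ∑ l ∈ range n, A n l * x n * x l = x n * ∑ l ∈ range n, A n l * x l := by
    rw [mul_sum]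
    exact sum_congr rfl fun j _ => by ring
  rw [h1, h2]
  ring

/-- The leading block of size `m` of the matrix `A`, minus the Gram matrix of the rows `Us`, is
positive semidefinite up to an error `r * (m + 1)`. -/
def DominatesGram (A : ℕ → ℕ → ℝ) (r : ℝ) (c : ℕ → ℕ → ℝ) (m : ℕ) (Us : List ℕ) : Prop :=
  ∀ x : ℕ → ℝ, (Us.map fun V => (∑ l ∈ range m, c V l * x l) ^ 2).sum ≤
    ∑ j ∈ range m, ∑ l ∈ range m, A j l * x j * x l + r * (m + 1) * ∑ l ∈ range m, x l ^ 2

/-- Adding the square belonging to `U` on the left only strengthens the claim. After that the last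
row and column of the difference matrix are at most `r` in size, and its leading block is covered by
the hypothesis. The cross terms cost `r * (x j ^ 2 + x l ^ 2)` each, which raises the error by one
more `r` per coordinate. -/
theorem DominatesGram.succ {A : ℕ → ℕ → ℝ} (hA : ∀ j l, A j l = A l j) {r : ℝ} {c : ℕ → ℕ → ℝ}
    {j : ℕ} {U : ℕ} {Us : List ℕ} (h : DominatesGram A r c j (U :: Us))
    (hr : ∀ l ≤ j, |A j l - ((U :: Us).map fun V => c V j * c V l).sum| ≤ r) :
    DominatesGram A r c (j + 1) Us := by
  intro x
  have h0 := h x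
  rw [sum_sum_range_succ A hA]
  have hle : (Us.map fun V => (∑ l ∈ range (j + 1), c V l * x l) ^ 2).sum ≤
      ((U :: Us).map fun V => (∑ l ∈ range (j + 1), c V l * x l) ^ 2).sum := by
    simp only [List.map_cons, List.sum_cons]
    have := sq_nonneg (∑ l ∈ range (j + 1), c U l * x l)
    linarith
  refine hle.trans ?_
  simp only [sum_range_succ _ j]
  rw [sum_map_add_mul_sq, sum_map_mul_sum]
  set G : ℕ → ℝ := fun l => ((U :: Us).map fun V => c V j * c V l).sum with hG
  change _ + 2 * x j * ∑ l ∈ range j, G l * x l + x j ^ 2 * G j ≤ _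
  -- Each cross term is estimated by `2 * |x j * x l| ≤ x j ^ 2 + x l ^ 2`.
  have hcross : 2 * x j * ∑ l ∈ range j, G l * x l ≤ 2 * x j * ∑ l ∈ range j, A j l * x l +
      ∑ l ∈ range j, r * (x j ^ 2 + x l ^ 2) := by
    rw [mul_sum, mul_sum, ← sum_add_distrib]
    refine sum_le_sum fun l hl => ?_
    have h1 := abs_le.mp (hr l (mem_range.mp hl).le)
    change -r ≤ A j l - G l ∧ A j l - G l ≤ r at h1
    nlinarith [mul_nonneg (sub_nonneg.mpr h1.2) (sq_nonneg (x j - x l)),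
      mul_nonneg (sub_nonneg.mpr h1.1) (sq_nonneg (x j + x l))]
  have hdiag : x j ^ 2 * G j ≤ A j j * x j ^ 2 + r * x j ^ 2 := by
    have h1 := abs_le.mp (hr j le_rfl)
    change -r ≤ A j j - G j ∧ A j j - G j ≤ r at h1
    nlinarith [sq_nonneg (x j)]
  have hr0 : 0 ≤ r := (abs_nonneg _).trans (hr j le_rfl)
  rw [← mul_sum, sum_add_distrib, sum_const, card_range, nsmul_eq_mul] at hcross
  have hS : 0 ≤ ∑ l ∈ range j, x l ^ 2 := sum_nonneg fun l _ => sq_nonneg _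
  push_cast
  nlinarith [mul_nonneg hr0 (sq_nonneg (x j))]

theorem rec_induction {α : Type*} (P : ℕ → α → Prop) (b s : ℕ) (f₀ : α) (step : ℕ → α → α)
    (h₀ : P b f₀) (n : ℕ) (hs : ∀ i < n, ∀ f, P (b + s * i) f → P (b + s * (i + 1)) (step i f)) :
    P (b + s * n) (Nat.rec f₀ step n) := by
  induction n with
  | zero => simpa using h₀
  | succ n ih => exact hs n (by omega) _ (ih fun i hi => hs i (by omega))

theorem cast_sum_map_mul (f : ℕ → ℕ → ℕ) (Us : List ℕ) (j l : ℕ) :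
    (((Us.map fun V => ((f V j : ℤ) - 2 ^ 25) * ((f V l : ℤ) - 2 ^ 25)).sum : ℤ) : ℝ) =
      (Us.map fun V => ((f V j : ℝ) - 2 ^ 25) * ((f V l : ℝ) - 2 ^ 25)).sum := by
  induction Us with
  | nil => simp
  | cons V Vs ih =>
    simp only [List.map_cons, List.sum_cons, Int.cast_add, ih]
    push_cast
    norm_num

/-- The residual is `2 ^ 25` from the acceptance test plus 1 from the rounding of the matrix
entries. The induction starts with an empty leading block, where the claim is trivial, and ends with
all 648 rows and an empty list, where no Gram matrix is left. -/
theorem cholesky_sound {blk : ℕ → ℕ → ℕ → ℕ → ℕ} {A : ℕ → ℕ → ℝ} (hA : ∀ j l, A j l = A l j)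
    (hlt : ∀ q < 36, ∀ c < 6, ∀ d < 3, ∀ l ≤ 18 * q + 3 * c + d,
      digit (2 ^ 64) (hessRow blk q c d) l < 2 ^ 62)
    (hdig : ∀ q < 36, ∀ c < 6, ∀ d < 3, ∀ l ≤ 18 * q + 3 * c + d,
      |A (18 * q + 3 * c + d) l - ((digit (2 ^ 64) (hessRow blk q c d) l : ℝ) - 2 ^ 60)| ≤ 1)
    (h : cholesky blk 36 0 0 [] = true) (x : ℕ → ℝ) :
    0 ≤ ∑ j ∈ range 648, ∑ l ∈ range 648, A j l * x j * x l +
      (2 ^ 25 + 1) * 649 * ∑ l ∈ range 648, x l ^ 2 := by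
  set cf : ℕ → ℕ → ℝ := fun V l => (digit (2 ^ 64) V l : ℝ) - 2 ^ 25 with hcf
  -- The continuation `f` still has `m` rows to find, with indices below `m`; the `κ` rows in `Us`
  -- belong to the larger indices.
  let P : ℕ → (ℕ → ℕ → List ℕ → Bool) → Prop := fun m f => ∀ κ SU Us, κ + m = 648 →
    Us.length = κ → Us.sum = SU → (∀ V ∈ Us, IsFactorRow V) → f κ SU Us = true →
    DominatesGram A (2 ^ 25 + 1) cf m Us
  have key : ∀ n ≤ 36, P (0 + 18 * n) (cholesky blk n) := by
    intro n
    induction n with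
    | zero =>
      intro _ κ SU Us _ _ _ _ _ x
      have : (Us.map fun V => (∑ l ∈ range 0, cf V l * x l) ^ 2).sum = 0 := by simp
      rw [this]
      simp
    | succ q ih =>
    intro hq
    have h6 := rec_induction P (0 + 18 * q) 3 (cholesky blk q) (fun c ihc => (nat_lit 3).rec ihc
      fun d ihd κ SU Us => choleskyStep q (Nat.add (Nat.mul 3 c) d)
        (Nat.add (Nat.mul 18 q) (Nat.add (Nat.mul 3 c) d)) (hessRow blk q c d) SU κ Us
        fun U => ihd (Nat.succ κ) (Nat.add SU U) (U :: Us)) (ih (by omega)) 6 ?_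
    · exact h6
    intro c hc g hg
    have h3 := rec_induction P (0 + 18 * q + 3 * c) 1 g (fun d ihd κ SU Us =>
      choleskyStep q (Nat.add (Nat.mul 3 c) d)
        (Nat.add (Nat.mul 18 q) (Nat.add (Nat.mul 3 c) d)) (hessRow blk q c d) SU κ Us
        fun U => ihd (Nat.succ κ) (Nat.add SU U) (U :: Us)) hg 3 ?_
    · exact h3
    intro d hd k hk κ SU Us hκ hlen hSU hUs hchk
    have hm : 0 + 18 * q + 3 * c + 1 * (d + 1) = 18 * q + 3 * c + d + 1 := by ring
    rw [hm] at hκ ⊢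
    unfold choleskyStep at hchk
    set j := 18 * q + 3 * c + d with hj
    have hjj : Nat.add (Nat.mul 18 q) (Nat.add (Nat.mul 3 c) d) = j := by
      change 18 * q + (3 * c + d) = j; omega
    rw [hjj] at hchk
    dsimp only at hchk
    obtain ⟨U, hU⟩ : ∃ U, U = nextRow (Nat.pow 2 (Nat.mul 64 j.succ)) (ones j.succ) q
      (Nat.add (Nat.mul 3 c) d) j (hessRow blk q c d) SU κ (gramRow q (Nat.add (Nat.mul 3 c) d)
        (Nat.sub (Nat.pow 2 (Nat.mul 64 j.succ)) 1) Us) := ⟨_, rfl⟩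
    rw [← hU] at hchk
    have hcond : ∀ {a b : Bool}, (bif a then b else false) = true → a = true ∧ b = true := by
      intro a b; cases a <;> simp
    obtain ⟨hacc, hrest⟩ := hcond hchk
    subst hSU
    obtain ⟨hUrow, hres⟩ := acceptRow_sound (q := q) (r := 3 * c + d) (j := j)
      (A := hessRow blk q c d) (κ := κ) (U := U) (Us := Us) (by omega) (by omega) (by omega) hlen
      (by omega) hUs (fun l hl => hlt q (by omega) c hc d hd l hl) hacc
    have hnext := hk (κ + 1) (Us.sum + U) (U :: Us) (by omega) (by simp [hlen])
      (by rw [List.sum_cons, add_comm])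
      (fun V hV => by
        rcases List.mem_cons.mp hV with rfl | hV
        exacts [hUrow, hUs V hV]) hrest
    rw [show 0 + 18 * q + 3 * c + 1 * d = j by omega] at hnext
    refine hnext.succ hA fun l hl => ?_
    have h1 := hdig q (by omega) c hc d hd l hl
    have h2 := hres l hl
    have h3 : ((((U :: Us).map fun V => ((digit (2 ^ 64) V j : ℤ) - 2 ^ 25) *
        ((digit (2 ^ 64) V l : ℤ) - 2 ^ 25)).sum : ℤ) : ℝ) =
        ((U :: Us).map fun V => cf V j * cf V l).sum := by
      exact cast_sum_map_mul (fun V l => digit (2 ^ 64) V l) _ j l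
    have h4 : |((digit (2 ^ 64) (hessRow blk q c d) l : ℝ) - 2 ^ 60) -
        ((U :: Us).map fun V => cf V j * cf V l).sum| ≤ 2 ^ 25 := by
      rw [← h3]
      have h5 : ((|((digit (2 ^ 64) (hessRow blk q c d) l : ℤ) - 2 ^ 60) -
          ((U :: Us).map fun V => ((digit (2 ^ 64) V j : ℤ) - 2 ^ 25) *
            ((digit (2 ^ 64) V l : ℤ) - 2 ^ 25)).sum| : ℤ) : ℝ) ≤ ((2 ^ 25 : ℤ) : ℝ) :=
        Int.cast_le.mpr h2
      have h6 : ((2 ^ 60 : ℤ) : ℝ) = 2 ^ 60 := by norm_num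
      rw [Int.cast_abs, Int.cast_sub, Int.cast_sub, Int.cast_natCast, h6] at h5
      exact h5.trans (by norm_num)
    calc |A j l - ((U :: Us).map fun V => cf V j * cf V l).sum|
        ≤ _ := abs_sub_le _ ((digit (2 ^ 64) (hessRow blk q c d) l : ℝ) - 2 ^ 60) _
      _ ≤ 2 ^ 25 + 1 := by linarith
  have hfin := key 36 le_rfl 0 0 [] rfl rfl rfl (by simp) h x
  simp only [List.map_nil, List.sum_nil] at hfin
  norm_num at hfin ⊢
  exact hfin

end Cholesky

/-! ### Bond stiffness matrices -/

section Stiffness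

set_option exponentiation.threshold 5000

open Finset

/-- A lower bound for the isotropic part of the bond stiffness, scaled by `2 ^ 256 * 10 ^ 32`. -/
def isoStiff (y : ℤ) : ℤ := 10 ^ 32 * 2 ^ 32 * y ^ 4 * (95 * 2 ^ 92 - 12 * y ^ 3)

/-- The directional part of the bond stiffness, scaled by `2 ^ 256`. -/
def dirStiff (y : ℤ) : ℤ := y ^ 5 * (168 * y ^ 3 - 48 * 2 ^ 96)

/-- The four sign patterns with product `ε`. -/
def bondSign (ε : ℤ) (k : Fin 4) : Fin 3 → ℤ :=
  ![![ε, ε, ε], ![ε, -ε, -ε], ![-ε, ε, -ε], ![-ε, -ε, ε]] k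

def bond (s x y : Fin 3 → ℤ) (d : Fin 3) : ℤ := x d - s d * y d

def bondSq (s x y : Fin 3 → ℤ) : ℤ := bond s x y 0 ^ 2 + bond s x y 1 ^ 2 + bond s x y 2 ^ 2

/-- The inverse square of the bond length in units of `2 ^ (-32)`, rounded down. -/
def bondInv (s x y : Fin 3 → ℤ) : ℤ := 2 ^ 32 * 10 ^ 32 / bondSq s x y

def stiffness (s x y : Fin 3 → ℤ) (d e : Fin 3) : ℤ :=
  (if d = e then isoStiff (bondInv s x y) else 0) +
    dirStiff (bondInv s x y) * (bond s x y d * bond s x y e)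

/-- The bond vectors, for the four sign patterns, in terms of differences and sums. -/
def bondTable {R : Type*} (f g : Fin 3 → R) (k : Fin 4) (d : Fin 3) : R :=
  ![![f 0, f 1, f 2], ![f 0, g 1, g 2], ![g 0, f 1, g 2], ![g 0, g 1, f 2]] k d

abbrev HessRing : Type := ZMod hessModulus

theorem hessModulus_cast : ((hessModulus : ℕ) : HessRing) = 0 := ZMod.natCast_self _

theorem natCast_natAdd {R : Type*} [Ring R] (a b : ℕ) : ((Nat.add a b : ℕ) : R) = a + b :=
  Nat.cast_add a b

theorem natCast_natMul {R : Type*} [Ring R] (a b : ℕ) : ((Nat.mul a b : ℕ) : R) = a * b :=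
  Nat.cast_mul a b

theorem natCast_natPow {R : Type*} [Ring R] (a b : ℕ) : ((Nat.pow a b : ℕ) : R) = (a : R) ^ b :=
  Nat.cast_pow a b

theorem natCast_negMod {R : Type*} [Ring R] {m x : ℕ} (hm : ((m : ℕ) : R) = 0) (hx : x ≤ m) :
    ((negMod m x : ℕ) : R) = -x := by
  have : negMod m x + x = m := Nat.sub_add_cancel hx
  have := congrArg (Nat.cast (R := R)) this
  rw [Nat.cast_add, hm] at this
  exact eq_neg_of_add_eq_zero_left this

theorem natCast_subMod {R : Type*} [Ring R] {m y : ℕ} (hm : ((m : ℕ) : R) = 0) (x : ℕ)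
    (hy : y ≤ m) : ((subMod m x y : ℕ) : R) = x - y := by
  rw [subMod, natCast_natAdd, natCast_negMod hm hy, sub_eq_add_neg]

theorem land_mask (w x : ℕ) : Nat.land x (Nat.sub (Nat.pow 2 w) 1) = x % 2 ^ w :=
  Nat.and_two_pow_sub_one_eq_mod x w

theorem land_hessMask (x : ℕ) : Nat.land x hessMask = x % 2 ^ 384 := land_mask 384 x

theorem natCast_land_hessMask {R : Type*} [Ring R] (hR : ((hessModulus : ℕ) : R) = 0) (x : ℕ) :
    ((Nat.land x hessMask : ℕ) : R) = x := by
  have h := congrArg (Nat.cast (R := R)) (Nat.mod_add_div x (2 ^ 384))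
  have h' : ((2 ^ 384 : ℕ) : R) = 0 := hR
  rw [Nat.cast_add, Nat.cast_mul, h', zero_mul, add_zero] at h
  rw [land_hessMask, h]

theorem natCast_isoMod {R : Type*} [CommRing R] (hR : ((hessModulus : ℕ) : R) = 0) (y : ℕ) :
    ((isoMod y : ℕ) : R) = (isoStiff y : ℤ) := by
  have h : Nat.mul (Nat.mul (Nat.pow 10 32) (Nat.pow 2 32)) 12 ≤ hessModulus :=
    (by decide +kernel)
  rw [isoMod, isoOfPowers, natCast_land_hessMask hR, isoCoeff₁, isoCoeff₂]
  simp only [natCast_natMul, natCast_natAdd, natCast_natPow, natCast_negMod hR h,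
    isoStiff]
  push_cast
  ring

theorem natCast_dirMod {R : Type*} [CommRing R] (hR : ((hessModulus : ℕ) : R) = 0) (y : ℕ) :
    ((dirMod y : ℕ) : R) = (dirStiff y : ℤ) := by
  have h : Nat.mul 48 (Nat.pow 2 96) ≤ hessModulus := (by decide +kernel)
  rw [dirMod, dirOfPowers, natCast_land_hessMask hR, dirCoeff]
  simp only [natCast_natMul, natCast_natAdd, natCast_natPow, natCast_negMod hR h,
    dirStiff]
  push_cast
  ring

theorem isoMod_le (y : ℕ) : isoMod y ≤ hessModulus := by
  rw [isoMod, isoOfPowers, land_hessMask]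
  exact (Nat.mod_lt _ (pow_pos two_pos 384)).le

theorem dirMod_le (y : ℕ) : dirMod y ≤ hessModulus := by
  rw [dirMod, dirOfPowers, land_hessMask]
  exact (Nat.mod_lt _ (pow_pos two_pos 384)).le

/-- The shifted integer `z + 2 ^ 382` lies in `[0, 2 ^ 384)`, so its residue modulo `2 ^ 384` is the
integer itself. -/
theorem digitOf_eq_div {sh E : ℕ} {z : ℤ} (h : (E : HessRing) = z) (h0 : -2 ^ 382 ≤ z)
    (h1 : z < 2 ^ 382) : (digitOf sh E : ℤ) = (z + 2 ^ 382) / 2 ^ sh := by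
  have e1 : digitOf sh E = (E + 2 ^ 382) % 2 ^ 384 / 2 ^ sh := by
    rw [← Nat.shiftRight_eq_div_pow, ← land_hessMask]; rfl
  have e2 : (((E + 2 ^ 382 : ℕ) : ℤ) : HessRing) = ((z + 2 ^ 382 : ℤ) : HessRing) := by
    push_cast
    rw [h]
  have e3 := (ZMod.intCast_eq_intCast_iff' _ _ _).mp e2
  rw [show hessModulus = 2 ^ 384 from rfl] at e3
  rw [e1, Int.natCast_ediv, Int.natCast_mod, Nat.cast_pow, Nat.cast_pow]
  rw [Nat.cast_pow] at e3
  rw [Nat.cast_ofNat] at e3 ⊢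
  rw [e3, Int.emod_eq_of_lt]
  · linarith
  · have : (2 : ℤ) ^ 384 = 2 ^ 382 * 4 := by rw [pow_add 2 382 2]; norm_num
    have : (0 : ℤ) < 2 ^ 382 := pow_pos two_pos _
    linarith

theorem consDigit_eq (x y : ℕ) : consDigit x y = x + 2 ^ 64 * y := rfl

/-- The entries of a packed matrix before rounding. -/
def packEntries (f1 f2 f3 g1 g2 g3 B0 B1 B2 B3 C0 C1 C2 C3 D0 D1 D2 D3
    p11 p12 p21 p22 p33 : ℕ) : Fin 3 → Fin 3 → ℕ :=
  ![![Nat.add p11 (mix f1 g1 B0 B1 B2 B3), Nat.add p12 (mix f1 g1 C0 C1 C2 C3),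
      mix f1 g1 D0 D1 D2 D3],
    ![Nat.add p21 (mix f2 g2 B0 B2 B1 B3), Nat.add p22 (mix f2 g2 C0 C2 C1 C3),
      mix f2 g2 D0 D2 D1 D3],
    ![mix f3 g3 B0 B3 B1 B2, mix f3 g3 C0 C3 C1 C2, Nat.add p33 (mix f3 g3 D0 D3 D1 D2)]]

theorem digitOf_lt {sh : ℕ} (hsh : 322 ≤ sh) (E : ℕ) : digitOf sh E < 2 ^ 62 := by
  have e1 : digitOf sh E = (E + 2 ^ 382) % 2 ^ 384 / 2 ^ sh := by
    rw [← Nat.shiftRight_eq_div_pow, ← land_hessMask]; rfl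
  rw [e1]
  refine Nat.div_lt_of_lt_mul ((Nat.mod_lt _ (pow_pos two_pos 384)).trans_le ?_)
  rw [← pow_add]
  exact Nat.pow_le_pow_right two_pos (by omega)

theorem sum_range_nine (z : Fin 3 → Fin 3 → ℕ) (B : ℕ) :
    ∑ l ∈ range 9, z (Fin.ofNat 3 (l / 3)) (Fin.ofNat 3 l) * B ^ l =
      z 0 0 + B * (z 0 1 + B * (z 0 2 + B * (z 1 0 + B * (z 1 1 + B * (z 1 2 + B * (z 2 0 +
        B * (z 2 1 + B * z 2 2))))))) := by
  simp only [sum_range_succ, sum_range_zero, zero_add]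
  change z 0 0 * B ^ 0 + z 0 1 * B ^ 1 + z 0 2 * B ^ 2 + z 1 0 * B ^ 3 + z 1 1 * B ^ 4 +
    z 1 2 * B ^ 5 + z 2 0 * B ^ 6 + z 2 1 * B ^ 7 + z 2 2 * B ^ 8 = _
  ring

theorem packMatrix_eq_sum (sh f1 f2 f3 g1 g2 g3 B0 B1 B2 B3 C0 C1 C2 C3 D0 D1 D2 D3
    p11 p12 p21 p22 p33 : ℕ) :
    packMatrix sh f1 f2 f3 g1 g2 g3 B0 B1 B2 B3 C0 C1 C2 C3 D0 D1 D2 D3 p11 p12 p21 p22 p33 =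
      ∑ l ∈ range 9, digitOf sh (packEntries f1 f2 f3 g1 g2 g3 B0 B1 B2 B3 C0 C1 C2 C3 D0 D1 D2 D3
        p11 p12 p21 p22 p33 (Fin.ofNat 3 (l / 3)) (Fin.ofNat 3 l)) * (2 ^ 64) ^ l := by
  rw [sum_range_nine (fun d e => digitOf sh (packEntries f1 f2 f3 g1 g2 g3 B0 B1 B2 B3 C0 C1 C2 C3
    D0 D1 D2 D3 p11 p12 p21 p22 p33 d e))]
  simp only [packMatrix, consDigit_eq]
  generalize (2 : ℕ) ^ 64 = B
  simp [packEntries]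

theorem digit_packMatrix {sh : ℕ} (hsh : 322 ≤ sh) (f1 f2 f3 g1 g2 g3 B0 B1 B2 B3 C0 C1 C2 C3
    D0 D1 D2 D3 p11 p12 p21 p22 p33 : ℕ) (d e : Fin 3) :
    digit (2 ^ 64) (packMatrix sh f1 f2 f3 g1 g2 g3 B0 B1 B2 B3 C0 C1 C2 C3 D0 D1 D2 D3
      p11 p12 p21 p22 p33) (3 * d + e) =
      digitOf sh (packEntries f1 f2 f3 g1 g2 g3 B0 B1 B2 B3 C0 C1 C2 C3 D0 D1 D2 D3
        p11 p12 p21 p22 p33 d e) := by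
  rw [packMatrix_eq_sum, digit_sum (fun l _ => (digitOf_lt hsh _).trans_le
    (Nat.pow_le_pow_right two_pos (by norm_num))) (by omega)]
  congr
  · exact Fin.ext (by simp [Fin.ofNat]; omega)
  · exact Fin.ext (by simp [Fin.ofNat])

theorem packMatrix_lt {sh : ℕ} (hsh : 322 ≤ sh) (f1 f2 f3 g1 g2 g3 B0 B1 B2 B3 C0 C1 C2 C3
    D0 D1 D2 D3 p11 p12 p21 p22 p33 : ℕ) :
    packMatrix sh f1 f2 f3 g1 g2 g3 B0 B1 B2 B3 C0 C1 C2 C3 D0 D1 D2 D3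
      p11 p12 p21 p22 p33 < (2 ^ 64) ^ 9 := by
  rw [packMatrix_eq_sum]
  exact sum_digit_lt (fun l _ => (digitOf_lt hsh _).trans_le
    (Nat.pow_le_pow_right two_pos (by norm_num)))

/-- The block `k` holds the weighted sum of the four stiffness matrices, plus the penalty `p`. -/
def BlockSpec (R : Type*) [CommRing R] (sh : ℕ) (k : BlockFn) (w : Fin 4 → Fin 3 → ℤ) (p : Fin 3 → Fin 3 → ℤ) : Prop :=
  ∀ f g : Fin 3 → ℕ, ∀ a b : Fin 4 → ℕ, (∀ i, a i ≤ hessModulus) → (∀ i, b i ≤ hessModulus) →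
    k (f 0) (f 1) (f 2) (g 0) (g 1) (g 2) (a 0) (a 1) (a 2) (a 3) (b 0) (b 1) (b 2) (b 3) <
      (2 ^ 64) ^ 9 ∧ ∀ d e : Fin 3, ∃ E : ℕ,
    digit (2 ^ 64) (k (f 0) (f 1) (f 2) (g 0) (g 1) (g 2) (a 0) (a 1) (a 2) (a 3)
      (b 0) (b 1) (b 2) (b 3)) (3 * d + e) = digitOf sh E ∧
    (E : R) = p d e + ∑ i, (w i e : R) * ((if d = e then (a i : R) else 0) +
      b i * (bondTable (fun d => (f d : R)) (fun d => (g d : R)) i d *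
        bondTable (fun d => (f d : R)) (fun d => (g d : R)) i e))

theorem blockSpec_self (R : Type*) [CommRing R] : BlockSpec R 334 selfBlock (fun _ _ => 1) (fun _ _ => 0) := by
  intro f g a b _ _
  simp only [selfBlock]
  refine ⟨packMatrix_lt (by norm_num) .., fun d e => ⟨_, digit_packMatrix (by norm_num) .., ?_⟩⟩
  fin_cases d <;> fin_cases e <;>
    simp [packEntries, mix, add4, bondTable, Fin.sum_univ_four, -Nat.add_eq, -Nat.mul_eq,
      natCast_natAdd, natCast_natMul] <;> ring

theorem blockSpec_invariantEven {R : Type*} [CommRing R] (hR : ((hessModulus : ℕ) : R) = 0) :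
    BlockSpec R 322 invariantEven (fun i e => -bondSign 1 i e) (fun _ _ => 0) := by
  intro f g a b ha hb
  simp only [invariantEven, packInvariant]
  refine ⟨packMatrix_lt (by norm_num) .., fun d e => ⟨_, digit_packMatrix (by norm_num) .., ?_⟩⟩
  fin_cases d <;> fin_cases e <;>
    simp [packEntries, mix, add4, bondTable, bondSign, Fin.sum_univ_four, -Nat.add_eq, -Nat.mul_eq,
      natCast_natAdd, natCast_natMul, natCast_negMod hR, ha, hb] <;> ring

theorem blockSpec_invariantOdd {R : Type*} [CommRing R] (hR : ((hessModulus : ℕ) : R) = 0) :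
    BlockSpec R 322 invariantOdd (fun i e => -bondSign (-1) i e) (fun _ _ => 0) := by
  intro f g a b ha hb
  simp only [invariantOdd, packInvariant]
  refine ⟨packMatrix_lt (by norm_num) .., fun d e => ⟨_, digit_packMatrix (by norm_num) .., ?_⟩⟩
  fin_cases d <;> fin_cases e <;>
    simp [packEntries, mix, add4, bondTable, bondSign, Fin.sum_univ_four, -Nat.add_eq, -Nat.mul_eq,
      natCast_natAdd, natCast_natMul, natCast_negMod hR, ha, hb] <;> ring

/-- The velocity field of the rotation about the third axis. -/
def rotField (x : Fin 3 → ℤ) : Fin 3 → ℤ := ![-x 1, x 0, 0]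

/-- The penalty for translations along and rotations about the third axis. -/
def axialPenalty (ε : ℤ) (x y : Fin 3 → ℤ) (d e : Fin 3) : ℤ :=
  2 ^ 249 * ε * (rotField x d * rotField y e) + if d = 2 ∧ e = 2 then 2 ^ 358 else 0

theorem blockSpec_axial {R : Type*} [CommRing R] (hR : ((hessModulus : ℕ) : R) = 0)
    (ε : ℤ) (c nc : ℕ) (hc : (c : R) = 2 ^ 249 * ε)
    (hnc : (nc : R) = -(2 ^ 249 * ε)) (hε : ε * ε = 1) (x y : Fin 3 → ℕ) :
    BlockSpec R 322 (axialBlock c nc (x 0) (x 1) (y 0) (y 1))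
      (fun i e => -(bondSign ε i 2 * bondSign ε i e))
      (axialPenalty ε (fun d => x d) (fun d => y d)) := by
  intro f g a b ha hb
  have hε' : (ε : R) * ε = 1 := by exact_mod_cast congrArg (Int.cast (R := R)) hε
  -- The patterns for `ε = -1` are the negatives of those for `ε = 1`, and the weight is quadratic
  -- in the signs. Hence one block function serves both sublattices and only the penalty depends on
  -- `ε`.
  have h : ∀ i e, ((-(bondSign ε i 2 * bondSign ε i e) : ℤ) : R) =
      -(bondSign 1 i 2 * bondSign 1 i e : ℤ) := by
    intro i e
    fin_cases i <;> fin_cases e <;> simp [bondSign, hε']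
  simp only [h]
  simp only [axialBlock, packAxial]
  refine ⟨packMatrix_lt (by norm_num) .., fun d e => ⟨_, digit_packMatrix (by norm_num) .., ?_⟩⟩
  fin_cases d <;> fin_cases e <;>
    simp [packEntries, mix, add4, bondTable, bondSign, axialPenalty, rotField, Fin.sum_univ_four,
      -Nat.add_eq, -Nat.mul_eq, -Nat.pow_eq, hc, hnc, natCast_natPow,
      natCast_natAdd, natCast_natMul, natCast_negMod hR, ha, hb] <;> ring

end Stiffness

/-! ### Pairs of sites: entries, sizes and separation. -/

section Sites

open Finset

set_option exponentiation.threshold 5000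

/-- The relaxed offsets, in units of `10 ^ (-16)`, of the atoms over the site
`i = 36 * a + 6 * b + c` with layer indices `a`, `b`, `c`. -/
def siteVec (i : ℕ) : Fin 3 → ℕ :=
  ![siteX (i / 6) (i % 6), siteY (i / 6) (i % 6), siteZ (i / 6) (i % 6)]

/-- The sublattice of a site. -/
def sitePar (i : ℕ) : ℤ := (-1) ^ (i / 6 / 6 + (i / 6 + i % 6))

theorem sitePar_mul_self (i : ℕ) : sitePar i * sitePar i = 1 := by
  rw [sitePar, ← mul_pow]; norm_num

theorem sitePar_mul_sitePar (i i' : ℕ) : sitePar i * sitePar i' =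
    if sameParity (i / 6) (i % 6) (i' / 6) (i' % 6) then 1 else -1 := by
  rw [sitePar, sitePar, ← pow_add]
  have h : sameParity (i / 6) (i % 6) (i' / 6) (i' % 6) = true ↔
      Even (i / 6 / 6 + (i / 6 + i % 6) + (i' / 6 / 6 + (i' / 6 + i' % 6))) := by
    rw [Nat.even_iff]
    exact Iff.of_eq Nat.beq_eq
  by_cases hs : sameParity (i / 6) (i % 6) (i' / 6) (i' % 6) = true
  · rw [if_pos hs, Even.neg_one_pow (h.mp hs)]
  · rw [if_neg hs, Odd.neg_one_pow (Nat.not_even_iff_odd.mp (mt h.mpr hs))]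

theorem sitePar_mul_eq (i i' : ℕ) : sitePar i * sitePar i' = 1 ∨ sitePar i * sitePar i' = -1 := by
  rw [sitePar_mul_sitePar]
  split <;> simp

theorem relaxedOffset_le (a b c : ℕ) : relaxedOffset a b c ≤ 2 ^ 56 := by
  have h : ∀ x ∈ relaxedTable, x ≤ 2 ^ 56 := by decide +kernel
  unfold relaxedOffset
  by_cases hl : 21 * a + max b c * (max b c + 1) / 2 + min b c < relaxedTable.length
  · rw [List.getD_eq_getElem _ _ hl]
    exact h _ (List.getElem_mem hl)
  · rw [List.getD_eq_default _ _ (by omega)]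
    positivity

theorem siteVec_le (i : ℕ) (d : Fin 3) : siteVec i d ≤ 2 ^ 56 := by
  fin_cases d
  exacts [relaxedOffset_le _ _ _, relaxedOffset_le _ _ _, relaxedOffset_le _ _ _]

def siteInt (i : ℕ) (d : Fin 3) : ℤ := siteVec i d

theorem natCast_sqAdd (a b : ℕ) : ((sqAdd a b : ℕ) : ℤ) = (a + b) ^ 2 := by
  rw [sqAdd, natCast_natMul, natCast_natAdd, sq]

theorem natCast_sqSub (a b : ℕ) : ((sqSub a b : ℕ) : ℤ) = (a - b) ^ 2 := by
  have h : Nat.mul 4 (Nat.mul a b) ≤ sqAdd a b := by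
    change 4 * (a * b) ≤ (a + b) * (a + b)
    zify
    nlinarith [sq_nonneg ((a : ℤ) - b)]
  rw [sqSub, Nat.sub_eq, Nat.cast_sub h, natCast_sqAdd, natCast_natMul, natCast_natMul]
  push_cast
  ring

theorem natCast_inverseSq (a b c : ℕ) :
    ((inverseSq a b c : ℕ) : ℤ) = 2 ^ 32 * 10 ^ 32 / ((a : ℤ) + b + c) := by
  change (((2 ^ 32 * 10 ^ 32) / (a + b + c) : ℕ) : ℤ) = _
  push_cast
  rfl

theorem bondInv_nonneg (s x y : Fin 3 → ℤ) : 0 ≤ bondInv s x y := by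
  unfold bondInv bondSq
  positivity

/-- The alternative zero is the bond from an atom to itself: integer division by zero yields the
inverse square zero, so this bond has no stiffness and needs no special treatment. -/
theorem bondInv_le {s x y : Fin 3 → ℤ} (h : bondSq s x y = 0 ∨ 10 ^ 32 ≤ bondSq s x y) :
    bondInv s x y ≤ 2 ^ 32 := by
  unfold bondInv
  rcases h with h | h
  · rw [h]; norm_num
  · exact Int.ediv_le_of_le_mul (by linarith [pow_pos (show (0 : ℤ) < 10 by norm_num) 32])
      (by nlinarith)

theorem abs_isoStiff_le {y : ℤ} (h0 : 0 ≤ y) (h1 : y ≤ 2 ^ 32) : |isoStiff y| ≤ 2 ^ 367 := by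
  have h3 : y ^ 3 ≤ (2 ^ 32) ^ 3 := by gcongr
  have h4 : y ^ 4 ≤ (2 ^ 32) ^ 4 := by gcongr
  have h3' : 0 ≤ y ^ 3 := by positivity
  have h5 : |95 * 2 ^ 92 - 12 * y ^ 3| ≤ 192 * 2 ^ 92 := by
    rw [abs_le]; constructor <;> linarith
  rw [isoStiff, abs_mul, abs_of_nonneg (by positivity)]
  calc 10 ^ 32 * 2 ^ 32 * y ^ 4 * |95 * 2 ^ 92 - 12 * y ^ 3|
      ≤ 10 ^ 32 * 2 ^ 32 * (2 ^ 32) ^ 4 * (192 * 2 ^ 92) := by gcongr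
    _ ≤ 2 ^ 367 := by norm_num

theorem abs_dirStiff_le {y : ℤ} (h0 : 0 ≤ y) (h1 : y ≤ 2 ^ 32) : |dirStiff y| ≤ 2 ^ 264 := by
  have h3 : y ^ 3 ≤ (2 ^ 32) ^ 3 := by gcongr
  have h4 : y ^ 5 ≤ (2 ^ 32) ^ 5 := by gcongr
  have h3' : 0 ≤ y ^ 3 := by positivity
  have h5 : |168 * y ^ 3 - 48 * 2 ^ 96| ≤ 168 * 2 ^ 96 := by
    rw [abs_le]; constructor <;> linarith
  rw [dirStiff, abs_mul, abs_of_nonneg (a := y ^ 5) (by positivity)]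
  calc y ^ 5 * |168 * y ^ 3 - 48 * 2 ^ 96| ≤ (2 ^ 32) ^ 5 * (168 * 2 ^ 96) := by gcongr
    _ ≤ 2 ^ 264 := by norm_num

theorem abs_bondSign {ε : ℤ} (hε : ε = 1 ∨ ε = -1) (k : Fin 4) (d : Fin 3) :
    |bondSign ε k d| = 1 := by
  rcases hε with rfl | rfl <;> fin_cases k <;> fin_cases d <;> simp [bondSign]

theorem abs_stiffness_le {s x y : Fin 3 → ℤ} (h : bondSq s x y = 0 ∨ 10 ^ 32 ≤ bondSq s x y)
    (hs : ∀ d, |s d| = 1) (hx : ∀ d, |x d| ≤ 2 ^ 56) (hy : ∀ d, |y d| ≤ 2 ^ 56) (d e : Fin 3) :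
    |stiffness s x y d e| ≤ 2 ^ 367 + 2 ^ 378 := by
  have h1 := abs_isoStiff_le (bondInv_nonneg s x y) (bondInv_le h)
  have h2 := abs_dirStiff_le (bondInv_nonneg s x y) (bondInv_le h)
  have hb : ∀ d, |bond s x y d| ≤ 2 ^ 57 := by
    intro d
    unfold bond
    calc |x d - s d * y d| ≤ |x d| + |s d * y d| := abs_sub _ _
      _ ≤ 2 ^ 56 + 2 ^ 56 := by rw [abs_mul, hs, one_mul]; exact add_le_add (hx d) (hy d)
      _ = 2 ^ 57 := by norm_num
  unfold stiffness
  refine (abs_add_le _ _).trans (add_le_add ?_ ?_)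
  · split
    · exact h1
    · simp
  · rw [abs_mul, abs_mul]
    calc |dirStiff (bondInv s x y)| * (|bond s x y d| * |bond s x y e|)
        ≤ 2 ^ 264 * (2 ^ 57 * 2 ^ 57) := by gcongr <;> apply_rules
      _ = 2 ^ 378 := by norm_num

/-- The four bond vectors between the atoms over two sites are zero or long. -/
def Separated (i i' : ℕ) : Prop := ∀ k : Fin 4,
  (i = i' ∧ k = 0) ∨ 10 ^ 32 ≤ bondSq (bondSign (sitePar i * sitePar i') k) (siteInt i) (siteInt i')

theorem bondSq_self (i : ℕ) :
    bondSq (bondSign (sitePar i * sitePar i) 0) (siteInt i) (siteInt i) = 0 := by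
  rw [sitePar_mul_self]
  simp [bondSq, bond, bondSign]

theorem Separated.eq_zero_or {i i' : ℕ} (h : Separated i i') (k : Fin 4) :
    bondSq (bondSign (sitePar i * sitePar i') k) (siteInt i) (siteInt i') = 0 ∨
      10 ^ 32 ≤ bondSq (bondSign (sitePar i * sitePar i') k) (siteInt i) (siteInt i') := by
  rcases h k with ⟨rfl, rfl⟩ | h
  exacts [Or.inl (bondSq_self i), Or.inr h]

/-- A weighted sum of the four stiffness matrices of the bonds between two sites. -/
def coupling (w : (Fin 3 → ℤ) → Fin 3 → ℤ) (i i' : ℕ) (d e : Fin 3) : ℤ :=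
  ∑ k, w (bondSign (sitePar i * sitePar i') k) e *
    stiffness (bondSign (sitePar i * sitePar i') k) (siteInt i) (siteInt i') d e

theorem abs_siteInt_le (i : ℕ) (d : Fin 3) : |siteInt i d| ≤ 2 ^ 56 := by
  rw [siteInt, Nat.abs_cast]
  exact_mod_cast siteVec_le i d

theorem abs_coupling_le {w : (Fin 3 → ℤ) → Fin 3 → ℤ} {i i' : ℕ} (h : Separated i i')
    (hw : ∀ k e, |w (bondSign (sitePar i * sitePar i') k) e| ≤ 1) (d e : Fin 3) :
    |coupling w i i' d e| ≤ 4 * (2 ^ 367 + 2 ^ 378) := by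
  refine (abs_sum_le_sum_abs _ _).trans ?_
  calc _ ≤ ∑ _k : Fin 4, ((2 : ℤ) ^ 367 + 2 ^ 378) := sum_le_sum fun k _ => ?_
    _ = 4 * (2 ^ 367 + 2 ^ 378) := by rw [sum_const, card_univ, Fintype.card_fin]; norm_num
  rw [abs_mul]
  have := abs_stiffness_le (h.eq_zero_or k) (abs_bondSign (sitePar_mul_eq i i') k)
    (abs_siteInt_le i) (abs_siteInt_le i') d e
  nlinarith [hw k e, abs_nonneg (w (bondSign (sitePar i * sitePar i') k) e),
    abs_nonneg (stiffness (bondSign (sitePar i * sitePar i') k) (siteInt i) (siteInt i') d e)]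

theorem blockEven_spec {sh : ℕ} {k : BlockFn} {w : Fin 4 → Fin 3 → ℤ} {p : Fin 3 → Fin 3 → ℤ}
    (hk : BlockSpec HessRing sh k w p) (x y : Fin 3 → ℕ) (hy : ∀ d, y d ≤ 2 ^ 56) :
    blockEven k (x 0) (x 1) (x 2) (y 0) (y 1) (y 2) < (2 ^ 64) ^ 9 ∧ ∀ d e : Fin 3, ∃ E : ℕ,
      digit (2 ^ 64) (blockEven k (x 0) (x 1) (x 2) (y 0) (y 1) (y 2)) (3 * d + e) =
        digitOf sh E ∧ (E : HessRing) = (p d e + ∑ i, w i e *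
          stiffness (bondSign 1 i) (fun d => x d) (fun d => y d) d e : ℤ) := by
  have hle : ∀ d, y d ≤ hessModulus := fun d => (hy d).trans (by decide +kernel)
  let z : Fin 4 → ℕ :=
    ![inverseSq (sqSub (x 0) (y 0)) (sqSub (x 1) (y 1)) (sqSub (x 2) (y 2)),
      inverseSq (sqSub (x 0) (y 0)) (sqAdd (x 1) (y 1)) (sqAdd (x 2) (y 2)),
      inverseSq (sqAdd (x 0) (y 0)) (sqSub (x 1) (y 1)) (sqAdd (x 2) (y 2)),
      inverseSq (sqAdd (x 0) (y 0)) (sqAdd (x 1) (y 1)) (sqSub (x 2) (y 2))]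
  have hz : ∀ i, (z i : ℤ) = bondInv (bondSign 1 i) (fun d => x d) (fun d => y d) := by
    intro i
    fin_cases i <;> simp [z, natCast_inverseSq, natCast_sqAdd, natCast_sqSub, bondInv, bondSq,
      bond, bondSign]
  have hb : ∀ i d, bondTable (fun d => ((subMod hessModulus (x d) (y d) : ℕ) : HessRing))
      (fun d => ((Nat.add (x d) (y d) : ℕ) : HessRing)) i d =
      (bond (bondSign 1 i) (fun d => x d) (fun d => y d) d : ℤ) := by
    intro i d
    simp only [natCast_subMod hessModulus_cast _ (hle _), natCast_natAdd]
    fin_cases i <;> fin_cases d <;> simp [bondTable, bond, bondSign]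
  obtain ⟨h1, h2⟩ := hk (fun d => subMod hessModulus (x d) (y d)) (fun d => Nat.add (x d) (y d))
    (fun i => isoMod (z i)) (fun i => dirMod (z i)) (fun i => isoMod_le _) (fun i => dirMod_le _)
  refine ⟨h1, fun d e => ?_⟩
  obtain ⟨E, hE1, hE2⟩ := h2 d e
  refine ⟨E, hE1, hE2.trans ?_⟩
  simp only [hb, natCast_isoMod hessModulus_cast, natCast_dirMod hessModulus_cast, hz, stiffness]
  push_cast
  rfl

theorem blockOdd_spec {sh : ℕ} {k : BlockFn} {w : Fin 4 → Fin 3 → ℤ} {p : Fin 3 → Fin 3 → ℤ}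
    (hk : BlockSpec HessRing sh k w p) (x y : Fin 3 → ℕ) (hy : ∀ d, y d ≤ 2 ^ 56) :
    blockOdd k (x 0) (x 1) (x 2) (y 0) (y 1) (y 2) < (2 ^ 64) ^ 9 ∧ ∀ d e : Fin 3, ∃ E : ℕ,
      digit (2 ^ 64) (blockOdd k (x 0) (x 1) (x 2) (y 0) (y 1) (y 2)) (3 * d + e) =
        digitOf sh E ∧ (E : HessRing) = (p d e + ∑ i, w i e *
          stiffness (bondSign (-1) i) (fun d => x d) (fun d => y d) d e : ℤ) := by
  have hle : ∀ d, y d ≤ hessModulus := fun d => (hy d).trans (by decide +kernel)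
  let z : Fin 4 → ℕ :=
    ![inverseSq (sqAdd (x 0) (y 0)) (sqAdd (x 1) (y 1)) (sqAdd (x 2) (y 2)),
      inverseSq (sqAdd (x 0) (y 0)) (sqSub (x 1) (y 1)) (sqSub (x 2) (y 2)),
      inverseSq (sqSub (x 0) (y 0)) (sqAdd (x 1) (y 1)) (sqSub (x 2) (y 2)),
      inverseSq (sqSub (x 0) (y 0)) (sqSub (x 1) (y 1)) (sqAdd (x 2) (y 2))]
  have hz : ∀ i, (z i : ℤ) = bondInv (bondSign (-1) i) (fun d => x d) (fun d => y d) := by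
    intro i
    fin_cases i <;> simp [z, natCast_inverseSq, natCast_sqAdd, natCast_sqSub, bondInv, bondSq,
      bond, bondSign]
  have hb : ∀ i d, bondTable (fun d => ((Nat.add (x d) (y d) : ℕ) : HessRing))
      (fun d => ((subMod hessModulus (x d) (y d) : ℕ) : HessRing)) i d =
      (bond (bondSign (-1) i) (fun d => x d) (fun d => y d) d : ℤ) := by
    intro i d
    simp only [natCast_subMod hessModulus_cast _ (hle _), natCast_natAdd]
    fin_cases i <;> fin_cases d <;> simp [bondTable, bond, bondSign]
  obtain ⟨h1, h2⟩ := hk (fun d => Nat.add (x d) (y d)) (fun d => subMod hessModulus (x d) (y d))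
    (fun i => isoMod (z i)) (fun i => dirMod (z i)) (fun i => isoMod_le _) (fun i => dirMod_le _)
  refine ⟨h1, fun d e => ?_⟩
  obtain ⟨E, hE1, hE2⟩ := h2 d e
  refine ⟨E, hE1, hE2.trans ?_⟩
  simp only [hb, natCast_isoMod hessModulus_cast, natCast_dirMod hessModulus_cast, hz, stiffness]
  push_cast
  rfl

/-- The digits of the packed matrix of a pair of sites. -/
def PairSpec (sh : ℕ) (pair : ℕ → ℕ → ℕ → ℕ → ℕ) (z : ℕ → ℕ → Fin 3 → Fin 3 → ℤ) : Prop :=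
  ∀ i i', Separated i i' → pair (i / 6) (i % 6) (i' / 6) (i' % 6) < (2 ^ 64) ^ 9 ∧
    ∀ d e : Fin 3, |z i i' d e| ≤ 2 ^ 381 ∧
      (digit (2 ^ 64) (pair (i / 6) (i % 6) (i' / 6) (i' % 6)) (3 * d + e) : ℤ) =
        (z i i' d e + 2 ^ 382) / 2 ^ sh

theorem digitOf_eq_div_of_abs_le {sh E : ℕ} {z : ℤ} (h : (E : HessRing) = z) (h0 : |z| ≤ 2 ^ 381) :
    (digitOf sh E : ℤ) = (z + 2 ^ 382) / 2 ^ sh := by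
  have h1 := abs_le.mp h0
  have h2 : (2 : ℤ) ^ 381 < 2 ^ 382 := by norm_num
  exact digitOf_eq_div h (by linarith [h1.1]) (by linarith [h1.2])

/-- The packed blocks are known only modulo `2 ^ 384`. For separated sites all entries are at most
`2 ^ 381` in absolute value, which turns the congruences into equalities of integers. -/
theorem pairSpec_onPair {sh : ℕ} {w : (Fin 3 → ℤ) → Fin 3 → ℤ}
    {p : ℤ → (Fin 3 → ℤ) → (Fin 3 → ℤ) → Fin 3 → Fin 3 → ℤ}
    (k k' : (Fin 3 → ℕ) → (Fin 3 → ℕ) → BlockFn)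
    (hk : ∀ x y, BlockSpec HessRing sh (k x y) (fun i => w (bondSign 1 i))
      (p 1 (fun d => x d) (fun d => y d)))
    (hk' : ∀ x y, BlockSpec HessRing sh (k' x y) (fun i => w (bondSign (-1) i))
      (p (-1) (fun d => x d) (fun d => y d)))
    (hw : ∀ ε, ε = 1 ∨ ε = -1 → ∀ i e, |w (bondSign ε i) e| ≤ 1)
    (hp : ∀ ε, ε = 1 ∨ ε = -1 → ∀ x y : Fin 3 → ℤ, (∀ d, |x d| ≤ 2 ^ 56) → (∀ d, |y d| ≤ 2 ^ 56) →
      ∀ d e, |p ε x y d e| ≤ 2 ^ 367) :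
    PairSpec sh
      (onPair (fun x1 x2 x3 y1 y2 y3 => blockEven (k ![x1, x2, x3] ![y1, y2, y3]) x1 x2 x3 y1 y2 y3)
        (fun x1 x2 x3 y1 y2 y3 => blockOdd (k' ![x1, x2, x3] ![y1, y2, y3]) x1 x2 x3 y1 y2 y3))
      (fun i i' d e => p (sitePar i * sitePar i') (siteInt i) (siteInt i') d e +
        coupling w i i' d e) := by
  intro i i' hsep
  have hz : ∀ d e, |p (sitePar i * sitePar i') (siteInt i) (siteInt i') d e +
      coupling w i i' d e| ≤ 2 ^ 381 := by
    intro d e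
    have h1 := hp _ (sitePar_mul_eq i i') _ _ (abs_siteInt_le i) (abs_siteInt_le i') d e
    have h2 := abs_coupling_le hsep (hw _ (sitePar_mul_eq i i')) d e
    calc _ ≤ _ := abs_add_le _ _
      _ ≤ 2 ^ 367 + 4 * (2 ^ 367 + 2 ^ 378) := add_le_add h1 h2
      _ ≤ 2 ^ 381 := by norm_num
  have hy := siteVec_le i'
  simp only [coupling] at hz ⊢
  rw [sitePar_mul_sitePar] at hz ⊢
  by_cases hs : sameParity (i / 6) (i % 6) (i' / 6) (i' % 6) = true
  · obtain ⟨h1, h2⟩ := blockEven_spec (hk (siteVec i) (siteVec i')) (siteVec i) (siteVec i') hy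
    unfold onPair
    rw [hs] at hz ⊢
    rw [cond_true]
    rw [if_pos rfl] at hz ⊢
    refine ⟨h1, fun d e => ⟨hz d e, ?_⟩⟩
    obtain ⟨E, hE1, hE2⟩ := h2 d e
    exact (congrArg Nat.cast hE1).trans (digitOf_eq_div_of_abs_le hE2 (hz d e))
  · obtain ⟨h1, h2⟩ := blockOdd_spec (hk' (siteVec i) (siteVec i')) (siteVec i) (siteVec i') hy
    unfold onPair
    rw [Bool.not_eq_true] at hs
    rw [hs] at hz ⊢
    rw [cond_false]
    rw [if_neg Bool.false_ne_true] at hz ⊢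
    refine ⟨h1, fun d e => ⟨hz d e, ?_⟩⟩
    obtain ⟨E, hE1, hE2⟩ := h2 d e
    exact (congrArg Nat.cast hE1).trans (digitOf_eq_div_of_abs_le hE2 (hz d e))

theorem pairSpec_self : PairSpec 334 selfPair (coupling fun _ _ => 1) := by
  have := pairSpec_onPair (sh := 334) (w := fun _ _ => 1) (p := fun _ _ _ _ _ => 0)
    (fun _ _ => selfBlock) (fun _ _ => selfBlock) (fun _ _ => blockSpec_self _)
    (fun _ _ => blockSpec_self _) (by simp) (by simp)
  simp only [zero_add] at this
  exact this

theorem pairSpec_invariant : PairSpec 322 invariantPair (coupling fun s e => -s e) := by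
  have := pairSpec_onPair (sh := 322) (w := fun s e => -s e) (p := fun _ _ _ _ _ => 0)
    (fun _ _ => invariantEven) (fun _ _ => invariantOdd)
    (fun _ _ => blockSpec_invariantEven hessModulus_cast)
    (fun _ _ => blockSpec_invariantOdd hessModulus_cast)
    (fun ε hε i e => by rw [abs_neg, abs_bondSign hε]) (by simp)
  simp only [zero_add] at this
  exact this

theorem pairSpec_axial : PairSpec 322 axialPair (fun i i' d e =>
    axialPenalty (sitePar i * sitePar i') (siteInt i) (siteInt i') d e +
      coupling (fun s e => -(s 2 * s e)) i i' d e) := by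
  have h1 : ((rotationWeight : ℕ) : HessRing) = 2 ^ 249 := by
    rw [rotationWeight, natCast_natPow, Nat.cast_ofNat]
  have h2 : ((negMod hessModulus rotationWeight : ℕ) : HessRing) = -2 ^ 249 := by
    rw [natCast_negMod hessModulus_cast (by decide +kernel), h1]
  refine pairSpec_onPair (sh := 322) (w := fun s e => -(s 2 * s e)) (p := axialPenalty)
    (fun x y => axialBlock rotationWeight (negMod hessModulus rotationWeight)
      (x 0) (x 1) (y 0) (y 1))
    (fun x y => axialBlock (negMod hessModulus rotationWeight) rotationWeight
      (x 0) (x 1) (y 0) (y 1))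
    (fun x y => blockSpec_axial hessModulus_cast 1 _ _ (by rw [h1]; simp) (by rw [h2]; simp)
      (by norm_num) x y)
    (fun x y => blockSpec_axial hessModulus_cast (-1) _ _ (by rw [h2]; simp) (by rw [h1]; simp)
      (by norm_num) x y)
    (fun ε hε i e => by rw [abs_neg, abs_mul, abs_bondSign hε, abs_bondSign hε]; norm_num) ?_
  intro ε hε x y hx hy d e
  have hrot : ∀ x : Fin 3 → ℤ, (∀ d, |x d| ≤ 2 ^ 56) → ∀ d, |rotField x d| ≤ 2 ^ 56 := by
    intro x hx d
    fin_cases d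
    · simpa [rotField] using hx 1
    · simpa [rotField] using hx 0
    · simp [rotField]
  have hε' : |ε| = 1 := by rcases hε with rfl | rfl <;> simp
  unfold axialPenalty
  calc _ ≤ |2 ^ 249 * ε * (rotField x d * rotField y e)| +
        |if d = 2 ∧ e = 2 then (2 : ℤ) ^ 358 else 0| := abs_add_le _ _
    _ ≤ 2 ^ 249 * 1 * (2 ^ 56 * 2 ^ 56) + 2 ^ 358 := by
      refine add_le_add ?_ ?_
      · rw [abs_mul, abs_mul, abs_mul, hε', abs_of_nonneg (by positivity)]
        gcongr
        exacts [hrot x hx d, hrot y hy e]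
      · split
        · rw [abs_of_nonneg (by positivity)]
        · simp
    _ ≤ 2 ^ 367 := by norm_num

theorem cond_eq_true {a b : Bool} (h : (bif a then b else false) = true) : a = true ∧ b = true := by
  cases a <;> simp_all

theorem of_rec_cond {f : ℕ → Bool} {b : Bool} {n : ℕ}
    (h : n.rec b (fun c ih => bif f c then ih else false) = true) :
    b = true ∧ ∀ c < n, f c = true := by
  induction n with
  | zero => exact ⟨h, by simp⟩
  | succ n ih =>
    obtain ⟨h1, h2⟩ := cond_eq_true h
    obtain ⟨h3, h4⟩ := ih h2
    refine ⟨h3, fun c hc => ?_⟩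
    rcases Nat.lt_succ_iff_lt_or_eq.mp hc with hc | rfl
    exacts [h4 c hc, h1]

theorem of_allSites {f : ℕ → ℕ → Bool} (h : allSites f = true) {i : ℕ} (hi : i < 216) :
    f (i / 6) (i % 6) = true := by
  have key : ∀ n : ℕ, n.rec true (fun q ih => (nat_lit 6).rec ih
      fun c ihc => bif f q c then ihc else false) = true → ∀ q < n, ∀ c < 6, f q c = true := by
    intro n
    induction n with
    | zero => simp
    | succ n ih =>
      intro h q hq
      obtain ⟨h1, h2⟩ := of_rec_cond (f := f n) (n := 6) h
      rcases Nat.lt_succ_iff_lt_or_eq.mp hq with hq | rfl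
      exacts [ih h1 q hq, h2]
  exact key 36 h _ (by omega) _ (by omega)

theorem separated_of_check (h : allSites separationCheck = true) {i i' : ℕ} (hi : i < 216)
    (hi' : i' < 216) : Separated i i' := by
  have h1 := of_allSites (of_allSites h hi) hi'
  have hfar : ∀ a b c : ℕ, farEnough a b c = true → (10 : ℤ) ^ 32 ≤ (a : ℤ) + b + c := by
    intro a b c hab
    have := Nat.le_of_ble_eq_true hab
    exact_mod_cast this
  unfold separatedPair at h1
  unfold Separated
  rw [sitePar_mul_sitePar]
  by_cases hs : sameParity (i / 6) (i % 6) (i' / 6) (i' % 6) = true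
  · rw [hs, cond_true] at h1
    rw [if_pos hs]
    obtain ⟨h2, h3⟩ := cond_eq_true h1
    obtain ⟨h3, h4⟩ := cond_eq_true h3
    obtain ⟨h4, h5⟩ := cond_eq_true h4
    intro k
    fin_cases k
    · by_cases hii : i = i'
      · exact Or.inl ⟨hii, rfl⟩
      · right
        have : (bif Nat.beq (i / 6) (i' / 6) then Nat.beq (i % 6) (i' % 6) else false) = false := by
          rw [← Bool.not_eq_true]
          intro hc
          obtain ⟨e1, e2⟩ := cond_eq_true hc
          have := Nat.eq_of_beq_eq_true e1
          have := Nat.eq_of_beq_eq_true e2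
          omega
        rw [this, cond_false] at h2
        have := hfar _ _ _ h2
        simp only [natCast_sqSub] at this
        simpa [bondSq, bond, bondSign, siteInt, siteVec] using this
    all_goals right
    · have := hfar _ _ _ h3
      simp only [natCast_sqSub, natCast_sqAdd] at this
      simpa [bondSq, bond, bondSign, siteInt, siteVec] using this
    · have := hfar _ _ _ h4
      simp only [natCast_sqSub, natCast_sqAdd] at this
      simpa [bondSq, bond, bondSign, siteInt, siteVec] using this
    · have := hfar _ _ _ h5
      simp only [natCast_sqSub, natCast_sqAdd] at this
      simpa [bondSq, bond, bondSign, siteInt, siteVec] using this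
  · rw [Bool.not_eq_true] at hs
    rw [hs, cond_false] at h1
    rw [hs, if_neg Bool.false_ne_true]
    obtain ⟨h2, h3⟩ := cond_eq_true h1
    obtain ⟨h3, h4⟩ := cond_eq_true h3
    obtain ⟨h4, h5⟩ := cond_eq_true h4
    rw [cond_false] at h2
    intro k
    right
    fin_cases k
    · have := hfar _ _ _ h2
      simp only [natCast_sqAdd] at this
      simpa [bondSq, bond, bondSign, siteInt, siteVec] using this
    · have := hfar _ _ _ h3
      simp only [natCast_sqSub, natCast_sqAdd] at this
      simpa [bondSq, bond, bondSign, siteInt, siteVec] using this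
    · have := hfar _ _ _ h4
      simp only [natCast_sqSub, natCast_sqAdd] at this
      simpa [bondSq, bond, bondSign, siteInt, siteVec] using this
    · have := hfar _ _ _ h5
      simp only [natCast_sqSub, natCast_sqAdd] at this
      simpa [bondSq, bond, bondSign, siteInt, siteVec] using this

end Sites

/-! ### Rows of the reduced Hessian. -/

section Rows

open Finset

set_option exponentiation.threshold 5000

theorem horner6_eq (Y : ℕ) (f : ℕ → ℕ) : horner6 Y f = ∑ i ∈ range 6, f i * Y ^ i := by
  change f 0 + Y * (f 1 + Y * (f 2 + Y * (f 3 + Y * (f 4 + Y * f 5)))) = _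
  simp only [sum_range_succ, sum_range_zero]
  ring

theorem rowPart_eq (x d : ℕ) : rowPart x d = digit ((2 ^ 64) ^ 3) x d := by
  rw [rowPart, low_eq, digit]
  congr 1
  change x >>> (192 * d) = _
  rw [Nat.shiftRight_eq_div_pow, pow_mul, show 2 ^ 192 = (2 ^ 64) ^ 3 by rw [← pow_mul]]

theorem digit_rowPart (x d e : ℕ) (he : e < 3) :
    digit (2 ^ 64) (rowPart x d) e = digit (2 ^ 64) x (3 * d + e) := by
  rw [rowPart_eq, digit_digit _ _ _ _ _ he]

theorem rowPart_lt (x d : ℕ) : rowPart x d < (2 ^ 64) ^ 3 := by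
  rw [rowPart_eq]
  exact digit_lt (by positivity) _ _

theorem cond_lt {b : Bool} {x y n : ℕ} (hx : x < n) (hy : y < n) : (bif b then x else y) < n := by
  cases b <;> assumption

theorem rowTerm_lt (blk : ℕ → ℕ → ℕ → ℕ → ℕ) (q c d q' c' : ℕ) :
    rowTerm blk q c d q' c' < (2 ^ 64) ^ 3 :=
  have h0 : 0 < (2 ^ 64) ^ 3 := pow_pos (pow_pos two_pos 64) 3
  cond_lt (cond_lt (cond_lt (cond_lt (rowPart_lt _ _) (rowPart_lt _ _)) h0) (rowPart_lt _ _)) h0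

theorem sum_range_mul {M : Type*} [AddCommMonoid M] (n m : ℕ) (g : ℕ → M) :
    ∑ i ∈ range (m * n), g i = ∑ a ∈ range n, ∑ b ∈ range m, g (m * a + b) := by
  induction n with
  | zero => simp
  | succ n ih => rw [Nat.mul_succ, sum_range_add, ih, sum_range_succ]

theorem siteSum_eq_sum (w : ℕ) (f : ℕ → ℕ → ℕ) :
    siteSum w f = ∑ i ∈ range 216, f (i / 6) (i % 6) * (2 ^ w) ^ i := by
  have h : siteSum w f = horner6 (2 ^ (w * 36)) fun a => horner6 (2 ^ (w * 6)) fun b =>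
    horner6 (2 ^ w) fun c => f (6 * a + b) c := rfl
  rw [h, show 216 = 36 * 6 from rfl, sum_range_mul, horner6_eq]
  refine sum_congr rfl fun a _ => ?_
  rw [show 36 = 6 * 6 from rfl, sum_range_mul, horner6_eq, sum_mul]
  refine sum_congr rfl fun b _ => ?_
  rw [horner6_eq, sum_mul, sum_mul]
  refine sum_congr rfl fun c hc => ?_
  have hc := mem_range.mp hc
  rw [show (6 * 6 * a + (6 * b + c)) / 6 = 6 * a + b by omega,
    show (6 * 6 * a + (6 * b + c)) % 6 = c by omega, pow_mul, pow_mul, pow_add, pow_add,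
    ← pow_mul, ← pow_mul, ← pow_mul, ← pow_mul]
  ring

theorem digit_hessRow (blk : ℕ → ℕ → ℕ → ℕ → ℕ) (q c d : ℕ) {i e : ℕ} (hi : i < 216)
    (he : e < 3) : digit (2 ^ 64) (hessRow blk q c d) (3 * i + e) =
      digit (2 ^ 64) (rowTerm blk q c d (i / 6) (i % 6)) e := by
  rw [← digit_digit _ _ _ _ _ he, hessRow, siteSum_eq_sum, show 192 = 64 * 3 from rfl, pow_mul,
    digit_sum (z := fun i => rowTerm blk q c d (i / 6) (i % 6)) (fun _ _ => rowTerm_lt _ _ _ _ _ _)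
      hi]

theorem rowTerm_of_lt (blk : ℕ → ℕ → ℕ → ℕ → ℕ) {i i' : ℕ} (d : ℕ) (h : i' < i) :
    rowTerm blk (i / 6) (i % 6) d (i' / 6) (i' % 6) =
      rowPart (blk (i / 6) (i % 6) (i' / 6) (i' % 6)) d := by
  have h1 : Nat.ble (i' / 6) (i / 6) = true := Nat.ble_eq.mpr (by omega)
  unfold rowTerm
  rw [h1, cond_true]
  by_cases h2 : i' / 6 = i / 6
  · have h3 : Nat.beq (i' / 6) (i / 6) = true := Nat.beq_eq.mpr h2
    have h4 : Nat.ble (i' % 6) (i % 6) = true := Nat.ble_eq.mpr (by omega)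
    have h5 : Nat.beq (i' % 6) (i % 6) = false := Bool.eq_false_iff.mpr (by
      rw [Ne, Nat.beq_eq]; omega)
    rw [h3, h4, h5, cond_true, cond_true, cond_false]
  · have h3 : Nat.beq (i' / 6) (i / 6) = false := Bool.eq_false_iff.mpr (by
      rw [Ne, Nat.beq_eq]; omega)
    rw [h3, cond_false]

theorem rowTerm_self (blk : ℕ → ℕ → ℕ → ℕ → ℕ) (q c d : ℕ) :
    rowTerm blk q c d q c = rowPart (Nat.sub (Nat.add (blk q c q c)
      (Nat.mul 16777216 (selfMatrix q c))) diagShift) d := by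
  unfold rowTerm
  have h1 : ∀ n, Nat.ble n n = true := fun n => Nat.ble_eq.mpr le_rfl
  have h2 : ∀ n, Nat.beq n n = true := fun n => Nat.beq_eq.mpr rfl
  rw [h1, h2, h1, h2, cond_true, cond_true, cond_true, cond_true]

/-- The tabulated on-site stiffness matrix, with an offset. -/
def selfTab (i : ℕ) (d e : Fin 3) : ℕ :=
  selfEntry (i / 6) (i % 6) ((![![0, 1, 2], ![1, 3, 4], ![2, 4, 5]] : Fin 3 → Fin 3 → ℕ) d e)

theorem selfTab_comm (i : ℕ) (d e : Fin 3) : selfTab i d e = selfTab i e d := by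
  unfold selfTab
  fin_cases d <;> fin_cases e <;> rfl

theorem selfTab_lt (i : ℕ) (d e : Fin 3) : selfTab i d e < 2 ^ 24 := by
  have h : ∀ q c k, selfEntry q c k < 2 ^ 24 := by
    intro q c k
    exact Nat.and_lt_two_pow _ (n := 24) (by norm_num)
  exact h _ _ _

theorem selfMatrix_eq_sum (i : ℕ) : selfMatrix (i / 6) (i % 6) =
    ∑ l ∈ range 9, selfTab i (Fin.ofNat 3 (l / 3)) (Fin.ofNat 3 l) * (2 ^ 64) ^ l := by
  rw [sum_range_nine]
  simp only [selfMatrix, consDigit_eq]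
  generalize (2 : ℕ) ^ 64 = B
  simp [selfTab]

theorem constDigits_eq_sum (n c : ℕ) :
    constDigits n c = ∑ l ∈ range n, c * (2 ^ 64) ^ l := by
  change c * ones n = _
  rw [ones_eq, mul_sum]

def shiftDigit (d e : Fin 3) : ℕ := 2 ^ 47 + if d = e then 339000000000 else 0

theorem diagShift_eq_sum : diagShift =
    ∑ l ∈ range 9, shiftDigit (Fin.ofNat 3 (l / 3)) (Fin.ofNat 3 l) * (2 ^ 64) ^ l := by
  rw [sum_range_nine]
  have h : ∀ a b : ℕ, diagShiftOf a b =
      constDigits 9 a + b * (1 + ((2 ^ 64) ^ 4 + (2 ^ 64) ^ 8)) := fun a b => by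
    rw [← pow_mul, ← pow_mul]; rfl
  rw [diagShift, h, constDigits_eq_sum, show Nat.pow 2 47 = 2 ^ 47 from rfl]
  simp only [shiftDigit, sum_range_succ, sum_range_zero]
  generalize (2 : ℕ) ^ 64 = B
  generalize (2 : ℕ) ^ 47 = a
  generalize 339000000000 = b
  simp
  ring

theorem natCast_of_add_shiftDigit {D D' a : ℕ} {d e : Fin 3}
    (h : D + shiftDigit d e = D' + 2 ^ 24 * a) :
    (D : ℝ) = D' + 2 ^ 24 * a - (2 ^ 47 + if d = e then 339000000000 else 0) := by
  unfold shiftDigit at h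
  have h' := congrArg (Nat.cast (R := ℝ)) h
  push_cast at h'
  split_ifs at h' ⊢ <;> linarith

theorem eq_sum_digit {b n x : ℕ} (hx : x < b ^ n) :
    x = ∑ l ∈ range n, digit b x l * b ^ l := by
  rw [← mod_pow_eq_sum_digit, Nat.mod_eq_of_lt hx]

theorem ofNat_div_mod (d e : Fin 3) : Fin.ofNat 3 ((3 * (d : ℕ) + e) / 3) = d ∧
    Fin.ofNat 3 (3 * (d : ℕ) + e) = e :=
  ⟨Fin.ext (by simp [Fin.ofNat]; omega), Fin.ext (by simp [Fin.ofNat])⟩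

theorem three_mul_div_add_mod (l : ℕ) (hl : l < 9) :
    3 * ((Fin.ofNat 3 (l / 3) : Fin 3) : ℕ) + ((Fin.ofNat 3 l : Fin 3) : ℕ) = l := by
  simp only [Fin.ofNat]
  omega

/-- The entries of a diagonal block are at least `2 ^ 59` and `shiftDigit` is at most that, while
the sums stay below `2 ^ 64`. Adding and subtracting packed matrices therefore acts digit by digit.
-/
theorem digit_diagonal {x i : ℕ} (hx : x < (2 ^ 64) ^ 9)
    (h1 : ∀ l < 9, 2 ^ 59 ≤ digit (2 ^ 64) x l) (h2 : ∀ l < 9, digit (2 ^ 64) x l < 2 ^ 61)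
    (d e : Fin 3) :
    digit (2 ^ 64) (Nat.sub (Nat.add x (Nat.mul 16777216 (selfMatrix (i / 6) (i % 6)))) diagShift)
      (3 * d + e) + shiftDigit d e = digit (2 ^ 64) x (3 * d + e) + 2 ^ 24 * selfTab i d e := by
  let z : ℕ → ℕ := fun l => digit (2 ^ 64) x l + 2 ^ 24 * selfTab i (Fin.ofNat 3 (l / 3))
    (Fin.ofNat 3 l) - shiftDigit (Fin.ofNat 3 (l / 3)) (Fin.ofNat 3 l)
  have hs : ∀ d e, shiftDigit d e ≤ 2 ^ 59 := by
    intro d e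
    unfold shiftDigit
    split <;> norm_num
  have hzadd : ∀ l < 9, z l + shiftDigit (Fin.ofNat 3 (l / 3)) (Fin.ofNat 3 l) =
      digit (2 ^ 64) x l + 2 ^ 24 * selfTab i (Fin.ofNat 3 (l / 3)) (Fin.ofNat 3 l) :=
    fun l hl => Nat.sub_add_cancel (((hs _ _).trans (h1 l hl)).trans (Nat.le_add_right _ _))
  have hzlt : ∀ l < 9, z l < 2 ^ 64 := by
    intro l hl
    have e1 := hzadd l hl
    have e2 := h2 l hl
    have e3 := selfTab_lt i (Fin.ofNat 3 (l / 3)) (Fin.ofNat 3 l)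
    generalize selfTab i (Fin.ofNat 3 (l / 3)) (Fin.ofNat 3 l) = a at *
    generalize digit (2 ^ 64) x l = b at *
    omega
  have hz : Nat.sub (Nat.add x (Nat.mul 16777216 (selfMatrix (i / 6) (i % 6)))) diagShift =
      ∑ l ∈ range 9, z l * (2 ^ 64) ^ l := by
    have : x + 16777216 * selfMatrix (i / 6) (i % 6) =
        ∑ l ∈ range 9, z l * (2 ^ 64) ^ l + diagShift := by
      rw [diagShift_eq_sum, ← sum_add_distrib, selfMatrix_eq_sum, mul_sum]
      nth_rw 1 [eq_sum_digit hx]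
      rw [← sum_add_distrib]
      refine sum_congr rfl fun l hl => ?_
      rw [← add_mul, hzadd l (mem_range.mp hl), add_mul, mul_assoc]
      norm_num
    exact Nat.sub_eq_of_eq_add this
  rw [hz, digit_sum hzlt (by omega)]
  have := hzadd (3 * d + e) (by omega)
  rw [(ofNat_div_mod d e).1, (ofNat_div_mod d e).2] at this
  exact this

/-- The offset `2 ^ 382` becomes `2 ^ 60` after the shift by 322 bits, and rounding down loses at
most one unit. -/
theorem PairSpec.digit_bounds {pair : ℕ → ℕ → ℕ → ℕ → ℕ} {z : ℕ → ℕ → Fin 3 → Fin 3 → ℤ}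
    (h : PairSpec 322 pair z) {i i' : ℕ} (hs : Separated i i') (d e : Fin 3) :
    2 ^ 59 ≤ digit (2 ^ 64) (pair (i / 6) (i % 6) (i' / 6) (i' % 6)) (3 * d + e) ∧
    digit (2 ^ 64) (pair (i / 6) (i % 6) (i' / 6) (i' % 6)) (3 * d + e) < 2 ^ 61 ∧
    |(z i i' d e : ℝ) / 2 ^ 322 -
      ((digit (2 ^ 64) (pair (i / 6) (i % 6) (i' / 6) (i' % 6)) (3 * d + e) : ℝ) - 2 ^ 60)| ≤ 1 := by
  obtain ⟨h1, h2⟩ := (h i i' hs).2 d e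
  generalize digit (2 ^ 64) (pair (i / 6) (i % 6) (i' / 6) (i' % 6)) (3 * d + e) = D at *
  generalize z i i' d e = w at *
  have hw := abs_le.mp h1
  have hp : (0 : ℤ) < 2 ^ 322 := by positivity
  have h3 := Int.mul_ediv_self_le (x := w + 2 ^ 382) hp.ne'
  have h4 := Int.lt_mul_ediv_self_add (x := w + 2 ^ 382) hp
  rw [← h2] at h3 h4
  refine ⟨?_, ?_, ?_⟩
  · by_contra hc
    have : (D : ℤ) + 1 ≤ 2 ^ 59 := by exact_mod_cast (not_le.mp hc)
    have h5 : (2 : ℤ) ^ 322 * (D + 1) ≤ 2 ^ 322 * 2 ^ 59 := by gcongr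
    linarith [hw.1]
  · by_contra hc
    have : (2 : ℤ) ^ 61 ≤ D := by exact_mod_cast (not_lt.mp hc)
    have h5 : (2 : ℤ) ^ 322 * 2 ^ 61 ≤ 2 ^ 322 * D := by gcongr
    linarith [hw.2]
  · have h3' : (2 : ℝ) ^ 322 * D ≤ w + 2 ^ 382 := by exact_mod_cast h3
    have h4' : (w : ℝ) + 2 ^ 382 ≤ 2 ^ 322 * D + 2 ^ 322 := by exact_mod_cast h4.le
    have e1 : (w : ℝ) / 2 ^ 322 - ((D : ℝ) - 2 ^ 60) = (w + 2 ^ 382 - 2 ^ 322 * D) / 2 ^ 322 := by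
      field_simp
      ring
    rw [e1, abs_of_nonneg (div_nonneg (by linarith) (by positivity)),
      div_le_one (by positivity)]
    linarith

/-- The shifted reduced Hessian, in units of `2 ^ 322`. -/
noncomputable def shiftedHessian (z : ℕ → ℕ → Fin 3 → Fin 3 → ℤ) (i i' : ℕ) (d e : Fin 3) : ℝ :=
  z i i' d e / 2 ^ 322 +
    if i = i' then 2 ^ 24 * ((selfTab i d e : ℝ) - 2 ^ 23) - (if d = e then 339000000000 else 0)
    else 0

theorem hessRow_spec {pair : ℕ → ℕ → ℕ → ℕ → ℕ} {z : ℕ → ℕ → Fin 3 → Fin 3 → ℤ}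
    (h : PairSpec 322 pair z) (hsep : ∀ i < 216, ∀ i' < 216, Separated i i') {i i' : ℕ}
    (hi : i < 216) (hi' : i' ≤ i) (d e : Fin 3) :
    digit (2 ^ 64) (hessRow pair (i / 6) (i % 6) d) (3 * i' + e) < 2 ^ 62 ∧
    |shiftedHessian z i i' d e -
      ((digit (2 ^ 64) (hessRow pair (i / 6) (i % 6) d) (3 * i' + e) : ℝ) - 2 ^ 60)| ≤ 1 := by
  have hs := hsep i hi i' (by omega)
  obtain ⟨h1, h2, h3⟩ := h.digit_bounds hs d e
  rw [digit_hessRow _ _ _ _ (by omega) e.2]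
  rcases hi'.lt_or_eq with hlt | rfl
  · rw [rowTerm_of_lt _ _ hlt, digit_rowPart _ _ _ e.2, shiftedHessian, if_neg hlt.ne', add_zero]
    exact ⟨h2.trans (by norm_num), h3⟩
  · have hd := digit_diagonal (x := pair (i' / 6) (i' % 6) (i' / 6) (i' % 6)) (i := i')
      (h i' i' hs).1
      (fun l hl => by
        have := (h.digit_bounds hs (Fin.ofNat 3 (l / 3)) (Fin.ofNat 3 l)).1
        rwa [three_mul_div_add_mod l hl] at this)
      (fun l hl => by
        have := (h.digit_bounds hs (Fin.ofNat 3 (l / 3)) (Fin.ofNat 3 l)).2.1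
        rwa [three_mul_div_add_mod l hl] at this) d e
    rw [rowTerm_self, digit_rowPart _ _ _ e.2, shiftedHessian, if_pos rfl]
    have hlt := selfTab_lt i' d e
    have h4 : (digit (2 ^ 64) (Nat.sub (Nat.add (pair (i' / 6) (i' % 6) (i' / 6) (i' % 6))
        (Nat.mul 16777216 (selfMatrix (i' / 6) (i' % 6)))) diagShift) (3 * d + e) : ℝ) =
        (digit (2 ^ 64) (pair (i' / 6) (i' % 6) (i' / 6) (i' % 6)) (3 * d + e) : ℝ) +
        2 ^ 24 * selfTab i' d e - (2 ^ 47 + if d = e then 339000000000 else 0) :=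
      natCast_of_add_shiftDigit hd
    generalize digit (2 ^ 64) (Nat.sub (Nat.add (pair (i' / 6) (i' % 6) (i' / 6) (i' % 6))
        (Nat.mul 16777216 (selfMatrix (i' / 6) (i' % 6)))) diagShift) (3 * d + e) = D at *
    generalize digit (2 ^ 64) (pair (i' / 6) (i' % 6) (i' / 6) (i' % 6)) (3 * d + e) = D' at *
    constructor
    · generalize selfTab i' d e = a at *
      omega
    · rw [h4]
      refine le_trans (le_of_eq ?_) h3
      congr 1
      ring

theorem sum_range_split (g : ℕ → Fin 3 → ℝ) :
    ∑ j ∈ range 648, g (j / 3) (Fin.ofNat 3 j) = ∑ i ∈ range 216, ∑ d, g i d := by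
  rw [show 648 = 3 * 216 from rfl, sum_range_mul]
  refine sum_congr rfl fun i _ => ?_
  rw [sum_range]
  refine sum_congr rfl fun d _ => ?_
  congr 1
  · omega
  · exact Fin.ext (by simp [Fin.ofNat])

theorem sum_sum_range_split (A : ℕ → ℕ → Fin 3 → Fin 3 → ℝ) (x : ℕ → Fin 3 → ℝ) :
    ∑ j ∈ range 648, ∑ l ∈ range 648, A (j / 3) (l / 3) (Fin.ofNat 3 j) (Fin.ofNat 3 l) *
      x (j / 3) (Fin.ofNat 3 j) * x (l / 3) (Fin.ofNat 3 l) =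
    ∑ i ∈ range 216, ∑ i' ∈ range 216, ∑ d, ∑ e, A i i' d e * x i d * x i' e := by
  rw [sum_range_split fun i d => ∑ l ∈ range 648, A i (l / 3) d (Fin.ofNat 3 l) *
    x i d * x (l / 3) (Fin.ofNat 3 l)]
  refine sum_congr rfl fun i _ => ?_
  rw [sum_comm (s := range 216)]
  refine sum_congr rfl fun d _ => ?_
  exact sum_range_split fun i' e => A i i' d e * x i d * x i' e

/-- Coordinates are numbered `j = 3 * i + d`. The rows store only the part up to the diagonal, so
the symmetry `hz` supplies the rest of the matrix. -/
theorem shiftedHessian_nonneg {pair : ℕ → ℕ → ℕ → ℕ → ℕ} {z : ℕ → ℕ → Fin 3 → Fin 3 → ℤ}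
    (h : PairSpec 322 pair z) (hsep : ∀ i < 216, ∀ i' < 216, Separated i i')
    (hz : ∀ i i' d e, z i i' d e = z i' i e d) (hc : cholesky pair 36 0 0 [] = true)
    (x : ℕ → Fin 3 → ℝ) :
    0 ≤ ∑ i ∈ range 216, ∑ i' ∈ range 216, ∑ d, ∑ e, shiftedHessian z i i' d e * x i d * x i' e +
      (2 ^ 25 + 1) * 649 * ∑ i ∈ range 216, ∑ d, x i d ^ 2 := by
  have hsym : ∀ i i' d e, shiftedHessian z i i' d e = shiftedHessian z i' i e d := by
    intro i i' d e
    unfold shiftedHessian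
    rw [hz]
    by_cases hii : i = i'
    · subst hii
      simp only [selfTab_comm i d e, eq_comm (a := d)]
    · rw [if_neg hii, if_neg (Ne.symm hii)]
  have key : ∀ q < 36, ∀ c < 6, ∀ d < 3, ∀ l ≤ 18 * q + 3 * c + d,
      digit (2 ^ 64) (hessRow pair q c d) l < 2 ^ 62 ∧
      |shiftedHessian z ((18 * q + 3 * c + d) / 3) (l / 3) (Fin.ofNat 3 (18 * q + 3 * c + d))
        (Fin.ofNat 3 l) - ((digit (2 ^ 64) (hessRow pair q c d) l : ℝ) - 2 ^ 60)| ≤ 1 := by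
    intro q hq c hc d hd l hl
    have := hessRow_spec h hsep (i := (18 * q + 3 * c + d) / 3) (i' := l / 3) (by omega) (by omega)
      (Fin.ofNat 3 (18 * q + 3 * c + d)) (Fin.ofNat 3 l)
    have e1 : ((Fin.ofNat 3 (18 * q + 3 * c + d) : Fin 3) : ℕ) = d := by
      simp only [Fin.ofNat]; omega
    have e2 : 3 * (l / 3) + ((Fin.ofNat 3 l : Fin 3) : ℕ) = l := by
      simp only [Fin.ofNat]; omega
    rwa [e2, e1, show (18 * q + 3 * c + d) / 3 / 6 = q by omega,
      show (18 * q + 3 * c + d) / 3 % 6 = c by omega] at this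
  have := cholesky_sound (A := fun j l => shiftedHessian z (j / 3) (l / 3) (Fin.ofNat 3 j)
    (Fin.ofNat 3 l)) (fun _ _ => hsym _ _ _ _) (fun q hq c hc d hd l hl => (key q hq c hc d hd l hl).1)
    (fun q hq c hc d hd l hl => (key q hq c hc d hd l hl).2) hc
    (fun j => x (j / 3) (Fin.ofNat 3 j))
  rw [sum_range_split fun i d => x i d ^ 2, sum_sum_range_split] at this
  exact this

end Rows

/-! ### On-site stiffness and the bound for one symmetry component. -/

section Reduced

open Finset

set_option exponentiation.threshold 5000

theorem of_digitsBelow {w b n m x y : ℕ} (hbw : b ≤ w)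
    (hm : m = (2 ^ w - 2 ^ b) * ∑ l ∈ range n, (2 ^ w) ^ l)
    (h : digitsBelow ((2 ^ w) ^ n) m x y = true) :
    ∃ r : ℕ → ℕ, (∀ l < n, r l < 2 ^ b) ∧ x = y + ∑ l ∈ range n, r l * (2 ^ w) ^ l := by
  unfold digitsBelow at h
  obtain ⟨h1, h2⟩ := cond_eq_true h
  have hle : y ≤ x := Nat.le_of_ble_eq_true h1
  cases h3 : Nat.ble ((2 ^ w) ^ n) (Nat.sub x y) with
  | true => rw [h3] at h2; exact absurd h2 Bool.false_ne_true
  | false =>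
    rw [h3, cond_false] at h2
    have h4 : x - y < (2 ^ w) ^ n := by
      by_contra hc
      exact absurd (Nat.ble_eq.mpr (not_lt.mp hc)) (by rw [← Nat.sub_eq, h3]; exact Bool.false_ne_true)
    have h5 : (x - y) &&& m = 0 := Nat.eq_of_beq_eq_true h2
    rw [hm] at h5
    refine ⟨fun l => digit (2 ^ w) (x - y) l, fun l hl => digit_lt_of_land_eq_zero hbw h5 hl, ?_⟩
    rw [← eq_sum_digit h4]
    omega

theorem siteSum_zero (f : ℕ → ℕ → ℕ) : siteSum 0 f = ∑ i ∈ range 216, f (i / 6) (i % 6) := by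
  rw [siteSum_eq_sum]
  simp

theorem ediv_bounds {z D : ℤ} {m : ℤ} (hm : 0 < m) (h : D = (z + 2 ^ 382) / m) :
    m * D ≤ z + 2 ^ 382 ∧ z + 2 ^ 382 < m * D + m := by
  have h3 := Int.mul_ediv_self_le (x := z + 2 ^ 382) hm.ne'
  have h4 := Int.lt_mul_ediv_self_add (x := z + 2 ^ 382) hm
  rw [← h] at h3 h4
  exact ⟨h3, h4⟩

theorem selfSide_add (i c : ℕ) (r : ℕ → ℕ) :
    Nat.add (Nat.mul 4096 (selfMatrix (i / 6) (i % 6))) (constDigits 9 c) +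
      ∑ l ∈ range 9, r l * (2 ^ 64) ^ l =
      ∑ l ∈ range 9, (4096 * selfTab i (Fin.ofNat 3 (l / 3)) (Fin.ofNat 3 l) + c + r l) *
        (2 ^ 64) ^ l := by
  rw [Nat.add_eq, Nat.mul_eq, constDigits_eq_sum, selfMatrix_eq_sum, mul_sum, ← sum_add_distrib,
    ← sum_add_distrib]
  refine sum_congr rfl fun l _ => ?_
  generalize (2 ^ 64) ^ l = B
  ring

/-- The constant is `4312 = 4096 + 216`: the check tolerates a discrepancy below `2 ^ 12` units of
`2 ^ 334`, and each of the 216 summands is rounded down by at most one unit. -/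
theorem selfTab_spec (hsep : ∀ i < 216, ∀ i' < 216, Separated i i')
    (hcheck : allSites selfCheck = true) {i : ℕ} (hi : i < 216) (d e : Fin 3) :
    |(∑ i' ∈ range 216, coupling (fun _ _ => 1) i i' d e) - 2 ^ 346 * ((selfTab i d e : ℤ) - 2 ^ 23)| ≤
      4312 * 2 ^ 334 := by
  have h0 := of_allSites hcheck hi
  unfold selfCheck at h0
  rw [siteSum_zero, show Nat.pow 2 576 = (2 ^ 64) ^ 9 by rw [← pow_mul]; rfl] at h0
  obtain ⟨r, hr, hxy⟩ := of_digitsBelow (w := 64) (b := 12) (by norm_num)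
    (by rw [constDigits_eq, show 2 ^ 64 - 2 ^ 12 = 18446744073709547520 by norm_num]) h0
  set D : ℕ → ℕ → ℕ := fun i' l =>
    digit (2 ^ 64) (selfPair (i / 6) (i % 6) (i' / 6) (i' % 6)) l with hD
  have hspec := fun i' (hi' : i' < 216) => pairSpec_self i i' (hsep i hi i' hi')
  have hDb : ∀ i' < 216, ∀ d e : Fin 3,
      2 ^ 334 * (D i' (3 * d + e) : ℤ) ≤ coupling (fun _ _ => 1) i i' d e + 2 ^ 382 ∧
      coupling (fun _ _ => 1) i i' d e + 2 ^ 382 < 2 ^ 334 * (D i' (3 * d + e) : ℤ) + 2 ^ 334 :=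
    fun i' hi' d e => ediv_bounds (by positivity) ((hspec i' hi').2 d e).2
  have hDlt : ∀ i' < 216, ∀ l < 9, D i' l < 2 ^ 49 := by
    intro i' hi' l hl
    have h1 := (hDb i' hi' (Fin.ofNat 3 (l / 3)) (Fin.ofNat 3 l)).1
    have h2 := (abs_le.mp ((hspec i' hi').2 (Fin.ofNat 3 (l / 3)) (Fin.ofNat 3 l)).1).2
    rw [three_mul_div_add_mod l hl] at h1
    generalize D i' l = D' at *
    by_contra hc
    have h3 : (2 : ℤ) ^ 49 ≤ D' := by exact_mod_cast (not_lt.mp hc)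
    have h4 : (2 : ℤ) ^ 334 * 2 ^ 49 ≤ 2 ^ 334 * D' := by gcongr
    linarith
  have hx : ∑ i' ∈ range 216, selfPair (i / 6) (i % 6) (i' / 6) (i' % 6) =
      ∑ l ∈ range 9, (∑ i' ∈ range 216, D i' l) * (2 ^ 64) ^ l := by
    simp only [sum_mul]
    rw [sum_comm]
    exact sum_congr rfl fun i' hi' => eq_sum_digit (hspec i' (mem_range.mp hi')).1
  -- Each of the 216 digits carries the offset `2 ^ 382 / 2 ^ 334 = 2 ^ 48`, and the tabulated
  -- entries carry `2 ^ 23`, which the factor 4096 turns into `2 ^ 35`.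
  set c : ℕ := Nat.sub (Nat.mul 216 (Nat.pow 2 48)) (Nat.pow 2 35) with hc
  have hc' : c + 2 ^ 35 = 216 * 2 ^ 48 := by rw [hc]; decide +kernel
  rw [hx, selfSide_add] at hxy
  have hl : 3 * (d : ℕ) + e < 9 := by omega
  have hdig := digit_ext ?_ ?_ hxy hl
  · rw [(ofNat_div_mod d e).1, (ofNat_div_mod d e).2] at hdig
    have hr' := hr _ hl
    generalize r (3 * d + e) = ρ at *
    have h1 : 2 ^ 334 * (∑ i' ∈ range 216, (D i' (3 * d + e) : ℤ)) ≤
        (∑ i' ∈ range 216, coupling (fun _ _ => 1) i i' d e) + 216 * 2 ^ 382 := by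
      have : ∑ i' ∈ range 216, 2 ^ 334 * (D i' (3 * d + e) : ℤ) ≤
          ∑ i' ∈ range 216, (coupling (fun _ _ => 1) i i' d e + 2 ^ 382) :=
        sum_le_sum fun i' hi' => (hDb i' (mem_range.mp hi') d e).1
      rwa [← mul_sum, sum_add_distrib, sum_const, card_range, nsmul_eq_mul] at this
    have h2 : (∑ i' ∈ range 216, coupling (fun _ _ => 1) i i' d e) + 216 * 2 ^ 382 ≤
        2 ^ 334 * (∑ i' ∈ range 216, (D i' (3 * d + e) : ℤ)) + 216 * 2 ^ 334 := by
      have : ∑ i' ∈ range 216, (coupling (fun _ _ => 1) i i' d e + 2 ^ 382) ≤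
          ∑ i' ∈ range 216, (2 ^ 334 * (D i' (3 * d + e) : ℤ) + 2 ^ 334) :=
        sum_le_sum fun i' hi' => (hDb i' (mem_range.mp hi') d e).2.le
      rwa [sum_add_distrib, sum_add_distrib, sum_const, sum_const, card_range, nsmul_eq_mul,
        nsmul_eq_mul, ← mul_sum] at this
    rw [← Nat.cast_sum, hdig] at h1 h2
    generalize (∑ i' ∈ range 216, coupling (fun _ _ => 1) i i' d e) = C at *
    generalize selfTab i d e = S at *
    have hc'' : (c : ℤ) = 216 * 2 ^ 48 - 2 ^ 35 := by
      have := congrArg (Nat.cast (R := ℤ)) hc'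
      push_cast at this
      linarith
    have hρ : (ρ : ℤ) ≤ 2 ^ 12 := by exact_mod_cast hr'.le
    have hρ0 : (0 : ℤ) ≤ ρ := Int.natCast_nonneg ρ
    push_cast at h1 h2
    rw [hc''] at h1 h2
    rw [abs_le]
    constructor <;> linarith
  · intro l hl
    have : ∑ i' ∈ range 216, D i' l ≤ ∑ _i' ∈ range 216, 2 ^ 49 :=
      sum_le_sum fun i' hi' => (hDlt i' (mem_range.mp hi') l hl).le
    refine this.trans_lt ?_
    rw [sum_const, card_range]
    norm_num
  · intro l hl
    have h1 := selfTab_lt i (Fin.ofNat 3 (l / 3)) (Fin.ofNat 3 l)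
    have h2 := hr l hl
    generalize selfTab i (Fin.ofNat 3 (l / 3)) (Fin.ofNat 3 l) = S at *
    generalize r l = ρ at *
    omega

/-- Exchanging the end points multiplies the component `d` of the bond by `-s d` and keeps its
length. -/
theorem stiffness_swap {s : Fin 3 → ℤ} (hs : ∀ d, s d * s d = 1) (x y : Fin 3 → ℤ) (d e : Fin 3) :
    stiffness s y x d e = s d * s e * stiffness s x y d e := by
  have hb : ∀ d, bond s y x d = -(s d) * bond s x y d := by
    intro d
    unfold bond
    linear_combination -y d * hs d
  have hq : bondSq s y x = bondSq s x y := by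
    unfold bondSq
    rw [hb, hb, hb]
    linear_combination bond s x y 0 ^ 2 * hs 0 + bond s x y 1 ^ 2 * hs 1 + bond s x y 2 ^ 2 * hs 2
  have hi : bondInv s y x = bondInv s x y := by rw [bondInv, bondInv, hq]
  unfold stiffness
  rw [hi, hb, hb]
  split
  · subst e
    linear_combination (-isoStiff (bondInv s x y)) * hs d
  · ring

theorem stiffness_comm (s x y : Fin 3 → ℤ) (d e : Fin 3) :
    stiffness s x y d e = stiffness s x y e d := by
  unfold stiffness
  rw [mul_comm (bond s x y d)]
  simp only [eq_comm]

theorem bondSign_mul_self {ε : ℤ} (hε : ε = 1 ∨ ε = -1) (k : Fin 4) (d : Fin 3) :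
    bondSign ε k d * bondSign ε k d = 1 := by
  rw [← abs_mul_abs_self, abs_bondSign hε, one_mul]

/-- Symmetry of the reduced Hessian: the condition on `w` says that the weight absorbs the signs
produced by exchanging the end points. -/
theorem coupling_swap {w : (Fin 3 → ℤ) → Fin 3 → ℤ}
    (hw : ∀ s : Fin 3 → ℤ, (∀ d, s d * s d = 1) → ∀ d e, w s d * (s d * s e) = w s e)
    (i i' : ℕ) (d e : Fin 3) : coupling w i i' d e = coupling w i' i e d := by
  unfold coupling
  rw [mul_comm (sitePar i')]
  refine sum_congr rfl fun k _ => ?_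
  have hs := bondSign_mul_self (sitePar_mul_eq i i') k
  rw [stiffness_swap hs (siteInt i), stiffness_comm _ _ _ e, ← hw _ hs d e]
  ring

theorem mul_mul_le_of_abs_sub_le {C S : ℝ}
    (h : |C - 2 ^ 346 * (S - 2 ^ 23)| ≤ 4312 * 2 ^ 334) (a b : ℝ) :
    2 ^ 24 * (S - 2 ^ 23) * a * b ≤
      C * a * b / 2 ^ 322 + 4312 * 2 ^ 12 * ((a ^ 2 + b ^ 2) / 2) := by
  obtain ⟨h6, h7⟩ := abs_le.mp h
  have h8 : -(4312 * 2 ^ 12) ≤ C / 2 ^ 322 - 2 ^ 24 * (S - 2 ^ 23) := by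
    rw [le_sub_iff_add_le, le_div_iff₀ (by positivity)]
    linarith
  have h9 : C / 2 ^ 322 - 2 ^ 24 * (S - 2 ^ 23) ≤ 4312 * 2 ^ 12 := by
    rw [sub_le_iff_le_add, div_le_iff₀ (by positivity)]
    linarith
  rw [show C * a * b / 2 ^ 322 = C / 2 ^ 322 * (a * b) by ring]
  generalize C / 2 ^ 322 = C' at *
  generalize 2 ^ 24 * (S - 2 ^ 23) = T at *
  generalize (4312 * 2 ^ 12 : ℝ) = K at *
  nlinarith [mul_nonneg (sub_nonneg.mpr h9) (sq_nonneg (a - b)),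
    mul_nonneg (sub_nonneg.mpr h8) (sq_nonneg (a + b))]

/-- The quadratic form on one symmetry component, bounded below. -/
theorem reduced_form_bound {pair : ℕ → ℕ → ℕ → ℕ → ℕ} {z : ℕ → ℕ → Fin 3 → Fin 3 → ℤ}
    (h : PairSpec 322 pair z) (hsep : ∀ i < 216, ∀ i' < 216, Separated i i')
    (hself : allSites selfCheck = true)
    (hz : ∀ i i' d e, z i i' d e = z i' i e d) (hc : cholesky pair 36 0 0 [] = true)
    (x : ℕ → Fin 3 → ℝ) :
    300000000000 * 2 ^ 322 * ∑ i ∈ range 216, ∑ d, x i d ^ 2 ≤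
      ∑ i ∈ range 216, ∑ i' ∈ range 216, ∑ d, ∑ e, (z i i' d e : ℝ) * x i d * x i' e +
      ∑ i ∈ range 216, ∑ i' ∈ range 216, ∑ d, ∑ e,
        (coupling (fun _ _ => 1) i i' d e : ℝ) * x i d * x i e := by
  have h1 := shiftedHessian_nonneg h hsep hz hc x
  have h2 : ∑ i ∈ range 216, ∑ i' ∈ range 216, ∑ d, ∑ e,
      shiftedHessian z i i' d e * x i d * x i' e =
      (∑ i ∈ range 216, ∑ i' ∈ range 216, ∑ d, ∑ e, (z i i' d e : ℝ) * x i d * x i' e) / 2 ^ 322 +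
      ∑ i ∈ range 216, (∑ d, ∑ e, 2 ^ 24 * ((selfTab i d e : ℝ) - 2 ^ 23) * x i d * x i e -
        339000000000 * ∑ d, x i d ^ 2) := by
    rw [sum_div, ← sum_add_distrib]
    refine sum_congr rfl fun i hi => ?_
    have h3 : ∀ i' ∈ range 216, ∑ d, ∑ e, shiftedHessian z i i' d e * x i d * x i' e =
        (∑ d, ∑ e, (z i i' d e : ℝ) * x i d * x i' e) / 2 ^ 322 + if i = i' then
          (∑ d, ∑ e, 2 ^ 24 * ((selfTab i d e : ℝ) - 2 ^ 23) * x i d * x i e -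
            339000000000 * ∑ d, x i d ^ 2) else 0 := by
      intro i' _
      simp only [shiftedHessian]
      by_cases hii : i = i'
      · subst hii
        simp only [if_true, Fin.sum_univ_three]
        simp
        ring
      · simp only [if_neg hii, Fin.sum_univ_three]
        ring
    rw [sum_congr rfl h3, sum_add_distrib, sum_ite_eq, if_pos hi, sum_div]
  have h4 : ∀ i ∈ range 216, ∑ d, ∑ e, 2 ^ 24 * ((selfTab i d e : ℝ) - 2 ^ 23) * x i d * x i e ≤
      (∑ i' ∈ range 216, ∑ d, ∑ e, (coupling (fun _ _ => 1) i i' d e : ℝ) * x i d * x i e) /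
        2 ^ 322 + 3 * (4312 * 2 ^ 12) * ∑ d, x i d ^ 2 := by
    intro i hi
    have e1 : ∑ i' ∈ range 216, ∑ d, ∑ e, (coupling (fun _ _ => 1) i i' d e : ℝ) * x i d * x i e =
        ∑ d, ∑ e, (∑ i' ∈ range 216, (coupling (fun _ _ => 1) i i' d e : ℝ)) * x i d * x i e := by
      rw [sum_comm]
      refine sum_congr rfl fun d _ => ?_
      rw [sum_comm]
      refine sum_congr rfl fun e _ => ?_
      rw [sum_mul, sum_mul]
    have e2 : ∀ d e, 2 ^ 24 * ((selfTab i d e : ℝ) - 2 ^ 23) * x i d * x i e ≤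
        (∑ i' ∈ range 216, (coupling (fun _ _ => 1) i i' d e : ℝ)) * x i d * x i e / 2 ^ 322 +
          4312 * 2 ^ 12 * ((x i d ^ 2 + x i e ^ 2) / 2) := by
      intro d e
      have := selfTab_spec hsep hself (mem_range.mp hi) d e
      have h5 : |(∑ i' ∈ range 216, (coupling (fun _ _ => 1) i i' d e : ℝ)) -
          2 ^ 346 * ((selfTab i d e : ℝ) - 2 ^ 23)| ≤ 4312 * 2 ^ 334 := by exact_mod_cast this
      exact mul_mul_le_of_abs_sub_le h5 _ _
    rw [e1]
    calc _ ≤ ∑ d, ∑ e, ((∑ i' ∈ range 216, (coupling (fun _ _ => 1) i i' d e : ℝ)) *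
          x i d * x i e / 2 ^ 322 + 4312 * 2 ^ 12 * ((x i d ^ 2 + x i e ^ 2) / 2)) :=
        sum_le_sum fun d _ => sum_le_sum fun e _ => e2 d e
      _ = _ := by
        simp only [Fin.sum_univ_three]
        generalize (4312 * 2 ^ 12 : ℝ) = K
        generalize (2 ^ 322 : ℝ) = L
        ring
  have h5 := sum_le_sum h4
  rw [h2, sum_sub_distrib, ← mul_sum] at h1
  rw [sum_add_distrib, ← mul_sum, ← sum_div] at h5
  set N := ∑ i ∈ range 216, ∑ d, x i d ^ 2
  have hN : 0 ≤ N := sum_nonneg fun i _ => sum_nonneg fun d _ => sq_nonneg _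
  rw [← sub_nonneg]
  generalize ∑ i ∈ range 216, ∑ i' ∈ range 216, ∑ d, ∑ e, (z i i' d e : ℝ) * x i d * x i' e = a at *
  generalize ∑ i ∈ range 216, ∑ i' ∈ range 216, ∑ d, ∑ e,
    (coupling (fun _ _ => 1) i i' d e : ℝ) * x i d * x i e = b at *
  -- The diagonal shift `339 * 10 ^ 9` exceeds `300 * 10 ^ 9` by more than the Cholesky error `649 *
  -- (2 ^ 25 + 1)`, about `21.8 * 10 ^ 9`, together with the table error `3 * 4312 * 2 ^ 12`.
  have h6 : 300000000000 * N ≤ a / 2 ^ 322 + b / 2 ^ 322 := by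
    norm_num at h1 h5 ⊢
    linarith
  rw [← add_div, le_div_iff₀ (by positivity)] at h6
  linarith

end Reduced

/-! ### The net forces at the approximate minimizer. -/

section Force

open Finset

set_option exponentiation.threshold 5000

/-- The scaled derivative of the pair potential. -/
def pairForce (y : ℤ) : ℤ := y ^ 4 * (6 * 2 ^ 216 - 12 * y ^ 3)

/-- The inverse square of the bond length in units of `2 ^ (-72)`, rounded down. -/
def bondInvFine (s x y : Fin 3 → ℤ) : ℤ := 2 ^ 72 * 10 ^ 32 / bondSq s x y

/-- The scaled gradient of the energy of the bonds between an atom over the site `i` and the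
atoms over the site `i'`. -/
def siteForce (i i' : ℕ) (d : Fin 3) : ℤ :=
  ∑ k, pairForce (bondInvFine (bondSign (sitePar i * sitePar i') k) (siteInt i) (siteInt i')) *
    bond (bondSign (sitePar i * sitePar i') k) (siteInt i) (siteInt i') d

theorem bondInvFine_nonneg (s x y : Fin 3 → ℤ) : 0 ≤ bondInvFine s x y := by
  unfold bondInvFine bondSq
  positivity

theorem bondInvFine_le {s x y : Fin 3 → ℤ} (h : bondSq s x y = 0 ∨ 10 ^ 32 ≤ bondSq s x y) :
    bondInvFine s x y ≤ 2 ^ 72 := by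
  unfold bondInvFine
  rcases h with h | h
  · rw [h]; norm_num
  · exact Int.ediv_le_of_le_mul (by linarith [pow_pos (show (0 : ℤ) < 10 by norm_num) 32])
      (by nlinarith)

theorem abs_pairForce_le {y : ℤ} (h0 : 0 ≤ y) (h1 : y ≤ 2 ^ 72) : |pairForce y| ≤ 2 ^ 508 := by
  have h3 : y ^ 3 ≤ (2 ^ 72) ^ 3 := by gcongr
  have h3' : 0 ≤ y ^ 3 := by positivity
  have h5 : |6 * 2 ^ 216 - 12 * y ^ 3| ≤ 2 ^ 220 := by
    rw [abs_le]; constructor <;> linarith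
  rw [pairForce, abs_mul, abs_of_nonneg (a := y ^ 4) (by positivity)]
  calc y ^ 4 * |6 * 2 ^ 216 - 12 * y ^ 3| ≤ (2 ^ 72) ^ 4 * 2 ^ 220 := by gcongr
    _ = 2 ^ 508 := by norm_num

theorem abs_siteForce_le {i i' : ℕ} (h : Separated i i') (d : Fin 3) :
    |siteForce i i' d| ≤ 2 ^ 567 := by
  refine (abs_sum_le_sum_abs _ _).trans ?_
  calc _ ≤ ∑ _k : Fin 4, ((2 : ℤ) ^ 508 * 2 ^ 57) := sum_le_sum fun k _ => ?_
    _ = 2 ^ 567 := by rw [sum_const, card_univ, Fintype.card_fin]; norm_num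
  have hb : |bond (bondSign (sitePar i * sitePar i') k) (siteInt i) (siteInt i') d| ≤ 2 ^ 57 := by
    unfold bond
    refine (abs_sub _ _).trans ?_
    rw [abs_mul, abs_bondSign (sitePar_mul_eq i i'), one_mul]
    linarith [abs_siteInt_le i d, abs_siteInt_le i' d]
  rw [abs_mul]
  exact mul_le_mul (abs_pairForce_le (bondInvFine_nonneg _ _ _) (bondInvFine_le (h.eq_zero_or k)))
    hb (abs_nonneg _) (by positivity)

abbrev GradRing : Type := ℤ ⧸ Ideal.span {(gradModulus : ℤ)}

theorem emod_eq_emod_of_quotient_eq {m a b : ℤ} (h : (a : ℤ ⧸ Ideal.span {m}) = b) :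
    a % m = b % m := by
  rw [← eq_intCast (Ideal.Quotient.mk (Ideal.span {m})), ← eq_intCast (Ideal.Quotient.mk
    (Ideal.span {m})), Ideal.Quotient.eq, Ideal.mem_span_singleton] at h
  exact Int.emod_eq_emod_iff_emod_sub_eq_zero.mpr (Int.emod_eq_zero_of_dvd h)

theorem gradModulus_cast : ((gradModulus : ℕ) : GradRing) = 0 := by
  rw [← Int.cast_natCast, ← eq_intCast (Ideal.Quotient.mk (Ideal.span {(gradModulus : ℤ)}))]
  exact Ideal.Quotient.eq_zero_iff_mem.mpr (Ideal.mem_span_singleton_self _)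

theorem natCast_forceOfInverse {R : Type*} [CommRing R] (hR : ((gradModulus : ℕ) : R) = 0) {y : ℕ}
    (hy : y ≤ 2 ^ 72) : ((forceOfInverse y : ℕ) : R) = (pairForce y : ℤ) := by
  have h : Nat.mul 12 (Nat.mul (Nat.mul y y) y) ≤ gradModulus := by
    change 12 * (y * y * y) ≤ 2 ^ 640
    calc 12 * (y * y * y) ≤ 12 * (2 ^ 72 * 2 ^ 72 * 2 ^ 72) := by gcongr
      _ ≤ 2 ^ 640 := by norm_num
  rw [forceOfInverse, forceOfPowers, gradCoeff₁]
  simp only [natCast_natMul, natCast_natAdd, natCast_natPow, natCast_negMod hR h, pairForce]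
  push_cast
  ring

theorem gradDigit_eq {E : ℕ} {z : ℤ} (h : (E : GradRing) = z) (hz : |z| ≤ 2 ^ 629) :
    (gradDigit E : ℤ) = z + 2 ^ 630 := by
  have e1 : gradDigit E = (E + 2 ^ 630) % 2 ^ 640 := land_mask 640 _
  have e2 : (((E + 2 ^ 630 : ℕ) : ℤ) : GradRing) = ((z + 2 ^ 630 : ℤ) : GradRing) := by
    push_cast
    rw [h]
  have e3 := emod_eq_emod_of_quotient_eq e2
  rw [show gradModulus = 2 ^ 640 from rfl] at e3
  have hz' := abs_le.mp hz
  rw [e1, Int.natCast_mod, e3, Nat.cast_pow, Nat.cast_ofNat, Int.emod_eq_of_lt]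
  · linarith
  · linarith

/-- The packed force on an atom over the site `i`. -/
theorem forceBlock_eq (f g : Fin 3 → ℕ) (a : Fin 4 → ℕ) {z : Fin 3 → ℤ}
    (hz : ∀ d, |z d| ≤ 2 ^ 629)
    (h : ∀ d, (z d : GradRing) = ∑ k, (a k : GradRing) *
      bondTable (fun d => (f d : GradRing)) (fun d => (g d : GradRing)) k d) :
    ∃ D : ℕ → ℕ, (∀ d : Fin 3, (D d : ℤ) = z d + 2 ^ 630) ∧
      packForce (f 0) (f 1) (f 2) (g 0) (g 1) (g 2) (a 0) (a 1) (a 2) (a 3) =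
        ∑ l ∈ range 3, D l * (2 ^ 704) ^ l := by
  let E : Fin 3 → ℕ := ![mix (f 0) (g 0) (a 0) (a 1) (a 2) (a 3),
    mix (f 1) (g 1) (a 0) (a 2) (a 1) (a 3), mix (f 2) (g 2) (a 0) (a 3) (a 1) (a 2)]
  refine ⟨fun l => gradDigit (E (Fin.ofNat 3 l)), fun d => ?_, ?_⟩
  · have : (Fin.ofNat 3 (d : ℕ) : Fin 3) = d := Fin.ext (by simp [Fin.ofNat])
    simp only [this]
    refine gradDigit_eq ?_ (hz d)
    rw [h d]
    fin_cases d <;> simp [E, mix, bondTable, Fin.sum_univ_four, -Nat.add_eq, -Nat.mul_eq,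
      natCast_natAdd, natCast_natMul] <;> ring
  · have hp : ∀ B x y w : ℕ, Nat.add x (Nat.mul B (Nat.add y (Nat.mul B w))) =
        x * B ^ 0 + y * B ^ 1 + w * B ^ 2 := fun B x y w => by
      change x + B * (y + B * w) = _
      ring
    rw [packForce, hp]
    simp only [sum_range_succ, sum_range_zero, zero_add]
    rfl

theorem natCast_gradInverse (a b c : ℕ) :
    ((gradInverse a b c : ℕ) : ℤ) =
      2 ^ 72 * 10 ^ 32 / ((a : ℤ) + b + c) := by
  change (((2 ^ 72 * 10 ^ 32) / (a + b + c) : ℕ) : ℤ) = _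
  push_cast
  rfl

theorem forcePair_eq {i i' : ℕ} (hsep : Separated i i') :
    ∃ D : ℕ → ℕ, (∀ d : Fin 3, (D d : ℤ) = siteForce i i' d + 2 ^ 630) ∧
      onPair forceEven forceOdd (i / 6) (i % 6) (i' / 6) (i' % 6) =
        ∑ l ∈ range 3, D l * (2 ^ 704) ^ l := by
  have hz : ∀ d, |siteForce i i' d| ≤ 2 ^ 629 := fun d =>
    (abs_siteForce_le hsep d).trans (by norm_num)
  have hle : ∀ d, siteVec i' d ≤ gradModulus := fun d => (siteVec_le i' d).trans (by decide +kernel)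
  have hinv : ∀ k, bondInvFine (bondSign (sitePar i * sitePar i') k) (siteInt i) (siteInt i') ≤
      2 ^ 72 := fun k => bondInvFine_le (hsep.eq_zero_or k)
  set x := siteVec i with hx
  set y := siteVec i' with hy
  have hcast : ∀ (z : Fin 4 → ℕ), (∀ k, (z k : ℤ) =
      bondInvFine (bondSign (sitePar i * sitePar i') k) (siteInt i) (siteInt i')) →
      ∀ k, ((forceOfInverse (z k) : ℕ) : GradRing) =
        (pairForce (bondInvFine (bondSign (sitePar i * sitePar i') k)
          (siteInt i) (siteInt i')) : ℤ) := by
    intro z hzk k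
    rw [← hzk k]
    refine natCast_forceOfInverse gradModulus_cast ?_
    have := hinv k
    rw [← hzk k] at this
    exact_mod_cast this
  have hpar := sitePar_mul_sitePar i i'
  by_cases hs : sameParity (i / 6) (i % 6) (i' / 6) (i' % 6) = true
  · rw [if_pos hs] at hpar
    let z : Fin 4 → ℕ :=
      ![gradInverse (sqSub (x 0) (y 0)) (sqSub (x 1) (y 1)) (sqSub (x 2) (y 2)),
        gradInverse (sqSub (x 0) (y 0)) (sqAdd (x 1) (y 1)) (sqAdd (x 2) (y 2)),
        gradInverse (sqAdd (x 0) (y 0)) (sqSub (x 1) (y 1)) (sqAdd (x 2) (y 2)),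
        gradInverse (sqAdd (x 0) (y 0)) (sqAdd (x 1) (y 1)) (sqSub (x 2) (y 2))]
    have hzk : ∀ k, (z k : ℤ) =
        bondInvFine (bondSign (sitePar i * sitePar i') k) (siteInt i) (siteInt i') := by
      intro k
      rw [hpar]
      fin_cases k <;> simp [z, natCast_gradInverse, natCast_sqAdd, natCast_sqSub, bondInvFine,
        bondSq, bond, bondSign, siteInt, hx, hy]
    have hb : ∀ k d, bondTable (fun d => ((subMod gradModulus (x d) (y d) : ℕ) : GradRing))
        (fun d => ((Nat.add (x d) (y d) : ℕ) : GradRing)) k d =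
        (bond (bondSign 1 k) (siteInt i) (siteInt i') d : ℤ) := by
      intro k d
      simp only [natCast_subMod gradModulus_cast _ (hle _), natCast_natAdd]
      fin_cases k <;> fin_cases d <;> simp [bondTable, bond, bondSign, siteInt, hx, hy]
    obtain ⟨D, hD1, hD2⟩ := forceBlock_eq (fun d => subMod gradModulus (x d) (y d))
      (fun d => Nat.add (x d) (y d)) (fun k => forceOfInverse (z k)) hz (fun d => by
        simp only [siteForce, hb, hcast z hzk]
        push_cast
        rw [hpar])
    refine ⟨D, hD1, ?_⟩
    unfold onPair
    rw [hs, cond_true]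
    exact hD2
  · rw [if_neg hs] at hpar
    let z : Fin 4 → ℕ :=
      ![gradInverse (sqAdd (x 0) (y 0)) (sqAdd (x 1) (y 1)) (sqAdd (x 2) (y 2)),
        gradInverse (sqAdd (x 0) (y 0)) (sqSub (x 1) (y 1)) (sqSub (x 2) (y 2)),
        gradInverse (sqSub (x 0) (y 0)) (sqAdd (x 1) (y 1)) (sqSub (x 2) (y 2)),
        gradInverse (sqSub (x 0) (y 0)) (sqSub (x 1) (y 1)) (sqAdd (x 2) (y 2))]
    have hzk : ∀ k, (z k : ℤ) =
        bondInvFine (bondSign (sitePar i * sitePar i') k) (siteInt i) (siteInt i') := by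
      intro k
      rw [hpar]
      fin_cases k <;> simp [z, natCast_gradInverse, natCast_sqAdd, natCast_sqSub, bondInvFine,
        bondSq, bond, bondSign, siteInt, hx, hy]
    have hb : ∀ k d, bondTable (fun d => ((Nat.add (x d) (y d) : ℕ) : GradRing))
        (fun d => ((subMod gradModulus (x d) (y d) : ℕ) : GradRing)) k d =
        (bond (bondSign (-1) k) (siteInt i) (siteInt i') d : ℤ) := by
      intro k d
      simp only [natCast_subMod gradModulus_cast _ (hle _), natCast_natAdd]
      fin_cases k <;> fin_cases d <;> simp [bondTable, bond, bondSign, siteInt, hx, hy]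
    obtain ⟨D, hD1, hD2⟩ := forceBlock_eq (fun d => Nat.add (x d) (y d))
      (fun d => subMod gradModulus (x d) (y d)) (fun k => forceOfInverse (z k)) hz (fun d => by
        simp only [siteForce, hb, hcast z hzk]
        push_cast
        rw [hpar])
    refine ⟨D, hD1, ?_⟩
    unfold onPair
    rw [Bool.not_eq_true] at hs
    rw [hs, cond_false]
    exact hD2

theorem forceOnes_eq : forceOnes = ∑ l ∈ range 3, (2 ^ 704) ^ l := by
  have h : ∀ B : ℕ, threeOnes B = ∑ l ∈ range 3, B ^ l := fun B => by
    change 1 + B * (1 + B) = _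
    simp only [sum_range_succ, sum_range_zero]
    ring
  exact h (2 ^ 704)

/-- The digits carry the offset `2 ^ 630`, 216 times in the sum. The check subtracts `216 * 2 ^ 630
- 2 ^ 511` and asks for a remainder below `2 ^ 512`, which leaves a symmetric interval of radius `2
^ 511`. -/
theorem abs_sum_siteForce_le (hsep : ∀ i < 216, ∀ i' < 216, Separated i i')
    (hcheck : allSites forceCheck = true) {i : ℕ} (hi : i < 216) (d : Fin 3) :
    |∑ i' ∈ range 216, siteForce i i' d| ≤ 2 ^ 511 := by
  have h0 := of_allSites hcheck hi
  unfold forceCheck at h0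
  have hP : Nat.pow 2 2112 = (2 ^ 704) ^ 3 := pow_mul 2 704 3
  rw [siteSum_zero, hP] at h0
  obtain ⟨r, hr, hxy⟩ := of_digitsBelow (w := 704) (b := 512) (by norm_num)
    (by rw [forceOnes_eq]; exact Nat.mul_comm _ _) h0
  have hex : ∀ i' : ℕ, ∃ D : ℕ → ℕ, i' < 216 →
      (∀ d : Fin 3, (D d : ℤ) = siteForce i i' d + 2 ^ 630) ∧
      onPair forceEven forceOdd (i / 6) (i % 6) (i' / 6) (i' % 6) =
        ∑ l ∈ range 3, D l * (2 ^ 704) ^ l := by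
    intro i'
    by_cases hi' : i' < 216
    · obtain ⟨D, hD⟩ := forcePair_eq (hsep i hi i' hi')
      exact ⟨D, fun _ => hD⟩
    · exact ⟨fun _ => 0, fun h => absurd h hi'⟩
  choose D hD using hex
  have hDlt : ∀ i' < 216, ∀ l < 3, D i' l < 2 ^ 631 := by
    intro i' hi' l hl
    have h1 := (hD i' hi').1 ⟨l, hl⟩
    have h2 := (abs_le.mp (abs_siteForce_le (hsep i hi i' hi') ⟨l, hl⟩)).2
    simp only at h1
    have h3 : (D i' l : ℤ) < 2 ^ 631 := by rw [h1]; linarith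
    exact_mod_cast h3
  have hx : ∑ i' ∈ range 216, onPair forceEven forceOdd (i / 6) (i % 6) (i' / 6) (i' % 6) =
      ∑ l ∈ range 3, (∑ i' ∈ range 216, D i' l) * (2 ^ 704) ^ l := by
    simp only [sum_mul]
    rw [sum_comm]
    exact sum_congr rfl fun i' hi' => (hD i' (mem_range.mp hi')).2
  obtain ⟨c, hc⟩ : ∃ c, c = Nat.sub (Nat.mul 216 (Nat.pow 2 630)) (Nat.pow 2 511) := ⟨_, rfl⟩
  have hc' : c + 2 ^ 511 = 216 * 2 ^ 630 := by
    rw [hc]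
    exact Nat.sub_add_cancel (by decide +kernel)
  rw [← hc, hx, forceOnes_eq, Nat.mul_eq, mul_sum, ← sum_add_distrib] at hxy
  simp only [← add_mul] at hxy
  have hdig := digit_ext ?_ ?_ hxy d.2
  · have h1 : ∑ i' ∈ range 216, (D i' d : ℤ) = ∑ i' ∈ range 216, siteForce i i' d + 216 * 2 ^ 630 := by
      rw [sum_congr rfl fun i' hi' => (hD i' (mem_range.mp hi')).1 d, sum_add_distrib, sum_const,
        card_range, nsmul_eq_mul]
      rfl
    have h2 := congrArg (Nat.cast (R := ℤ)) hdig
    rw [Nat.cast_sum, h1, Nat.cast_add] at h2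
    have h3 := congrArg (Nat.cast (R := ℤ)) hc'
    push_cast at h3
    have h4 : (r d : ℤ) ≤ 2 ^ 512 := by exact_mod_cast (hr d d.2).le
    have h5 : (0 : ℤ) ≤ r d := Int.natCast_nonneg _
    rw [abs_le]
    constructor <;> linarith
  · intro l hl
    have : ∑ i' ∈ range 216, D i' l ≤ ∑ _i' ∈ range 216, 2 ^ 631 :=
      sum_le_sum fun i' hi' => (hDlt i' (mem_range.mp hi') l hl).le
    refine this.trans_lt ?_
    rw [sum_const, card_range]
    norm_num
  · intro l hl
    calc c + r l < 216 * 2 ^ 630 + 2 ^ 512 := by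
          have := hr l hl
          have : c ≤ 216 * 2 ^ 630 := by rw [← hc']; exact Nat.le_add_right _ _
          linarith
      _ < 2 ^ 704 := by norm_num

end Force

/-! ### The finite computations. -/

section KernelChecks

set_option maxRecDepth 1000000

/-- The trivial character contains no infinitesimal translation or rotation, so this block needs no
penalty. -/
theorem cholesky_invariant : cholesky invariantPair 36 0 0 [] = true := by decide +kernel

/-- One nontrivial character suffices, because cyclic permutation of the axes carries its block to
the other two. -/
theorem cholesky_axial : cholesky axialPair 36 0 0 [] = true := by decide +kernel

theorem selfCheck_all : allSites selfCheck = true := by decide +kernel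

theorem forceCheck_all : allSites forceCheck = true := by decide +kernel

/-- Unit separation keeps all rounded inverse squares at or below their scale, and it is the lower
bound on bond lengths that the curvature estimates need. -/
theorem separationCheck_all : allSites separationCheck = true := by decide +kernel

end KernelChecks

/-! ### Rigid motions in the components, and cyclic permutation of the axes. -/

section Symmetry

open Finset

set_option exponentiation.threshold 5000

theorem separated_all : ∀ i < 216, ∀ i' < 216, Separated i i' :=
  fun _ hi _ hi' => separated_of_check separationCheck_all hi hi'

/-- The weight of a bond in the component of the character `s ↦ s f`. -/
def axisWeight (f : Fin 3) (s : Fin 3 → ℤ) (e : Fin 3) : ℤ := -(s f * s e)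

/-- The reduced quadratic form with bond weights `w`. -/
noncomputable def reducedForm (w : (Fin 3 → ℤ) → Fin 3 → ℤ) (x : ℕ → Fin 3 → ℝ) : ℝ :=
  ∑ i ∈ range 216, ∑ i' ∈ range 216, ∑ d, ∑ e, (coupling w i i' d e : ℝ) * x i d * x i' e +
    ∑ i ∈ range 216, ∑ i' ∈ range 216, ∑ d, ∑ e,
      (coupling (fun _ _ => 1) i i' d e : ℝ) * x i d * x i e

theorem invariant_bound (x : ℕ → Fin 3 → ℝ) :
    300000000000 * 2 ^ 322 * ∑ i ∈ range 216, ∑ d, x i d ^ 2 ≤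
      reducedForm (fun s e => -s e) x :=
  reduced_form_bound pairSpec_invariant separated_all selfCheck_all
    (coupling_swap fun s hs d e => by linear_combination -s e * hs d) cholesky_invariant x

theorem axialPenalty_swap (ε : ℤ) (x y : Fin 3 → ℤ) (d e : Fin 3) :
    axialPenalty ε x y d e = axialPenalty ε y x e d := by
  unfold axialPenalty
  simp only [and_comm, mul_comm (rotField x d)]

/-- There is no translation along and no rotation about the axis `f`. -/
def NoAxialMotion (f : Fin 3) (x : ℕ → Fin 3 → ℝ) : Prop :=
  ∑ i ∈ range 216, x i f = 0 ∧
    ∑ i ∈ range 216, (sitePar i : ℝ) *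
      ((siteInt i (f + 1) : ℝ) * x i (f + 2) - (siteInt i (f + 2) : ℝ) * x i (f + 1)) = 0

/-- The penalty is a combination of the squares of two linear functionals, the mean translation
along and the mean rotation about the axis, and both vanish on `x`. -/
theorem sum_axialPenalty {x : ℕ → Fin 3 → ℝ} (hx : NoAxialMotion 2 x) :
    ∑ i ∈ range 216, ∑ i' ∈ range 216, ∑ d, ∑ e,
      (axialPenalty (sitePar i * sitePar i') (siteInt i) (siteInt i') d e : ℝ) *
        x i d * x i' e = 0 := by
  obtain ⟨h1, h2⟩ := hx
  set r : ℕ → ℝ := fun i => (sitePar i : ℝ) *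
    ((siteInt i (2 + 1) : ℝ) * x i (2 + 2) - (siteInt i (2 + 2) : ℝ) * x i (2 + 1)) with hr
  have h3 : ∀ i i', ∑ d, ∑ e,
      (axialPenalty (sitePar i * sitePar i') (siteInt i) (siteInt i') d e : ℝ) * x i d * x i' e =
      2 ^ 249 * (r i * r i') + 2 ^ 358 * (x i 2 * x i' 2) := by
    intro i i'
    have e1 : (2 : Fin 3) + 1 = 0 := rfl
    have e2 : (2 : Fin 3) + 2 = 1 := rfl
    simp only [hr, e1, e2, axialPenalty, rotField, Fin.sum_univ_three]
    simp
    ring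
  simp only [h3, sum_add_distrib, ← mul_sum, h1, h2, mul_zero, add_zero, sum_const_zero]

theorem axial_bound {x : ℕ → Fin 3 → ℝ} (hx : NoAxialMotion 2 x) :
    300000000000 * 2 ^ 322 * ∑ i ∈ range 216, ∑ d, x i d ^ 2 ≤
      reducedForm (axisWeight 2) x := by
  have h := reduced_form_bound pairSpec_axial separated_all selfCheck_all
    (fun i i' d e => by
      rw [axialPenalty_swap, mul_comm (sitePar i), coupling_swap
        (fun s hs d e => by linear_combination -(s 2 * s e) * hs d)]) cholesky_axial x
  refine h.trans (le_of_eq ?_)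
  unfold reducedForm
  congr 1
  have h4 : ∀ i i', ∑ d, ∑ e, ((axialPenalty (sitePar i * sitePar i') (siteInt i) (siteInt i') d e +
      coupling (fun s e => -(s 2 * s e)) i i' d e : ℤ) : ℝ) * x i d * x i' e =
      ∑ d, ∑ e, (axialPenalty (sitePar i * sitePar i') (siteInt i) (siteInt i') d e : ℝ) *
        x i d * x i' e +
      ∑ d, ∑ e, (coupling (axisWeight 2) i i' d e : ℝ) * x i d * x i' e := by
    intro i i'
    simp only [Int.cast_add, add_mul, sum_add_distrib]
    rfl
  simp only [h4, sum_add_distrib, sum_axialPenalty hx, zero_add]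

/-- The rotation `(a, b, c) ↦ (b, c, a)` of the sites. -/
def siteRot (i : ℕ) : ℕ := 36 * (i / 6 % 6) + (6 * (i % 6) + i / 36)

def siteRotInv (i : ℕ) : ℕ := 36 * (i % 6) + (6 * (i / 36) + i / 6 % 6)

theorem exists_layers {i : ℕ} (hi : i < 216) :
    ∃ a b c, a < 6 ∧ b < 6 ∧ c < 6 ∧ i = 36 * a + (6 * b + c) :=
  ⟨i / 36, i / 6 % 6, i % 6, by omega, by omega, by omega, by omega⟩

theorem layers_div {a b c : ℕ} (hb : b < 6) (hc : c < 6) :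
    (36 * a + (6 * b + c)) / 36 = a ∧ (36 * a + (6 * b + c)) / 6 = 6 * a + b ∧
      (36 * a + (6 * b + c)) % 6 = c ∧ (6 * a + b) / 6 = a ∧ (6 * a + b) % 6 = b := by
  omega

theorem siteRot_layers {a b c : ℕ} (hb : b < 6) (hc : c < 6) :
    siteRot (36 * a + (6 * b + c)) = 36 * b + (6 * c + a) := by
  obtain ⟨h1, h2, h3, h4, h5⟩ := layers_div (a := a) hb hc
  rw [siteRot, h1, h2, h3, h5]

theorem siteRotInv_layers {a b c : ℕ} (hb : b < 6) (hc : c < 6) :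
    siteRotInv (36 * a + (6 * b + c)) = 36 * c + (6 * a + b) := by
  obtain ⟨h1, h2, h3, h4, h5⟩ := layers_div (a := a) hb hc
  rw [siteRotInv, h1, h2, h3, h5]

/-- In all three directions the offset is the same function of the layer indices taken in cyclic
order, starting with the direction itself. -/
theorem siteInt_siteRot {i : ℕ} (hi : i < 216) (d : Fin 3) :
    siteInt (siteRot i) d = siteInt i (d + 1) := by
  have h1 : siteRot i / 6 / 6 = i / 6 % 6 ∧ siteRot i / 6 % 6 = i % 6 ∧
      siteRot i % 6 = i / 6 / 6 := by
    obtain ⟨a, b, c, ha, hb, hc, rfl⟩ := exists_layers hi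
    obtain ⟨h1, h2, h3, h4, h5⟩ := layers_div (a := a) hb hc
    rw [siteRot_layers hb hc, h2, h3, h4, h5]
    obtain ⟨h1, h2, h3, h4, h5⟩ := layers_div (a := b) hc ha
    rw [h2, h3, h4, h5]
    exact ⟨rfl, rfl, rfl⟩
  obtain ⟨h1, h2, h3⟩ := h1
  have hX : siteX (siteRot i / 6) (siteRot i % 6) = siteY (i / 6) (i % 6) := by
    change relaxedOffset (siteRot i / 6 / 6) (siteRot i / 6 % 6) (siteRot i % 6) =
      relaxedOffset (i / 6 % 6) (i % 6) (i / 6 / 6)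
    rw [h1, h2, h3]
  have hY : siteY (siteRot i / 6) (siteRot i % 6) = siteZ (i / 6) (i % 6) := by
    change relaxedOffset (siteRot i / 6 % 6) (siteRot i % 6) (siteRot i / 6 / 6) =
      relaxedOffset (i % 6) (i / 6 / 6) (i / 6 % 6)
    rw [h1, h2, h3]
  have hZ : siteZ (siteRot i / 6) (siteRot i % 6) = siteX (i / 6) (i % 6) := by
    change relaxedOffset (siteRot i % 6) (siteRot i / 6 / 6) (siteRot i / 6 % 6) =
      relaxedOffset (i / 6 / 6) (i / 6 % 6) (i % 6)
    rw [h1, h2, h3]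
  fin_cases d
  · exact congrArg Nat.cast hX
  · exact congrArg Nat.cast hY
  · exact congrArg Nat.cast hZ

theorem sitePar_siteRot {i : ℕ} (hi : i < 216) : sitePar (siteRot i) = sitePar i := by
  unfold sitePar
  rw [neg_one_pow_eq_pow_mod_two, neg_one_pow_eq_pow_mod_two (n := i / 6 / 6 + _)]
  congr 1
  obtain ⟨a, b, c, ha, hb, hc, rfl⟩ := exists_layers hi
  obtain ⟨h1, h2, h3, h4, h5⟩ := layers_div (a := a) hb hc
  rw [siteRot_layers hb hc, h2, h3, h4]
  obtain ⟨h1, h2, h3, h4, h5⟩ := layers_div (a := b) hc ha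
  rw [h2, h3, h4]
  omega

theorem siteRotInv_siteRot {i : ℕ} (hi : i < 216) : siteRotInv (siteRot i) = i := by
  obtain ⟨a, b, c, ha, hb, hc, rfl⟩ := exists_layers hi
  rw [siteRot_layers hb hc, siteRotInv_layers hc ha]

theorem siteRot_siteRotInv {i : ℕ} (hi : i < 216) : siteRot (siteRotInv i) = i := by
  obtain ⟨a, b, c, ha, hb, hc, rfl⟩ := exists_layers hi
  rw [siteRotInv_layers hb hc, siteRot_layers ha hb]

theorem sum_siteRot (g : ℕ → ℝ) :
    ∑ i ∈ range 216, g (siteRot i) = ∑ i ∈ range 216, g i := by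
  refine sum_nbij' siteRot siteRotInv ?_ ?_ (fun i hi => siteRotInv_siteRot (mem_range.mp hi))
    (fun i hi => siteRot_siteRotInv (mem_range.mp hi)) fun _ _ => rfl <;> intro i hi <;>
    obtain ⟨a, b, c, ha, hb, hc, rfl⟩ := exists_layers (mem_range.mp hi) <;> rw [mem_range]
  · rw [siteRot_layers hb hc]; omega
  · rw [siteRotInv_layers hb hc]; omega

/-- The rotation of the four sign patterns. -/
def signRot (k : Fin 4) : Fin 4 := ![0, 3, 1, 2] k

theorem bondSign_signRot (ε : ℤ) (k : Fin 4) (d : Fin 3) :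
    bondSign ε (signRot k) d = bondSign ε k (d + 1) := by
  fin_cases k <;> fin_cases d <;> rfl

theorem stiffness_rot (s x y s' x' y' : Fin 3 → ℤ) (hs : ∀ d, s' d = s (d + 1))
    (hx : ∀ d, x' d = x (d + 1)) (hy : ∀ d, y' d = y (d + 1)) (d e : Fin 3) :
    stiffness s' x' y' d e = stiffness s x y (d + 1) (e + 1) := by
  have hb : ∀ d, bond s' x' y' d = bond s x y (d + 1) := fun d => by
    rw [bond, bond, hs, hx, hy]
  have hq : bondSq s' x' y' = bondSq s x y := by
    unfold bondSq
    rw [hb, hb, hb]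
    change bond s x y 1 ^ 2 + bond s x y 2 ^ 2 + bond s x y 0 ^ 2 = _
    ring
  unfold stiffness bondInv
  rw [hq, hb, hb]
  simp only [add_left_inj]

theorem coupling_rot {w w' : (Fin 3 → ℤ) → Fin 3 → ℤ}
    (hw : ∀ s s' : Fin 3 → ℤ, (∀ d, s' d = s (d + 1)) → ∀ e, w' s' e = w s (e + 1))
    {i i' : ℕ} (hi : i < 216) (hi' : i' < 216) (d e : Fin 3) :
    coupling w' (siteRot i) (siteRot i') d e = coupling w i i' (d + 1) (e + 1) := by
  unfold coupling
  rw [sitePar_siteRot hi, sitePar_siteRot hi']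
  have hperm : Function.Bijective signRot := by decide
  rw [← (Equiv.ofBijective _ hperm).sum_comp]
  refine sum_congr rfl fun k _ => ?_
  have hs := bondSign_signRot (sitePar i * sitePar i') k
  rw [Equiv.ofBijective_apply, hw _ _ hs, stiffness_rot _ _ _ _ _ _ hs (siteInt_siteRot hi)
    (siteInt_siteRot hi')]

theorem sum_add_one (h : Fin 3 → ℝ) : ∑ d, h (d + 1) = ∑ d, h d :=
  Equiv.sum_comp (Equiv.addRight (1 : Fin 3)) h

theorem sum_coupling_rot {w w' : (Fin 3 → ℤ) → Fin 3 → ℤ}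
    (hw : ∀ s s' : Fin 3 → ℤ, (∀ d, s' d = s (d + 1)) → ∀ e, w' s' e = w s (e + 1))
    {i i' : ℕ} (hi : i < 216) (hi' : i' < 216) (y z y' z' : Fin 3 → ℝ)
    (hy : ∀ d, y' d = y (d + 1)) (hz : ∀ d, z' d = z (d + 1)) :
    ∑ d, ∑ e, (coupling w' (siteRot i) (siteRot i') d e : ℝ) * y' d * z' e =
      ∑ d, ∑ e, (coupling w i i' d e : ℝ) * y d * z e := by
  simp only [coupling_rot hw hi hi', hy, hz]
  rw [sum_add_one fun d => ∑ e, (coupling w i i' d (e + 1) : ℝ) * y d * z (e + 1)]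
  exact sum_congr rfl fun d _ => sum_add_one fun e => (coupling w i i' d e : ℝ) * y d * z e

/-- Rotating sites, coordinates and sign patterns together permutes the terms of the form and only
changes the bond weight. -/
theorem reducedForm_rot {w w' : (Fin 3 → ℤ) → Fin 3 → ℤ}
    (hw : ∀ s s' : Fin 3 → ℤ, (∀ d, s' d = s (d + 1)) → ∀ e, w' s' e = w s (e + 1))
    (x : ℕ → Fin 3 → ℝ) :
    reducedForm w' (fun i d => x (siteRotInv i) (d + 1)) = reducedForm w x := by
  unfold reducedForm
  congr 1
  · rw [← sum_siteRot]
    refine sum_congr rfl fun i hi => ?_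
    rw [← sum_siteRot]
    refine sum_congr rfl fun i' hi' => ?_
    have hi := mem_range.mp hi
    have hi' := mem_range.mp hi'
    exact sum_coupling_rot hw hi hi' _ _ _ _ (fun d => by simp only [siteRotInv_siteRot hi])
      (fun d => by simp only [siteRotInv_siteRot hi'])
  · rw [← sum_siteRot]
    refine sum_congr rfl fun i hi => ?_
    rw [← sum_siteRot]
    refine sum_congr rfl fun i' hi' => ?_
    have hi := mem_range.mp hi
    have hi' := mem_range.mp hi'
    exact sum_coupling_rot (fun _ _ _ _ => rfl) hi hi' _ _ _ _
      (fun d => by simp only [siteRotInv_siteRot hi]) (fun d => by simp only [siteRotInv_siteRot hi])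

theorem NoAxialMotion.rot {f : Fin 3} {x : ℕ → Fin 3 → ℝ} (h : NoAxialMotion (f + 1) x) :
    NoAxialMotion f (fun i d => x (siteRotInv i) (d + 1)) := by
  obtain ⟨h1, h2⟩ := h
  constructor
  · rw [← sum_siteRot, ← h1]
    exact sum_congr rfl fun i hi => by simp only [siteRotInv_siteRot (mem_range.mp hi)]
  · rw [← sum_siteRot, ← h2]
    refine sum_congr rfl fun i hi => ?_
    have hi := mem_range.mp hi
    simp only [siteRotInv_siteRot hi, sitePar_siteRot hi, siteInt_siteRot hi,
      add_right_comm f 2 1]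

theorem axis_bound (f : Fin 3) {x : ℕ → Fin 3 → ℝ} (hx : NoAxialMotion f x) :
    300000000000 * 2 ^ 322 * ∑ i ∈ range 216, ∑ d, x i d ^ 2 ≤
      reducedForm (axisWeight f) x := by
  -- The bound passes from the axis `f` to `f + 1`; starting from the certified axis 2 it reaches 0
  -- and then 1.
  have step : ∀ f : Fin 3, (∀ x : ℕ → Fin 3 → ℝ, NoAxialMotion f x →
      300000000000 * 2 ^ 322 * ∑ i ∈ range 216, ∑ d, x i d ^ 2 ≤ reducedForm (axisWeight f) x) →
      ∀ x : ℕ → Fin 3 → ℝ, NoAxialMotion (f + 1) x →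
      300000000000 * 2 ^ 322 * ∑ i ∈ range 216, ∑ d, x i d ^ 2 ≤
        reducedForm (axisWeight (f + 1)) x := by
    intro f h x hx
    have h1 := h _ hx.rot
    rw [reducedForm_rot (w := axisWeight (f + 1)) (fun s s' hs e => by
      rw [axisWeight, axisWeight, hs, hs]), ← sum_siteRot] at h1
    refine le_trans (le_of_eq ?_) h1
    congr 1
    refine sum_congr rfl fun i hi => ?_
    simp only [siteRotInv_siteRot (mem_range.mp hi)]
    exact (sum_add_one fun d => x i d ^ 2).symm
  have h2 : ∀ x : ℕ → Fin 3 → ℝ, NoAxialMotion 2 x → _ := fun x hx => axial_bound hx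
  have h0 := step 2 h2
  have h1 := step (2 + 1) h0
  fin_cases f
  exacts [h0 x hx, h1 x hx, h2 x hx]

end Symmetry

/-! ### Splitting the quadratic form by characters of the Klein four-group. -/

section Characters

open Finset

set_option exponentiation.threshold 5000

/-- The four characters of the group of sign patterns with product one, extended to all signs. -/
def signChar (c : Fin 4) (s : Fin 3 → ℤ) : ℤ := ![1, s 0, s 1, s 2] c

/-- The product of sign patterns. -/
def signMul (g h : Fin 4) : Fin 4 := ![![0, 1, 2, 3], ![1, 0, 3, 2], ![2, 3, 0, 1], ![3, 2, 1, 0]] g h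

theorem bondSign_signMul (ε ε' : ℤ) (g h : Fin 4) (d : Fin 3) :
    bondSign (ε * ε') (signMul g h) d = bondSign ε g d * bondSign ε' h d := by
  fin_cases g <;> fin_cases h <;> fin_cases d <;> simp [bondSign, signMul]

theorem signChar_signMul (ε ε' : ℤ) (c g h : Fin 4) :
    signChar c (bondSign (ε * ε') (signMul g h)) =
      signChar c (bondSign ε g) * signChar c (bondSign ε' h) := by
  unfold signChar
  fin_cases c
  · rfl
  all_goals exact bondSign_signMul _ _ _ _ _

/-- Left multiplication by `g` permutes the Klein four-group. -/
theorem sum_signMul (g : Fin 4) (F : Fin 4 → ℝ) : ∑ k, F (signMul g k) = ∑ k, F k := by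
  fin_cases g <;> simp only [signMul, Fin.sum_univ_four] <;> simp <;> ring

theorem signChar_mul_self {ε : ℤ} (hε : ε = 1 ∨ ε = -1) (c k : Fin 4) :
    signChar c (bondSign ε k) * signChar c (bondSign ε k) = 1 := by
  unfold signChar
  fin_cases c
  · rfl
  all_goals exact bondSign_mul_self hε _ _

/-- Orthogonality of the four characters. -/
theorem sum_signChar_mul {ε : ℤ} (hε : ε = 1 ∨ ε = -1) (a b : Fin 4 → ℝ) :
    ∑ g, (∑ c, (signChar c (bondSign ε g) : ℝ) * a c) *
      (∑ c, (signChar c (bondSign ε g) : ℝ) * b c) = 4 * ∑ c, a c * b c := by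
  simp only [Fin.sum_univ_four, signChar, bondSign]
  rcases hε with rfl | rfl <;> simp <;> ring

/-- The component of a function on sign patterns for the character `c`. -/
noncomputable def signComp (ε : ℤ) (u : Fin 4 → ℝ) (c : Fin 4) : ℝ :=
  1 / 4 * ∑ g, (signChar c (bondSign ε g) : ℝ) * u g

theorem sum_signComp {ε : ℤ} (hε : ε = 1 ∨ ε = -1) (u : Fin 4 → ℝ) (g : Fin 4) :
    ∑ c, (signChar c (bondSign ε g) : ℝ) * signComp ε u c = u g := by
  simp only [signComp, Fin.sum_univ_four, signChar, bondSign]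
  rcases hε with rfl | rfl <;> fin_cases g <;> simp <;> ring

theorem sum_sq_signComp {ε : ℤ} (hε : ε = 1 ∨ ε = -1) (u : Fin 4 → ℝ) :
    ∑ g, u g ^ 2 = 4 * ∑ c, signComp ε u c ^ 2 := by
  have h := sum_signChar_mul hε (signComp ε u) (signComp ε u)
  simp only [sum_signComp hε] at h
  simpa only [sq] using h

/-- For a fixed relative pattern `k`, moving from `g` to `signMul g k` multiplies the component of
the character `c` by its value at `k`. By orthogonality the sum over `g` then decouples the
characters. -/
theorem sum_bond_signComp {ε ε' : ℤ} (hε : ε = 1 ∨ ε = -1) (hε' : ε' = 1 ∨ ε' = -1) (k : Fin 4)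
    (u u' v v' : Fin 4 → ℝ) (s t : ℝ) :
    ∑ g, (u g - s * u' (signMul g k)) * (v g - t * v' (signMul g k)) =
      4 * ∑ c, (signComp ε u c - signChar c (bondSign (ε * ε') k) * s * signComp ε' u' c) *
        (signComp ε v c - signChar c (bondSign (ε * ε') k) * t * signComp ε' v' c) := by
  have hεε : ε * (ε * ε') = ε' := by rcases hε with rfl | rfl <;> simp
  have key : ∀ (u u' : Fin 4 → ℝ) (s : ℝ) (g : Fin 4), u g - s * u' (signMul g k) =
      ∑ c, (signChar c (bondSign ε g) : ℝ) *
        (signComp ε u c - signChar c (bondSign (ε * ε') k) * s * signComp ε' u' c) := by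
    intro u u' s g
    rw [← sum_signComp hε u g, ← sum_signComp hε' u' (signMul g k), mul_sum, ← sum_sub_distrib]
    refine sum_congr rfl fun c _ => ?_
    have h := signChar_signMul ε (ε * ε') c g k
    rw [hεε] at h
    rw [h]
    push_cast
    ring
  simp only [key u u' s, key v v' t]
  exact sum_signChar_mul hε _ _

/-- The weight of a bond in the component of the character `c`. -/
def charWeight (c : Fin 4) (s : Fin 3 → ℤ) (e : Fin 3) : ℤ := -(signChar c s * s e)

theorem sum_form_sub {M : Fin 3 → Fin 3 → ℝ} (hM : ∀ d e, M d e = M e d) (a b t : Fin 3 → ℝ) :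
    ∑ d, ∑ e, M d e * ((a d - t d * b d) * (a e - t e * b e)) =
      ∑ d, ∑ e, M d e * a d * a e + ∑ d, ∑ e, t d * t e * M d e * b d * b e +
        2 * ∑ d, ∑ e, -t e * M d e * a d * b e := by
  simp only [Fin.sum_univ_three, hM 1 0, hM 2 0, hM 2 1]
  ring

theorem sum_move_inside {α : Type*} (t : Finset α) (F : α → Fin 3 → Fin 3 → ℝ) :
    ∑ k ∈ t, ∑ d, ∑ e, F k d e = ∑ d, ∑ e, ∑ k ∈ t, F k d e := by
  rw [sum_comm]
  exact sum_congr rfl fun d _ => sum_comm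

theorem sum_coupling (w : (Fin 3 → ℤ) → Fin 3 → ℤ) (i i' : ℕ) (a b : Fin 3 → ℝ) :
    ∑ d, ∑ e, (coupling w i i' d e : ℝ) * a d * b e =
      ∑ k, ∑ d, ∑ e, (w (bondSign (sitePar i * sitePar i') k) e : ℝ) *
        (stiffness (bondSign (sitePar i * sitePar i') k) (siteInt i) (siteInt i') d e : ℝ) *
          a d * b e := by
  rw [sum_move_inside]
  refine sum_congr rfl fun d _ => sum_congr rfl fun e _ => ?_
  rw [coupling, Int.cast_sum, sum_mul, sum_mul]
  simp only [Int.cast_mul]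

/-- The square of a difference expands into two on-site terms and a cross term. The signs square
away in the on-site terms, so these do not depend on the character and one table serves all
components. -/
theorem sum_bond_form (c : Fin 4) (i i' : ℕ) (a b : Fin 3 → ℝ) :
    ∑ k, ∑ d, ∑ e,
      (stiffness (bondSign (sitePar i * sitePar i') k) (siteInt i) (siteInt i') d e : ℝ) *
      ((a d - signChar c (bondSign (sitePar i * sitePar i') k) *
          bondSign (sitePar i * sitePar i') k d * b d) *
        (a e - signChar c (bondSign (sitePar i * sitePar i') k) *
          bondSign (sitePar i * sitePar i') k e * b e)) =
      ∑ d, ∑ e, (coupling (fun _ _ => 1) i i' d e : ℝ) * a d * a e +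
      ∑ d, ∑ e, (coupling (fun _ _ => 1) i' i d e : ℝ) * b d * b e +
      2 * ∑ d, ∑ e, (coupling (charWeight c) i i' d e : ℝ) * a d * b e := by
  rw [sum_coupling, sum_coupling, sum_coupling, mul_sum, ← sum_add_distrib, ← sum_add_distrib]
  refine sum_congr rfl fun k _ => ?_
  have hε := sitePar_mul_eq i i'
  have hs := bondSign_mul_self hε k
  rw [sum_form_sub (M := fun d e => (stiffness (bondSign (sitePar i * sitePar i') k) (siteInt i)
    (siteInt i') d e : ℝ)) (fun d e => by rw [stiffness_comm]) a b
    (fun d => signChar c (bondSign (sitePar i * sitePar i') k) *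
      bondSign (sitePar i * sitePar i') k d)]
  have h1 : ∀ d e, (signChar c (bondSign (sitePar i * sitePar i') k) *
      bondSign (sitePar i * sitePar i') k d : ℝ) * (signChar c (bondSign (sitePar i * sitePar i') k) *
      bondSign (sitePar i * sitePar i') k e) *
      stiffness (bondSign (sitePar i * sitePar i') k) (siteInt i) (siteInt i') d e =
      ((1 : ℤ) : ℝ) * stiffness (bondSign (sitePar i' * sitePar i) k) (siteInt i') (siteInt i) d e := by
    intro d e
    rw [mul_comm (sitePar i') (sitePar i), stiffness_swap hs (siteInt i)]
    have h2 : (signChar c (bondSign (sitePar i * sitePar i') k) : ℝ) *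
        signChar c (bondSign (sitePar i * sitePar i') k) = 1 := by
      exact_mod_cast signChar_mul_self hε c k
    push_cast
    linear_combination (bondSign (sitePar i * sitePar i') k d : ℝ) *
      bondSign (sitePar i * sitePar i') k e *
      stiffness (bondSign (sitePar i * sitePar i') k) (siteInt i) (siteInt i') d e * h2
  simp only [h1, charWeight, Int.cast_one, one_mul]
  push_cast
  rfl

theorem sum_sum_bond_form (c : Fin 4) (x : ℕ → Fin 3 → ℝ) :
    ∑ i ∈ range 216, ∑ i' ∈ range 216, ∑ k, ∑ d, ∑ e,
      (stiffness (bondSign (sitePar i * sitePar i') k) (siteInt i) (siteInt i') d e : ℝ) *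
      ((x i d - signChar c (bondSign (sitePar i * sitePar i') k) *
          bondSign (sitePar i * sitePar i') k d * x i' d) *
        (x i e - signChar c (bondSign (sitePar i * sitePar i') k) *
          bondSign (sitePar i * sitePar i') k e * x i' e)) = 2 * reducedForm (charWeight c) x := by
  simp only [sum_bond_form, sum_add_distrib, ← mul_sum, reducedForm]
  rw [sum_comm (f := fun i i' => ∑ d, ∑ e,
    (coupling (fun _ _ => 1) i' i d e : ℝ) * x i' d * x i' e)]
  ring

/-- The integer coordinates of the atom with the sign pattern `g` over the site `i`. -/
def latticeAtom (i : ℕ) (g : Fin 4) (d : Fin 3) : ℤ := bondSign (sitePar i) g d * siteInt i d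

theorem sitePar_eq (i : ℕ) : sitePar i = 1 ∨ sitePar i = -1 := by
  unfold sitePar
  exact neg_one_pow_eq_or ℤ _

theorem stiffness_signed {τ : Fin 3 → ℤ} (hτ : ∀ d, τ d * τ d = 1) (τ' s x y : Fin 3 → ℤ)
    (hs : ∀ d, s d = τ d * τ' d) (d e : Fin 3) :
    stiffness (fun _ => 1) (fun d => τ d * x d) (fun d => τ' d * y d) d e =
      τ d * τ e * stiffness s x y d e := by
  have hb : ∀ d, bond (fun _ => 1) (fun d => τ d * x d) (fun d => τ' d * y d) d =
      τ d * bond s x y d := by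
    intro d
    unfold bond
    rw [hs]
    linear_combination τ' d * y d * hτ d
  have hq : bondSq (fun _ => 1) (fun d => τ d * x d) (fun d => τ' d * y d) = bondSq s x y := by
    unfold bondSq
    rw [hb, hb, hb]
    linear_combination bond s x y 0 ^ 2 * hτ 0 + bond s x y 1 ^ 2 * hτ 1 + bond s x y 2 ^ 2 * hτ 2
  unfold stiffness bondInv
  rw [hq, hb, hb]
  split
  · subst e
    linear_combination (-isoStiff (2 ^ 32 * 10 ^ 32 / bondSq s x y)) * hτ d
  · ring

/-- The quadratic form of a bond between two atoms. -/
noncomputable def bondForm (P P' : Fin 3 → ℤ) (z : Fin 3 → ℝ) : ℝ :=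
  ∑ d, ∑ e, (stiffness (fun _ => 1) P P' d e : ℝ) * (z d * z e)

theorem bondForm_latticeAtom (V : ℕ → Fin 4 → Fin 3 → ℝ) (i i' : ℕ) (g k : Fin 4) :
    bondForm (latticeAtom i g) (latticeAtom i' (signMul g k))
        (fun d => V i g d - V i' (signMul g k) d) =
      ∑ d, ∑ e,
        (stiffness (bondSign (sitePar i * sitePar i') k) (siteInt i) (siteInt i') d e : ℝ) *
        ((bondSign (sitePar i) g d * V i g d - bondSign (sitePar i * sitePar i') k d *
            (bondSign (sitePar i') (signMul g k) d * V i' (signMul g k) d)) *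
          (bondSign (sitePar i) g e * V i g e - bondSign (sitePar i * sitePar i') k e *
            (bondSign (sitePar i') (signMul g k) e * V i' (signMul g k) e))) := by
  have hτ := bondSign_mul_self (sitePar_eq i) g
  have hτ' := bondSign_mul_self (sitePar_eq i') (signMul g k)
  have hs : ∀ d, bondSign (sitePar i * sitePar i') k d =
      bondSign (sitePar i) g d * bondSign (sitePar i') (signMul g k) d := by
    intro d
    have h := bondSign_signMul (sitePar i) (sitePar i * sitePar i') g k d
    rw [← mul_assoc, sitePar_mul_self, one_mul] at h
    rw [h]
    linear_combination -bondSign (sitePar i * sitePar i') k d * hτ d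
  unfold bondForm latticeAtom
  refine sum_congr rfl fun d _ => sum_congr rfl fun e _ => ?_
  rw [stiffness_signed hτ _ _ _ _ hs]
  have hz : ∀ d, (bondSign (sitePar i) g d * V i g d - bondSign (sitePar i * sitePar i') k d *
      (bondSign (sitePar i') (signMul g k) d * V i' (signMul g k) d) : ℝ) =
      bondSign (sitePar i) g d * (V i g d - V i' (signMul g k) d) := by
    intro d
    have h2 : (bondSign (sitePar i') (signMul g k) d : ℝ) *
      bondSign (sitePar i') (signMul g k) d = 1 := by exact_mod_cast hτ' d
    rw [hs]
    push_cast
    linear_combination -(bondSign (sitePar i) g d : ℝ) * V i' (signMul g k) d * h2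
  rw [hz, hz]
  push_cast
  ring

/-- The symmetry component of a displacement field. -/
noncomputable def fieldComp (V : ℕ → Fin 4 → Fin 3 → ℝ) (c : Fin 4) (i : ℕ) (d : Fin 3) : ℝ :=
  signComp (sitePar i) (fun g => bondSign (sitePar i) g d * V i g d) c

/-- The factor 8 is 4 from orthogonality of characters times 2 because the sum over ordered pairs of
sites produces each on-site term from both ends. -/
theorem sum_bondForm_eq (V : ℕ → Fin 4 → Fin 3 → ℝ) :
    ∑ i ∈ range 216, ∑ i' ∈ range 216, ∑ g, ∑ g',
      bondForm (latticeAtom i g) (latticeAtom i' g') (fun d => V i g d - V i' g' d) =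
      8 * ∑ c, reducedForm (charWeight c) (fieldComp V c) := by
  have h1 : ∀ i i', ∑ g, ∑ g',
      bondForm (latticeAtom i g) (latticeAtom i' g') (fun d => V i g d - V i' g' d) =
      4 * ∑ c, ∑ k, ∑ d, ∑ e,
      (stiffness (bondSign (sitePar i * sitePar i') k) (siteInt i) (siteInt i') d e : ℝ) *
      ((fieldComp V c i d - signChar c (bondSign (sitePar i * sitePar i') k) *
          bondSign (sitePar i * sitePar i') k d * fieldComp V c i' d) *
        (fieldComp V c i e - signChar c (bondSign (sitePar i * sitePar i') k) *
          bondSign (sitePar i * sitePar i') k e * fieldComp V c i' e)) := by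
    intro i i'
    have h2 : ∀ g, ∑ g', bondForm (latticeAtom i g) (latticeAtom i' g')
        (fun d => V i g d - V i' g' d) = ∑ k, bondForm (latticeAtom i g)
          (latticeAtom i' (signMul g k)) (fun d => V i g d - V i' (signMul g k) d) := fun g =>
      (sum_signMul g fun g' => bondForm (latticeAtom i g) (latticeAtom i' g')
        (fun d => V i g d - V i' g' d)).symm
    simp only [h2, bondForm_latticeAtom]
    rw [sum_comm, sum_comm (f := fun c k => ∑ d, ∑ e, (stiffness (bondSign (sitePar i * sitePar i') k)
      (siteInt i) (siteInt i') d e : ℝ) * ((fieldComp V c i d - signChar c (bondSign (sitePar i *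
        sitePar i') k) * bondSign (sitePar i * sitePar i') k d * fieldComp V c i' d) *
        (fieldComp V c i e - signChar c (bondSign (sitePar i * sitePar i') k) *
          bondSign (sitePar i * sitePar i') k e * fieldComp V c i' e))), mul_sum]
    refine sum_congr rfl fun k _ => ?_
    rw [sum_move_inside, sum_move_inside, mul_sum]
    refine sum_congr rfl fun d _ => ?_
    rw [mul_sum]
    refine sum_congr rfl fun e _ => ?_
    rw [← mul_sum, ← mul_sum, mul_left_comm]
    congr 1
    exact sum_bond_signComp (sitePar_eq i) (sitePar_eq i') k
      (fun g => bondSign (sitePar i) g d * V i g d) (fun g => bondSign (sitePar i') g d * V i' g d)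
      (fun g => bondSign (sitePar i) g e * V i g e) (fun g => bondSign (sitePar i') g e * V i' g e)
      _ _
  simp only [h1, ← mul_sum]
  have h3 : ∀ F : ℕ → ℕ → Fin 4 → ℝ, ∑ i ∈ range 216, ∑ i' ∈ range 216, ∑ c, F i i' c =
      ∑ c, ∑ i ∈ range 216, ∑ i' ∈ range 216, F i i' c := by
    intro F
    rw [sum_comm (s := univ)]
    refine sum_congr rfl fun i _ => ?_
    rw [sum_comm (s := univ)]
  rw [h3]
  simp only [sum_sum_bond_form, ← mul_sum]
  ring

/-- The three signs of a pattern have product `ε`, so two of them determine the third. This is why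
rotation about the axis `f` belongs to the same character as translation along it. -/
theorem bondSign_mul_bondSign {ε : ℤ} (hε : ε = 1 ∨ ε = -1) (g : Fin 4) (f : Fin 3) :
    ε * bondSign ε g f * bondSign ε g (f + 2) = bondSign ε g (f + 1) ∧
      ε * bondSign ε g f * bondSign ε g (f + 1) = bondSign ε g (f + 2) := by
  rcases hε with rfl | rfl <;> fin_cases g <;> fin_cases f <;> decide

/-- A displacement field without infinitesimal translation and rotation of the whole lattice. -/
theorem noAxialMotion_fieldComp {V : ℕ → Fin 4 → Fin 3 → ℝ}
    (h1 : ∀ d, ∑ i ∈ range 216, ∑ g, V i g d = 0)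
    (h2 : ∀ d, ∑ i ∈ range 216, ∑ g, ((latticeAtom i g (d + 1) : ℝ) * V i g (d + 2) -
      latticeAtom i g (d + 2) * V i g (d + 1)) = 0) (f : Fin 3) :
    NoAxialMotion f (fieldComp V f.succ) := by
  have hc : ∀ s : Fin 3 → ℤ, signChar f.succ s = s f := by
    intro s; fin_cases f <;> rfl
  constructor
  · have h3 : ∀ i, fieldComp V f.succ i f = 1 / 4 * ∑ g, V i g f := by
      intro i
      unfold fieldComp signComp
      congr 1
      refine sum_congr rfl fun g _ => ?_
      have : (bondSign (sitePar i) g f : ℝ) * bondSign (sitePar i) g f = 1 := by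
        exact_mod_cast bondSign_mul_self (sitePar_eq i) g f
      rw [hc]
      linear_combination V i g f * this
    simp only [h3, ← mul_sum, h1, mul_zero]
  · have h3 : ∀ i, (sitePar i : ℝ) * ((siteInt i (f + 1) : ℝ) * fieldComp V f.succ i (f + 2) -
        (siteInt i (f + 2) : ℝ) * fieldComp V f.succ i (f + 1)) =
        1 / 4 * ∑ g, ((latticeAtom i g (f + 1) : ℝ) * V i g (f + 2) -
          latticeAtom i g (f + 2) * V i g (f + 1)) := by
      intro i
      unfold fieldComp signComp latticeAtom
      simp only [hc, mul_sum, ← sum_sub_distrib]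
      refine sum_congr rfl fun g _ => ?_
      have e1 : (sitePar i : ℝ) * bondSign (sitePar i) g f * bondSign (sitePar i) g (f + 2) =
          bondSign (sitePar i) g (f + 1) := by
        exact_mod_cast (bondSign_mul_bondSign (sitePar_eq i) g f).1
      have e2 : (sitePar i : ℝ) * bondSign (sitePar i) g f * bondSign (sitePar i) g (f + 1) =
          bondSign (sitePar i) g (f + 2) := by
        exact_mod_cast (bondSign_mul_bondSign (sitePar_eq i) g f).2
      push_cast
      linear_combination (siteInt i (f + 1) : ℝ) * V i g (f + 2) / 4 * e1 -
        (siteInt i (f + 2) : ℝ) * V i g (f + 1) / 4 * e2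
    simp only [h3, ← mul_sum, h2, mul_zero]

theorem sum_sq_fieldComp (V : ℕ → Fin 4 → Fin 3 → ℝ) :
    ∑ i ∈ range 216, ∑ g, ∑ d, V i g d ^ 2 =
      4 * ∑ c, ∑ i ∈ range 216, ∑ d, fieldComp V c i d ^ 2 := by
  have h : ∀ i, ∑ g, ∑ d, V i g d ^ 2 = 4 * ∑ c, ∑ d, fieldComp V c i d ^ 2 := by
    intro i
    rw [sum_comm, sum_comm (s := univ (α := Fin 4)), mul_sum]
    refine sum_congr rfl fun d _ => ?_
    refine Eq.trans (sum_congr rfl fun g _ => ?_) (sum_sq_signComp (sitePar_eq i)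
      fun g => bondSign (sitePar i) g d * V i g d)
    have : (bondSign (sitePar i) g d : ℝ) * bondSign (sitePar i) g d = 1 := by
      exact_mod_cast bondSign_mul_self (sitePar_eq i) g d
    linear_combination -V i g d ^ 2 * this
  simp only [h, ← mul_sum]
  rw [sum_comm]

/-- The quadratic form of the lattice is positive definite up to rigid motions. -/
theorem lattice_form_bound {V : ℕ → Fin 4 → Fin 3 → ℝ}
    (h1 : ∀ d, ∑ i ∈ range 216, ∑ g, V i g d = 0)
    (h2 : ∀ d, ∑ i ∈ range 216, ∑ g, ((latticeAtom i g (d + 1) : ℝ) * V i g (d + 2) -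
      latticeAtom i g (d + 2) * V i g (d + 1)) = 0) :
    300000000000 * 2 ^ 322 * ∑ i ∈ range 216, ∑ g, ∑ d, V i g d ^ 2 ≤
      1 / 2 * ∑ i ∈ range 216, ∑ i' ∈ range 216, ∑ g, ∑ g',
        bondForm (latticeAtom i g) (latticeAtom i' g') (fun d => V i g d - V i' g' d) := by
  rw [sum_bondForm_eq, sum_sq_fieldComp]
  have hc : ∀ c, 300000000000 * 2 ^ 322 * ∑ i ∈ range 216, ∑ d, fieldComp V c i d ^ 2 ≤
      reducedForm (charWeight c) (fieldComp V c) := by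
    intro c
    refine Fin.cases ?_ (fun f => ?_) c
    · have := invariant_bound (fieldComp V 0)
      have hw : charWeight 0 = fun s e => -s e := by
        funext s e
        simp [charWeight, signChar]
      rwa [hw]
    · have hw : charWeight f.succ = axisWeight f := by
        funext s e
        fin_cases f <;> rfl
      rw [hw]
      exact axis_bound f (noAxialMotion_fieldComp h1 h2 f)
  have := sum_le_sum fun c (_ : c ∈ (univ : Finset (Fin 4))) => hc c
  rw [← mul_sum] at this
  linarith

end Characters

/-! ### From sites and sign patterns to the 864 atoms. -/

section Atoms

open Finset

set_option exponentiation.threshold 5000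

/-- The coordinates of an atom of the relaxed block in units of `10 ^ (-16)`. -/
def atomInt (n : Fin 864) (d : Fin 3) : ℤ :=
  layerSide (fccSite n d) * (relaxedOffset (layerIndex (fccSite n d))
    (layerIndex (fccSite n (d + 1))) (layerIndex (fccSite n (d + 2))) : ℤ)

theorem fccApprox_eq (n : Fin 864) (d : Fin 3) : fccApprox n d = (atomInt n d : ℝ) / 10 ^ 16 := by
  simp [fccApprox, atomInt]

def layerOf (τ : ℤ) (a : ℕ) : ℕ := if τ = 1 then 6 + a else 5 - a

/-- The index of the atom with the sign pattern `g` over the site `i`. -/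
def atomOf (i : Fin 216) (g : Fin 4) : Fin 864 :=
  Fin.ofNat 864 (72 * layerOf (bondSign (sitePar i) g 0) (i / 36) +
    6 * layerOf (bondSign (sitePar i) g 1) (i / 6 % 6) +
    layerOf (bondSign (sitePar i) g 2) (i % 6) / 2)

/-- That the index chosen in `atomOf` is right, including the halved last coordinate, is a finite
check. -/
theorem layer_atomOf : ∀ i : Fin 216, ∀ g : Fin 4, ∀ d : Fin 3,
    layerSide (fccSite (atomOf i g) d) = bondSign (sitePar i) g d ∧
      layerIndex (fccSite (atomOf i g) d) =
        (![i.val / 36, i.val / 6 % 6, i.val % 6] : Fin 3 → ℕ) d := by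
  decide +kernel

theorem atomInt_atomOf (i : Fin 216) (g : Fin 4) (d : Fin 3) :
    atomInt (atomOf i g) d = latticeAtom i g d := by
  unfold atomInt latticeAtom
  rw [(layer_atomOf i g d).1, (layer_atomOf i g d).2, (layer_atomOf i g (d + 1)).2,
    (layer_atomOf i g (d + 2)).2]
  congr 1
  have h : ∀ i : ℕ, i / 36 = i / 6 / 6 := fun i => by omega
  rw [h]
  fin_cases d <;> rfl

theorem bondSign_injective {ε : ℤ} (hε : ε = 1 ∨ ε = -1) : Function.Injective (bondSign ε) := by
  rcases hε with rfl | rfl <;> decide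

theorem atomOf_bijective : Function.Bijective fun x : Fin 216 × Fin 4 => atomOf x.1 x.2 := by
  rw [Fintype.bijective_iff_injective_and_card]
  refine ⟨?_, by simp⟩
  rintro ⟨i, g⟩ ⟨i', g'⟩ h
  simp only at h
  have h0 : ∀ d, (![i.val / 36, i.val / 6 % 6, i.val % 6] : Fin 3 → ℕ) d =
      (![i'.val / 36, i'.val / 6 % 6, i'.val % 6] : Fin 3 → ℕ) d := fun d => by
    rw [← (layer_atomOf i g d).2, ← (layer_atomOf i' g' d).2, h]
  have e0 : i.val / 36 = i'.val / 36 := h0 0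
  have e1 : i.val / 6 % 6 = i'.val / 6 % 6 := h0 1
  have e2 : i.val % 6 = i'.val % 6 := h0 2
  have hi : i = i' := Fin.ext (by omega)
  subst hi
  have hg : g = g' := bondSign_injective (sitePar_eq i) (funext fun d => by
    rw [← (layer_atomOf i g d).1, ← (layer_atomOf i g' d).1, h])
  rw [hg]

/-- The atom over the site `i`, for natural numbers `i`. -/
def atomAt (i : ℕ) (g : Fin 4) : Fin 864 := atomOf (Fin.ofNat 216 i) g

theorem atomInt_atomAt {i : ℕ} (hi : i < 216) (g : Fin 4) :
    atomInt (atomAt i g) = latticeAtom i g := by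
  funext d
  rw [atomAt, atomInt_atomOf]
  congr 1
  simp [Fin.ofNat, Nat.mod_eq_of_lt hi]

theorem sum_atoms (F : Fin 864 → ℝ) : ∑ n, F n = ∑ i ∈ range 216, ∑ g, F (atomAt i g) := by
  rw [← atomOf_bijective.sum_comp, Fintype.sum_prod_type, sum_range]
  refine sum_congr rfl fun i _ => sum_congr rfl fun g _ => ?_
  rw [atomAt]
  congr
  exact Fin.ext (Nat.mod_eq_of_lt i.2).symm

theorem exists_atomAt (n : Fin 864) : ∃ i < 216, ∃ g, n = atomAt i g := by
  obtain ⟨⟨i, g⟩, rfl⟩ := atomOf_bijective.surjective n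
  refine ⟨i, i.2, g, ?_⟩
  simp only [atomAt]
  congr
  exact Fin.ext (Nat.mod_eq_of_lt i.2).symm

theorem sum_atoms_atoms (F : Fin 864 → Fin 864 → ℝ) :
    ∑ n, ∑ m, F n m = ∑ i ∈ range 216, ∑ i' ∈ range 216, ∑ g, ∑ g',
      F (atomAt i g) (atomAt i' g') := by
  rw [sum_atoms]
  refine sum_congr rfl fun i _ => ?_
  rw [sum_comm (s := range 216)]
  exact sum_congr rfl fun g _ => sum_atoms _

theorem exists_signMul (g g' : Fin 4) : ∃ k, g' = signMul g k := by
  revert g g'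
  decide

theorem signMul_zero (g : Fin 4) : signMul g 0 = g := by
  revert g
  decide

theorem bondSign_mul_signMul (i i' : ℕ) (g k : Fin 4) (d : Fin 3) :
    bondSign (sitePar i * sitePar i') k d =
      bondSign (sitePar i) g d * bondSign (sitePar i') (signMul g k) d := by
  have h := bondSign_signMul (sitePar i) (sitePar i * sitePar i') g k d
  rw [← mul_assoc, sitePar_mul_self, one_mul] at h
  rw [h]
  linear_combination -bondSign (sitePar i * sitePar i') k d * bondSign_mul_self (sitePar_eq i) g d

theorem bond_latticeAtom (i i' : ℕ) (g k : Fin 4) (d : Fin 3) :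
    bond (fun _ => 1) (latticeAtom i g) (latticeAtom i' (signMul g k)) d =
      bondSign (sitePar i) g d *
        bond (bondSign (sitePar i * sitePar i') k) (siteInt i) (siteInt i') d := by
  unfold bond latticeAtom
  rw [bondSign_mul_signMul i i' g k]
  linear_combination bondSign (sitePar i') (signMul g k) d * siteInt i' d *
    bondSign_mul_self (sitePar_eq i) g d

theorem bondSq_latticeAtom (i i' : ℕ) (g k : Fin 4) :
    bondSq (fun _ => 1) (latticeAtom i g) (latticeAtom i' (signMul g k)) =
      bondSq (bondSign (sitePar i * sitePar i') k) (siteInt i) (siteInt i') := by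
  have hτ := bondSign_mul_self (sitePar_eq i) g
  unfold bondSq
  simp only [bond_latticeAtom]
  linear_combination
    bond (bondSign (sitePar i * sitePar i') k) (siteInt i) (siteInt i') 0 ^ 2 * hτ 0 +
    bond (bondSign (sitePar i * sitePar i') k) (siteInt i) (siteInt i') 1 ^ 2 * hτ 1 +
    bond (bondSign (sitePar i * sitePar i') k) (siteInt i) (siteInt i') 2 ^ 2 * hτ 2

/-- Different atoms have at least unit distance. -/
theorem atoms_separated {n m : Fin 864} (h : n ≠ m) :
    10 ^ 32 ≤ bondSq (fun _ => 1) (atomInt n) (atomInt m) := by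
  obtain ⟨i, hi, g, rfl⟩ := exists_atomAt n
  obtain ⟨i', hi', g', rfl⟩ := exists_atomAt m
  obtain ⟨k, rfl⟩ := exists_signMul g g'
  rw [atomInt_atomAt hi, atomInt_atomAt hi', bondSq_latticeAtom]
  rcases separated_all i hi i' hi' k with ⟨rfl, rfl⟩ | h'
  · rw [signMul_zero] at h
    exact absurd rfl h
  · exact h'

theorem abs_atomInt_le (n : Fin 864) (d : Fin 3) : |atomInt n d| ≤ 2 ^ 56 := by
  obtain ⟨i, hi, g, rfl⟩ := exists_atomAt n
  rw [atomInt_atomAt hi, latticeAtom, abs_mul, abs_bondSign (sitePar_eq i), one_mul]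
  exact abs_siteInt_le i d

/-- The net force on each atom is small. -/
theorem abs_force_le (n : Fin 864) (d : Fin 3) :
    |∑ m, (pairForce (bondInvFine (fun _ => 1) (atomInt n) (atomInt m)) : ℝ) *
      bond (fun _ => 1) (atomInt n) (atomInt m) d| ≤ 2 ^ 511 := by
  obtain ⟨i, hi, g, rfl⟩ := exists_atomAt n
  rw [sum_atoms, atomInt_atomAt hi]
  have h : ∀ i' ∈ range 216, ∑ g',
      (pairForce (bondInvFine (fun _ => 1) (latticeAtom i g) (atomInt (atomAt i' g'))) : ℝ) *
      bond (fun _ => 1) (latticeAtom i g) (atomInt (atomAt i' g')) d =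
      bondSign (sitePar i) g d * siteForce i i' d := by
    intro i' hi'
    rw [← sum_signMul g, siteForce, Int.cast_sum, mul_sum]
    refine sum_congr rfl fun k _ => ?_
    rw [atomInt_atomAt (mem_range.mp hi'), bond_latticeAtom, bondInvFine, bondInvFine,
      bondSq_latticeAtom]
    push_cast
    ring
  rw [sum_congr rfl h, ← mul_sum, abs_mul]
  have h1 : |(bondSign (sitePar i) g d : ℝ)| = 1 := by
    exact_mod_cast abs_bondSign (sitePar_eq i) g d
  rw [h1, one_mul]
  exact_mod_cast abs_sum_siteForce_le separated_all forceCheck_all hi d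

/-- The displacement field has neither a mean translation nor a mean rotation. -/
def Aligned (v : AtomCloud 864) : Prop :=
  (∀ d, ∑ n, v n d = 0) ∧
    ∀ d, ∑ n, (fccApprox n (d + 1) * v n (d + 2) - fccApprox n (d + 2) * v n (d + 1)) = 0

theorem Aligned.form_bound {v : AtomCloud 864} (hv : Aligned v) :
    300000000000 * 2 ^ 322 * ∑ n, ∑ d, v n d ^ 2 ≤
      1 / 2 * ∑ n, ∑ m, bondForm (atomInt n) (atomInt m) (fun d => v n d - v m d) := by
  have h := lattice_form_bound (V := fun i g => v (atomAt i g)) ?_ ?_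
  · rw [sum_atoms, sum_atoms_atoms]
    refine h.trans_eq (congrArg _ ?_)
    refine sum_congr rfl fun i hi => sum_congr rfl fun i' hi' => sum_congr rfl fun g _ =>
      sum_congr rfl fun g' _ => ?_
    rw [atomInt_atomAt (mem_range.mp hi), atomInt_atomAt (mem_range.mp hi')]
  · intro d
    rw [← sum_atoms fun n => v n d]
    exact hv.1 d
  · intro d
    have h2 := hv.2 d
    have h3 : ∀ n, fccApprox n (d + 1) * v n (d + 2) - fccApprox n (d + 2) * v n (d + 1) =
        1 / 10 ^ 16 * ((atomInt n (d + 1) : ℝ) * v n (d + 2) - atomInt n (d + 2) * v n (d + 1)) := by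
      intro n
      rw [fccApprox_eq, fccApprox_eq]
      ring
    simp only [h3, ← mul_sum] at h2
    rw [sum_atoms, mul_eq_zero] at h2
    rcases h2 with h2 | h2
    · norm_num at h2
    · rw [← h2]
      refine sum_congr rfl fun i hi => sum_congr rfl fun g _ => ?_
      rw [atomInt_atomAt (mem_range.mp hi)]

end Atoms

/-! ### The pair potential and its curvature along lines. -/

section PairEnergy

open Finset Matrix

/-- The Lennard-Jones potential as a function of the squared distance. -/
noncomputable def ljPotential (x : ℝ) : ℝ := x⁻¹ ^ 6 - x⁻¹ ^ 3

/-- The second derivative of the potential along a line, in terms of the inverse squared distance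
`T`, the squared length `n` of the direction, and the square `a` of its product with the bond. -/
noncomputable def ljCurvature (T n a : ℝ) : ℝ :=
  (6 * T ^ 4 - 12 * T ^ 7) * n + 24 * (7 * T ^ 8 - 2 * T ^ 5) * a

/-- Taylor's inequality by two monotonicity arguments: `h' s - c * s` is increasing, and therefore
so is `h s - h' 0 * s - c / 2 * s ^ 2`. -/
theorem le_of_second_deriv_ge {h h' h'' : ℝ → ℝ} {c : ℝ}
    (hd : ∀ s ∈ Set.Icc (0 : ℝ) 1, HasDerivAt h (h' s) s)
    (hd' : ∀ s ∈ Set.Icc (0 : ℝ) 1, HasDerivAt h' (h'' s) s)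
    (hc : ∀ s ∈ Set.Icc (0 : ℝ) 1, c ≤ h'' s) : h 0 + h' 0 + c / 2 ≤ h 1 := by
  have h0 : (0 : ℝ) ∈ Set.Icc (0 : ℝ) 1 := by simp
  have h1 : (1 : ℝ) ∈ Set.Icc (0 : ℝ) 1 := by simp
  have e1 : ∀ s ∈ Set.Icc (0 : ℝ) 1, HasDerivAt (fun s => h' s - c * s) (h'' s - c) s := by
    intro s hs
    simpa using (hd' s hs).fun_sub ((hasDerivAt_id' s).const_mul c)
  have m1 : MonotoneOn (fun s => h' s - c * s) (Set.Icc 0 1) := by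
    refine monotoneOn_of_deriv_nonneg (convex_Icc 0 1)
      (fun s hs => (e1 s hs).continuousAt.continuousWithinAt)
      (fun s hs => (e1 s (interior_subset hs)).differentiableAt.differentiableWithinAt) ?_
    intro s hs
    rw [(e1 s (interior_subset hs)).deriv]
    linarith [hc s (interior_subset hs)]
  have e2 : ∀ s ∈ Set.Icc (0 : ℝ) 1,
      HasDerivAt (fun s => h s - h' 0 * s - c / 2 * s ^ 2) (h' s - h' 0 - c * s) s := by
    intro s hs
    have := ((hd s hs).sub ((hasDerivAt_id s).const_mul (h' 0))).sub
      (((hasDerivAt_id s).pow 2).const_mul (c / 2))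
    refine this.congr_deriv ?_
    simp
    ring
  have m2 : MonotoneOn (fun s => h s - h' 0 * s - c / 2 * s ^ 2) (Set.Icc 0 1) := by
    refine monotoneOn_of_deriv_nonneg (convex_Icc 0 1)
      (fun s hs => (e2 s hs).continuousAt.continuousWithinAt)
      (fun s hs => (e2 s (interior_subset hs)).differentiableAt.differentiableWithinAt) ?_
    intro s hs
    rw [(e2 s (interior_subset hs)).deriv]
    have := m1 h0 (interior_subset hs) (interior_subset hs).1
    simp only [mul_zero, sub_zero] at this
    linarith
  have := m2 h0 h1 zero_le_one
  simp only [mul_zero, sub_zero, mul_one, one_pow, ne_eq, OfNat.ofNat_ne_zero, not_false_eq_true,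
    zero_pow] at this
  linarith

theorem HasDerivAt.inv_eq {x : ℝ → ℝ} {x' s : ℝ} (hx : HasDerivAt x x' s) (h : x s ≠ 0) :
    HasDerivAt (fun s => (x s)⁻¹) (-x' * (x s)⁻¹ ^ 2) s :=
  (hx.fun_inv h).congr_deriv (by rw [inv_pow, div_eq_mul_inv])

theorem hasDerivAt_ljPotential {x : ℝ → ℝ} {x' s : ℝ} (hx : HasDerivAt x x' s) (h : x s ≠ 0) :
    HasDerivAt (fun s => ljPotential (x s))
      ((6 * (x s)⁻¹ ^ 4 - 12 * (x s)⁻¹ ^ 7) * (x' / 2)) s := by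
  have hi := hx.inv_eq h
  refine ((hi.fun_pow 6).fun_sub (hi.fun_pow 3)).congr_deriv ?_
  generalize (x s)⁻¹ = T
  simp only [Nat.reduceSub]
  push_cast
  ring

/-- A second order lower bound for the potential along a line. -/
theorem ljPotential_line_ge {a b n c : ℝ}
    (hpos : ∀ s ∈ Set.Icc (0 : ℝ) 1, 0 < a + 2 * b * s + n * s ^ 2)
    (hc : ∀ s ∈ Set.Icc (0 : ℝ) 1,
      c ≤ ljCurvature (a + 2 * b * s + n * s ^ 2)⁻¹ n ((b + n * s) ^ 2)) :
    ljPotential a + (6 * a⁻¹ ^ 4 - 12 * a⁻¹ ^ 7) * b + c / 2 ≤ ljPotential (a + 2 * b + n) := by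
  have hx : ∀ s, HasDerivAt (fun s : ℝ => a + 2 * b * s + n * s ^ 2) (2 * (b + n * s)) s := by
    intro s
    have := (((hasDerivAt_id s).const_mul (2 * b)).const_add a).add
      (((hasDerivAt_id s).pow 2).const_mul n)
    refine this.congr_deriv ?_
    simp
    ring
  have := le_of_second_deriv_ge (h := fun s => ljPotential (a + 2 * b * s + n * s ^ 2))
    (h' := fun s => (6 * (a + 2 * b * s + n * s ^ 2)⁻¹ ^ 4 -
      12 * (a + 2 * b * s + n * s ^ 2)⁻¹ ^ 7) * (b + n * s))
    (h'' := fun s => ljCurvature (a + 2 * b * s + n * s ^ 2)⁻¹ n ((b + n * s) ^ 2)) (c := c)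
    ?_ ?_ hc
  · simpa using this
  · intro s hs
    refine (hasDerivAt_ljPotential (hx s) (hpos s hs).ne').congr_deriv ?_
    ring
  · intro s hs
    have h0 := (hpos s hs).ne'
    have hi := (hx s).inv_eq h0
    have hl : HasDerivAt (fun s : ℝ => b + n * s) n s := by
      simpa using ((hasDerivAt_id' s).const_mul n).const_add b
    refine ((((hi.fun_pow 4).const_mul 6).fun_sub ((hi.fun_pow 7).const_mul 12)).fun_mul
      hl).congr_deriv ?_
    simp only [ljCurvature, Nat.reduceSub]
    generalize (a + 2 * b * s + n * s ^ 2)⁻¹ = T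
    push_cast
    ring

/-- The slack `(6 - 95 / 16) * N = N / 16` pays for replacing the powers of `x` by 1 and `a` by `b`;
these replacements cost about `N / 25` in total. -/
theorem ljCurvature_ge_of_unit {x s N a b δ : ℝ} (hδ : δ = 1 / 50000) (hx : |x - 1| ≤ δ)
    (hs : 0 ≤ s) (hs1 : s ≤ 1) (hb : 0 ≤ b) (hbN : b ≤ N) (ha : 0 ≤ a) (hab : |a - b| ≤ δ * N) :
    95 / 16 * N - 12 * s * N + 168 * s * b - 48 * b ≤
      6 * x ^ 4 * N - 12 * s * x ^ 7 * N + 168 * s * x ^ 8 * a - 48 * x ^ 5 * a := by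
  have hN : 0 ≤ N := hb.trans hbN
  rw [abs_le] at hx hab
  subst hδ
  have hx0 : (1 - 1 / 50000 : ℝ) ≤ x := by linarith
  have hx1 : x ≤ 1 + 1 / 50000 := by linarith
  have hxp : 0 ≤ x := by linarith
  have p4 : (1 - 1 / 10000 : ℝ) ≤ x ^ 4 :=
    le_trans (by norm_num) (pow_le_pow_left₀ (by norm_num) hx0 4)
  have p8 : (1 - 1 / 6000 : ℝ) ≤ x ^ 8 :=
    le_trans (by norm_num) (pow_le_pow_left₀ (by norm_num) hx0 8)
  have p7 : x ^ 7 ≤ 1 + 1 / 7000 :=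
    le_trans (pow_le_pow_left₀ hxp hx1 7) (by norm_num)
  have p5 : x ^ 5 ≤ 1 + 1 / 9000 :=
    le_trans (pow_le_pow_left₀ hxp hx1 5) (by norm_num)
  have q4 : (1 - 1 / 10000) * N ≤ x ^ 4 * N := mul_le_mul_of_nonneg_right p4 hN
  have q7 : x ^ 7 * N ≤ (1 + 1 / 7000) * N := mul_le_mul_of_nonneg_right p7 hN
  have q8 : (1 - 1 / 6000) * a ≤ x ^ 8 * a := mul_le_mul_of_nonneg_right p8 ha
  have q5 : x ^ 5 * a ≤ (1 + 1 / 9000) * a := mul_le_mul_of_nonneg_right p5 ha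
  have r : s * (-(12 * (1 / 7000 * N)) - 168 * (1 / 6000 * a + 1 / 50000 * N)) ≤
      s * (-12 * (x ^ 7 * N) + 12 * N + 168 * (x ^ 8 * a) - 168 * b) :=
    mul_le_mul_of_nonneg_left (by linarith) hs
  have r' : s * (12 * (1 / 7000 * N) + 168 * (1 / 6000 * a + 1 / 50000 * N)) ≤
      1 * (12 * (1 / 7000 * N) + 168 * (1 / 6000 * a + 1 / 50000 * N)) :=
    mul_le_mul_of_nonneg_right hs1 (by positivity)
  linarith

/-- Scaling by `τ ^ 4` reduces to relative quantities: `T / τ` is close to 1, and `τ * R ≤ 1` bounds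
`τ * B` by `N`. -/
theorem ljCurvature_ge {T τ R N A B δ : ℝ} (hδ : δ = 1 / 50000) (hτ : 0 < τ) (hτ1 : τ ≤ 1)
    (hR : τ * R ≤ 1) (hT : |T - τ| ≤ δ * τ) (hB : 0 ≤ B) (hBR : B ≤ R * N) (hA : 0 ≤ A)
    (hN : 0 ≤ N) (hAB : |A - B| ≤ δ * (R * N)) :
    (95 / 16 * τ ^ 4 - 12 * τ ^ 7) * N + 24 * (7 * τ ^ 8 - 2 * τ ^ 5) * B ≤
      ljCurvature T N A := by
  have hd : 0 ≤ δ := by rw [hδ]; norm_num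
  have hRN : τ * (R * N) ≤ N := by nlinarith
  have key := ljCurvature_ge_of_unit (x := T / τ) (s := τ ^ 3) (N := N) (a := τ * A) (b := τ * B)
    hδ ?_ (by positivity) (pow_le_one₀ hτ.le hτ1) (by positivity)
    ((mul_le_mul_of_nonneg_left hBR hτ.le).trans hRN) (by positivity) ?_
  · have := mul_le_mul_of_nonneg_left key (pow_pos hτ 4).le
    refine le_trans (le_of_eq ?_) (this.trans (le_of_eq ?_))
    · ring
    · unfold ljCurvature
      field_simp
      ring
  · rw [div_sub_one hτ.ne', abs_div, abs_of_pos hτ, div_le_iff₀ hτ]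
    exact hT
  · rw [← mul_sub, abs_mul, abs_of_pos hτ]
    calc τ * |A - B| ≤ τ * (δ * (R * N)) := mul_le_mul_of_nonneg_left hAB hτ.le
      _ = δ * (τ * (R * N)) := by ring
      _ ≤ δ * N := mul_le_mul_of_nonneg_left hRN hd

theorem dotProduct_sq_le (x y : Fin 3 → ℝ) : (x ⬝ᵥ y) ^ 2 ≤ (x ⬝ᵥ x) * (y ⬝ᵥ y) := by
  have := sum_mul_sq_le_sq_mul_sq univ x y
  simpa only [dotProduct, sq] using this

theorem dotProduct_self_real_nonneg (x : Fin 3 → ℝ) : 0 ≤ x ⬝ᵥ x :=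
  sum_nonneg fun i _ => mul_self_nonneg (x i)

theorem abs_dotProduct_le {x y : Fin 3 → ℝ} {a b : ℝ} (ha : 0 ≤ a) (hb : 0 ≤ b)
    (hx : x ⬝ᵥ x ≤ a ^ 2) (hy : y ⬝ᵥ y ≤ b ^ 2) : |x ⬝ᵥ y| ≤ a * b := by
  refine abs_le_of_sq_le_sq ?_ (by positivity)
  calc (x ⬝ᵥ y) ^ 2 ≤ (x ⬝ᵥ x) * (y ⬝ᵥ y) := dotProduct_sq_le x y
    _ ≤ a ^ 2 * b ^ 2 := mul_le_mul hx hy (dotProduct_self_real_nonneg y) (by positivity)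
    _ = (a * b) ^ 2 := by ring

/-- The curvature of the potential near a bond `D` of length at least one. -/
theorem ljCurvature_near_ge {D e z : Fin 3 → ℝ} {τ : ℝ} (hD : 1 ≤ D ⬝ᵥ D)
    (he : e ⬝ᵥ e ≤ (1 / 125000) ^ 2) (hτ : τ * (D ⬝ᵥ D) ≤ 1)
    (hτ' : 1 - 1 / 5000000 ≤ τ * (D ⬝ᵥ D)) :
    0 < (D + e) ⬝ᵥ (D + e) ∧
    (95 / 16 * τ ^ 4 - 12 * τ ^ 7) * (z ⬝ᵥ z) + 24 * (7 * τ ^ 8 - 2 * τ ^ 5) * (D ⬝ᵥ z) ^ 2 ≤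
      ljCurvature ((D + e) ⬝ᵥ (D + e))⁻¹ (z ⬝ᵥ z) (((D + e) ⬝ᵥ z) ^ 2) := by
  set R := D ⬝ᵥ D with hR
  set N := z ⬝ᵥ z with hN
  have hN0 : 0 ≤ N := dotProduct_self_real_nonneg z
  have hsR : √R ≤ R := by
    rw [Real.sqrt_le_iff]
    exact ⟨by linarith, by nlinarith⟩
  have hsN : N = √N ^ 2 := (Real.sq_sqrt hN0).symm
  have hsR' : R = √R ^ 2 := (Real.sq_sqrt (by linarith)).symm
  have hDe : |D ⬝ᵥ e| ≤ √R * (1 / 125000) :=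
    abs_dotProduct_le (Real.sqrt_nonneg _) (by norm_num) hsR'.le he
  have hDz : |D ⬝ᵥ z| ≤ √R * √N :=
    abs_dotProduct_le (Real.sqrt_nonneg _) (Real.sqrt_nonneg _) hsR'.le hsN.le
  have hez : |e ⬝ᵥ z| ≤ 1 / 125000 * √N :=
    abs_dotProduct_le (by norm_num) (Real.sqrt_nonneg _) he hsN.le
  have hR1 : (D + e) ⬝ᵥ (D + e) = R + (2 * (D ⬝ᵥ e) + e ⬝ᵥ e) := by
    rw [add_dotProduct, dotProduct_add, dotProduct_add, dotProduct_comm e D]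
    ring
  have he0 := dotProduct_self_real_nonneg e
  -- Since `√R ≤ R`, the linear term is at most `16 / 1000000 * R`. Together with the rounding error
  -- `1 / 5000000` of `τ` this stays within the relative tolerance `1 / 50000`.
  have hR2 : |2 * (D ⬝ᵥ e) + e ⬝ᵥ e| ≤ R * (17 / 1000000) := by
    rw [abs_le] at hDe ⊢
    constructor <;> linarith
  have hRpos : 0 < (D + e) ⬝ᵥ (D + e) := by
    rw [hR1]
    rw [abs_le] at hR2
    linarith
  have hτ0 : 0 < τ := by
    by_contra h
    push Not at h
    nlinarith
  have hτ1 : τ ≤ 1 := by nlinarith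
  refine ⟨hRpos, ljCurvature_ge rfl hτ0 hτ1 hτ ?_ (sq_nonneg _) (dotProduct_sq_le D z)
    (sq_nonneg _) hN0 ?_⟩
  · have h1 : ((D + e) ⬝ᵥ (D + e))⁻¹ - τ =
        (1 - τ * ((D + e) ⬝ᵥ (D + e))) / ((D + e) ⬝ᵥ (D + e)) := by
      field_simp
    rw [h1, abs_div, abs_of_pos hRpos, div_le_iff₀ hRpos, hR1]
    rw [abs_le] at hR2 ⊢
    constructor <;> nlinarith
  · have h1 : ((D + e) ⬝ᵥ z) ^ 2 - (D ⬝ᵥ z) ^ 2 = (e ⬝ᵥ z) * (2 * (D ⬝ᵥ z) + e ⬝ᵥ z) := by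
      rw [add_dotProduct]
      ring
    rw [h1, abs_mul]
    have h2 : |2 * (D ⬝ᵥ z) + e ⬝ᵥ z| ≤ 2 * (√R * √N) + 1 / 125000 * √N := by
      refine (abs_add_le _ _).trans ?_
      rw [abs_mul, abs_two]
      linarith
    calc |e ⬝ᵥ z| * |2 * (D ⬝ᵥ z) + e ⬝ᵥ z|
        ≤ (1 / 125000 * √N) * (2 * (√R * √N) + 1 / 125000 * √N) :=
          mul_le_mul hez h2 (abs_nonneg _) (by positivity)
      _ = 1 / 125000 * (2 * √R + 1 / 125000) * √N ^ 2 := by ring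
      _ = 1 / 125000 * (2 * √R + 1 / 125000) * N := by rw [← hsN]
      _ ≤ (1 / 50000 * R) * N := by
          refine mul_le_mul_of_nonneg_right ?_ hN0
          linarith
      _ = _ := by ring

end PairEnergy

/-! ### Removing translations and rotations. -/

section Alignment

open Finset Matrix

theorem dotProduct_mulVec_self {A : Matrix (Fin 3) (Fin 3) ℝ}
    (hA : A ∈ specialOrthogonalGroup (Fin 3) ℝ) (x : Fin 3 → ℝ) :
    (A *ᵥ x) ⬝ᵥ (A *ᵥ x) = x ⬝ᵥ x := by
  have h : Aᵀ * A = 1 := (mem_orthogonalGroup_iff' (Fin 3) ℝ).mp hA.1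
  rw [dotProduct_mulVec, ← mulVec_transpose, mulVec_mulVec, h, one_mulVec]

theorem isCompact_specialOrthogonalGroup :
    IsCompact (specialOrthogonalGroup (Fin 3) ℝ : Set (Matrix (Fin 3) (Fin 3) ℝ)) := by
  have hK : IsCompact (Set.univ.pi fun _ : Fin 3 => Set.univ.pi fun _ : Fin 3 =>
      Set.Icc (-1 : ℝ) 1) :=
    isCompact_univ_pi fun _ => isCompact_univ_pi fun _ => isCompact_Icc
  refine hK.of_isClosed_subset ?_ ?_
  · have : (specialOrthogonalGroup (Fin 3) ℝ : Set (Matrix (Fin 3) (Fin 3) ℝ)) =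
        {A | A * Aᵀ = 1} ∩ {A | A.det = 1} := by
      ext A
      rw [SetLike.mem_coe, mem_specialOrthogonalGroup_iff, mem_orthogonalGroup_iff]
      rfl
    rw [this]
    exact (isClosed_eq (by fun_prop) continuous_const).inter
      (isClosed_eq (by fun_prop) continuous_const)
  · intro A hA i _ j _
    have := entry_norm_bound_of_unitary (mem_specialOrthogonalGroup_iff.mp hA).1 i j
    rw [Real.norm_eq_abs, abs_le] at this
    exact this

/-- The rotation by the angle `θ` about a coordinate axis. -/
noncomputable def axisRotation (d : Fin 3) (θ : ℝ) : Matrix (Fin 3) (Fin 3) ℝ :=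
  of fun i j => if i = d then (if j = d then 1 else 0)
    else if j = d then 0 else if i = j then Real.cos θ
    else if i = d + 1 then -Real.sin θ else Real.sin θ

theorem axisRotation_mem (d : Fin 3) (θ : ℝ) :
    axisRotation d θ ∈ specialOrthogonalGroup (Fin 3) ℝ := by
  have h := Real.sin_sq_add_cos_sq θ
  rw [mem_specialOrthogonalGroup_iff, mem_orthogonalGroup_iff]
  constructor
  · ext i j
    fin_cases d <;> fin_cases i <;> fin_cases j <;>
      simp [axisRotation, mul_apply, Fin.sum_univ_three] <;> linarith
  · rw [det_fin_three]
    fin_cases d <;> simp [axisRotation] <;> linarith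

theorem dotProduct_axisRotation (d : Fin 3) (θ : ℝ) (r x : Fin 3 → ℝ) :
    r ⬝ᵥ (axisRotation d θ *ᵥ x) = r d * x d +
      (r (d + 1) * x (d + 1) + r (d + 2) * x (d + 2)) * Real.cos θ +
      (r (d + 2) * x (d + 1) - r (d + 1) * x (d + 2)) * Real.sin θ := by
  fin_cases d <;>
    simp [axisRotation, dotProduct, mulVec, Fin.sum_univ_three] <;> ring

theorem eq_zero_of_trig_le {k a b : ℝ}
    (h : ∀ θ : ℝ, k + a * Real.cos θ + b * Real.sin θ ≤ k + a) : b = 0 := by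
  have hd : HasDerivAt (fun θ : ℝ => k + a * Real.cos θ + b * Real.sin θ) b 0 := by
    have := (((Real.hasDerivAt_cos 0).const_mul a).const_add k).fun_add
      ((Real.hasDerivAt_sin 0).const_mul b)
    simpa using this
  have hm : IsLocalMax (fun θ : ℝ => k + a * Real.cos θ + b * Real.sin θ) 0 :=
    Filter.Eventually.of_forall fun θ => by simpa using h θ
  exact hm.hasDerivAt_eq_zero hd

/-- The rotation which maximizes the overlap with a reference cloud has no residual torque. -/
theorem exists_maximal_overlap {N : ℕ} (r x : AtomCloud N) :
    ∃ A ∈ specialOrthogonalGroup (Fin 3) ℝ,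
      (∑ n, r n ⬝ᵥ x n ≤ ∑ n, r n ⬝ᵥ (A *ᵥ x n)) ∧
      ∀ d, ∑ n, (r n (d + 2) * (A *ᵥ x n) (d + 1) - r n (d + 1) * (A *ᵥ x n) (d + 2)) = 0 := by
  obtain ⟨A, hA, hmax⟩ := isCompact_specialOrthogonalGroup.exists_isMaxOn
    ⟨1, (specialOrthogonalGroup (Fin 3) ℝ).one_mem⟩
    (f := fun A : Matrix (Fin 3) (Fin 3) ℝ => ∑ n, r n ⬝ᵥ (A *ᵥ x n)) (by fun_prop)
  refine ⟨A, hA, ?_, fun d => ?_⟩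
  · simpa using hmax (specialOrthogonalGroup (Fin 3) ℝ).one_mem
  · have hθ : ∀ θ, ∑ n, r n ⬝ᵥ ((axisRotation d θ * A) *ᵥ x n) ≤ ∑ n, r n ⬝ᵥ (A *ᵥ x n) :=
      fun θ => hmax ((specialOrthogonalGroup (Fin 3) ℝ).mul_mem (axisRotation_mem d θ) hA)
    refine eq_zero_of_trig_le (k := ∑ n, r n d * (A *ᵥ x n) d)
      (a := ∑ n, (r n (d + 1) * (A *ᵥ x n) (d + 1) + r n (d + 2) * (A *ᵥ x n) (d + 2)))
      fun θ => ?_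
    have h1 : ∀ n, r n ⬝ᵥ (A *ᵥ x n) = r n d * (A *ᵥ x n) d +
        (r n (d + 1) * (A *ᵥ x n) (d + 1) + r n (d + 2) * (A *ᵥ x n) (d + 2)) := by
      intro n
      generalize A *ᵥ x n = y
      fin_cases d <;> simp [dotProduct, Fin.sum_univ_three] <;> ring
    have := hθ θ
    simp only [← mulVec_mulVec, dotProduct_axisRotation, h1, sum_add_distrib, ← sum_mul] at this
    simpa only [sum_add_distrib] using this

/-- Every cloud can be moved rigidly so that its displacement from a centred reference cloud
has neither a mean translation nor a mean rotation, without increasing the displacement. -/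
theorem exists_rigid_alignment {N : ℕ} (hN : N ≠ 0) (r q : AtomCloud N) (hr : ∑ n, r n = 0) :
    ∃ A ∈ specialOrthogonalGroup (Fin 3) ℝ, ∃ c : Fin 3 → ℝ,
      ∑ n, (A *ᵥ q n + c - r n) = 0 ∧
      (∀ d, ∑ n, (r n (d + 1) * (A *ᵥ q n + c - r n) (d + 2) -
        r n (d + 2) * (A *ᵥ q n + c - r n) (d + 1)) = 0) ∧
      ∑ n, (A *ᵥ q n + c - r n) ⬝ᵥ (A *ᵥ q n + c - r n) ≤
        ∑ n, (q n - r n) ⬝ᵥ (q n - r n) := by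
  set m : Fin 3 → ℝ := (N : ℝ)⁻¹ • ∑ n, q n with hm
  have hm' : ∑ n, q n = (N : ℝ) • m := by
    rw [hm, smul_smul, mul_inv_cancel₀ (Nat.cast_ne_zero.mpr hN), one_smul]
  have hx : ∑ n, (q n - m) = 0 := by
    rw [sum_sub_distrib, hm', sum_const, card_univ, Fintype.card_fin, ← Nat.cast_smul_eq_nsmul ℝ,
      sub_self]
  obtain ⟨A, hA, h1, h2⟩ := exists_maximal_overlap r fun n => q n - m
  have hv : ∀ n, A *ᵥ q n + -(A *ᵥ m) - r n = A *ᵥ (q n - m) - r n := by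
    intro n
    rw [mulVec_sub, sub_eq_add_neg (A *ᵥ q n)]
  refine ⟨A, hA, -(A *ᵥ m), ?_, fun d => ?_, ?_⟩
  · simp only [hv]
    rw [sum_sub_distrib, hr, ← mulVec_sum, hx, mulVec_zero, sub_zero]
  · simp only [hv]
    rw [← neg_eq_zero, ← h2 d, ← sum_neg_distrib]
    refine sum_congr rfl fun n _ => ?_
    simp only [Pi.sub_apply]
    ring
  · simp only [hv]
    have e1 : ∀ n, (A *ᵥ (q n - m) - r n) ⬝ᵥ (A *ᵥ (q n - m) - r n) =
        (q n - m) ⬝ᵥ (q n - m) + r n ⬝ᵥ r n - 2 * (r n ⬝ᵥ (A *ᵥ (q n - m))) := by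
      intro n
      rw [sub_dotProduct, dotProduct_sub, dotProduct_sub, dotProduct_mulVec_self hA,
        dotProduct_comm (A *ᵥ (q n - m)) (r n)]
      ring
    have e2 : ∀ n, (q n - r n) ⬝ᵥ (q n - r n) =
        (q n - m) ⬝ᵥ (q n - m) + r n ⬝ᵥ r n - 2 * (r n ⬝ᵥ (q n - m)) + m ⬝ᵥ m +
          2 * ((q n - m) ⬝ᵥ m) - 2 * (r n ⬝ᵥ m) := by
      intro n
      have : q n - r n = (q n - m) + m - r n := by abel
      rw [this]
      generalize q n - m = x
      simp only [sub_dotProduct, dotProduct_sub, add_dotProduct, dotProduct_add,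
        dotProduct_comm x (r n), dotProduct_comm m (r n), dotProduct_comm m x]
      ring
    -- Both clouds are centred, so the terms linear in `m` cancel. Centring gains the squares `m ⬝ᵥ
    -- m`, and maximality of the overlap does the rest.
    have e3 : ∑ n, (q n - m) ⬝ᵥ m = 0 := by rw [← sum_dotProduct, hx, zero_dotProduct]
    have e4 : ∑ n, r n ⬝ᵥ m = 0 := by rw [← sum_dotProduct, hr, zero_dotProduct]
    have e5 : 0 ≤ ∑ _n : Fin N, m ⬝ᵥ m := sum_nonneg fun _ _ => dotProduct_self_real_nonneg m
    simp only [e1, e2, sum_sub_distrib, sum_add_distrib, ← mul_sum, e3, e4]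
    linarith

end Alignment

/-! ### Strong convexity on aligned displacements. -/

section StrongConvexity

open Finset Matrix

set_option exponentiation.threshold 5000

/-- The energy of all ordered pairs of atoms. -/
noncomputable def pairSum {N : ℕ} (p : AtomCloud N) : ℝ :=
  ∑ n, ∑ m, ljPotential ((p n - p m) ⬝ᵥ (p n - p m))

/-- The derivative of the potential along a displacement `z` of the bond `D`. -/
noncomputable def ljSlope (D z : Fin 3 → ℝ) : ℝ :=
  (6 * (D ⬝ᵥ D)⁻¹ ^ 4 - 12 * (D ⬝ᵥ D)⁻¹ ^ 7) * (D ⬝ᵥ z)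

/-- The derivative of `pairSum` along a displacement field. -/
noncomputable def pairSlope {N : ℕ} (p v : AtomCloud N) : ℝ :=
  ∑ n, ∑ m, ljSlope (p n - p m) (v n - v m)

/-- The squared Euclidean norm of a displacement field. -/
noncomputable def sqNorm {N : ℕ} (v : AtomCloud N) : ℝ := ∑ n, v n ⬝ᵥ v n

theorem sqNorm_eq {N : ℕ} (v : AtomCloud N) : sqNorm v = ∑ n, ∑ d, v n d ^ 2 := by
  simp only [sqNorm, dotProduct, sq]

theorem dotProduct_sub_le_sqNorm {N : ℕ} (v : AtomCloud N) {n m : Fin N} (h : n ≠ m) :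
    (v n - v m) ⬝ᵥ (v n - v m) ≤ 2 * sqNorm v := by
  have h1 : v n ⬝ᵥ v n + v m ⬝ᵥ v m ≤ sqNorm v := by
    rw [← sum_pair (f := fun n => v n ⬝ᵥ v n) h]
    exact sum_le_univ_sum_of_nonneg fun n => dotProduct_self_real_nonneg (v n)
  have h2 := dotProduct_self_real_nonneg (v n + v m)
  have h3 : (v n - v m) ⬝ᵥ (v n - v m) + (v n + v m) ⬝ᵥ (v n + v m) =
      2 * (v n ⬝ᵥ v n + v m ⬝ᵥ v m) := by
    simp only [sub_dotProduct, dotProduct_sub, add_dotProduct, dotProduct_add]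
    ring
  linarith

theorem dotProduct_segment_le {a b : Fin 3 → ℝ} {r s : ℝ} (ha : a ⬝ᵥ a ≤ r) (hb : b ⬝ᵥ b ≤ r)
    (hs : s ∈ Set.Icc (0 : ℝ) 1) : (a + s • (b - a)) ⬝ᵥ (a + s • (b - a)) ≤ r := by
  have h1 : (a + s • (b - a)) ⬝ᵥ (a + s • (b - a)) =
      (1 - s) * (a ⬝ᵥ a) + s * (b ⬝ᵥ b) - s * (1 - s) * ((b - a) ⬝ᵥ (b - a)) := by
    simp only [sub_dotProduct, dotProduct_sub, add_dotProduct, dotProduct_add, smul_dotProduct,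
      dotProduct_smul, smul_eq_mul, dotProduct_comm b a]
    ring
  have h2 : 0 ≤ s * (1 - s) * ((b - a) ⬝ᵥ (b - a)) :=
    mul_nonneg (mul_nonneg hs.1 (by linarith [hs.2])) (dotProduct_self_real_nonneg _)
  have h3 : (1 - s) * (a ⬝ᵥ a) ≤ (1 - s) * r :=
    mul_le_mul_of_nonneg_left ha (by linarith [hs.2])
  have h4 : s * (b ⬝ᵥ b) ≤ s * r := mul_le_mul_of_nonneg_left hb hs.1
  linarith

/-- A second order lower bound for the potential between two bonds near the bond `D`. -/
theorem ljPotential_near_ge {D a b : Fin 3 → ℝ} {τ : ℝ} (hD : 1 ≤ D ⬝ᵥ D)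
    (ha : a ⬝ᵥ a ≤ (1 / 125000) ^ 2) (hb : b ⬝ᵥ b ≤ (1 / 125000) ^ 2)
    (hτ : τ * (D ⬝ᵥ D) ≤ 1) (hτ' : 1 - 1 / 5000000 ≤ τ * (D ⬝ᵥ D)) :
    ljPotential ((D + a) ⬝ᵥ (D + a)) + ljSlope (D + a) (b - a) +
      ((95 / 16 * τ ^ 4 - 12 * τ ^ 7) * ((b - a) ⬝ᵥ (b - a)) +
        24 * (7 * τ ^ 8 - 2 * τ ^ 5) * (D ⬝ᵥ (b - a)) ^ 2) / 2 ≤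
      ljPotential ((D + b) ⬝ᵥ (D + b)) := by
  set z := b - a with hz
  have h1 : ∀ s : ℝ, (D + (a + s • z)) ⬝ᵥ (D + (a + s • z)) =
      (D + a) ⬝ᵥ (D + a) + 2 * ((D + a) ⬝ᵥ z) * s + (z ⬝ᵥ z) * s ^ 2 := by
    intro s
    rw [← add_assoc]
    generalize D + a = x
    simp only [add_dotProduct, dotProduct_add, smul_dotProduct, dotProduct_smul, smul_eq_mul,
      dotProduct_comm z x]
    ring
  have h2 : ∀ s : ℝ, (D + (a + s • z)) ⬝ᵥ z = (D + a) ⬝ᵥ z + (z ⬝ᵥ z) * s := by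
    intro s
    simp only [add_dotProduct, smul_dotProduct, smul_eq_mul]
    ring
  have key := fun s (hs : s ∈ Set.Icc (0 : ℝ) 1) =>
    ljCurvature_near_ge (z := z) hD (dotProduct_segment_le ha hb hs) hτ hτ'
  have := ljPotential_line_ge (a := (D + a) ⬝ᵥ (D + a)) (b := (D + a) ⬝ᵥ z) (n := z ⬝ᵥ z)
    (c := (95 / 16 * τ ^ 4 - 12 * τ ^ 7) * (z ⬝ᵥ z) +
      24 * (7 * τ ^ 8 - 2 * τ ^ 5) * (D ⬝ᵥ z) ^ 2)
    (fun s hs => by rw [← h1]; exact (key s hs).1)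
    (fun s hs => by rw [← h1, ← h2]; exact (key s hs).2)
  have h3 := h1 1
  rw [one_smul, hz, add_sub_cancel, ← hz, mul_one, one_pow, mul_one] at h3
  rw [h3]
  exact this

/-- Undoes the integer scaling: `2 ^ 256` comes from the powers of the inverse square, `10 ^ 32`
from the two bond coordinates. -/
theorem bondForm_eq (P P' : Fin 3 → ℤ) (z D : Fin 3 → ℝ) (τ : ℝ)
    (hτ : τ = (bondInv (fun _ => 1) P P' : ℝ) / 2 ^ 32)
    (hD : ∀ d, D d = (bond (fun _ => 1) P P' d : ℝ) / 10 ^ 16) :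
    bondForm P P' z = 2 ^ 256 * 10 ^ 32 * ((95 / 16 * τ ^ 4 - 12 * τ ^ 7) * (z ⬝ᵥ z) +
      24 * (7 * τ ^ 8 - 2 * τ ^ 5) * (D ⬝ᵥ z) ^ 2) := by
  have h1 : (isoStiff (bondInv (fun _ => 1) P P') : ℝ) =
      2 ^ 256 * 10 ^ 32 * (95 / 16 * τ ^ 4 - 12 * τ ^ 7) := by
    rw [isoStiff, hτ]
    push_cast
    generalize (bondInv (fun _ => 1) P P' : ℝ) = y
    ring
  have h2 : (dirStiff (bondInv (fun _ => 1) P P') : ℝ) =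
      2 ^ 256 * (24 * (7 * τ ^ 8 - 2 * τ ^ 5)) := by
    rw [dirStiff, hτ]
    push_cast
    generalize (bondInv (fun _ => 1) P P' : ℝ) = y
    ring
  have h3 : ∀ d, (bond (fun _ => 1) P P' d : ℝ) = 10 ^ 16 * D d := fun d => by
    rw [hD]
    ring
  have h4 : (10 : ℝ) ^ 32 = 10 ^ 16 * 10 ^ 16 := by norm_num
  simp only [bondForm, stiffness, Int.cast_add, Int.cast_mul, Int.cast_ite, Int.cast_zero, h1, h2,
    h3, h4, dotProduct, Fin.sum_univ_three]
  generalize (10 : ℝ) ^ 16 = c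
  generalize (2 : ℝ) ^ 256 = k
  simp
  ring

theorem fcc_bond_eq (n m : Fin 864) (d : Fin 3) :
    (fccApprox n - fccApprox m) d = (bond (fun _ => 1) (atomInt n) (atomInt m) d : ℝ) / 10 ^ 16 := by
  rw [Pi.sub_apply, fccApprox_eq, fccApprox_eq, bond]
  push_cast
  ring

theorem fcc_dotProduct_eq (n m : Fin 864) :
    (fccApprox n - fccApprox m) ⬝ᵥ (fccApprox n - fccApprox m) =
      (bondSq (fun _ => 1) (atomInt n) (atomInt m) : ℝ) / 10 ^ 32 := by
  have h4 : (10 : ℝ) ^ 32 = 10 ^ 16 * 10 ^ 16 := by norm_num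
  simp only [dotProduct, Fin.sum_univ_three, fcc_bond_eq, bondSq, h4]
  push_cast
  ring

theorem abs_fcc_bond_le (n m : Fin 864) (d : Fin 3) :
    |bond (fun _ => 1) (atomInt n) (atomInt m) d| ≤ 2 ^ 57 := by
  have h1 := abs_atomInt_le n d
  have h2 := abs_atomInt_le m d
  rw [bond, one_mul]
  rw [abs_le] at *
  constructor <;> linarith

theorem fcc_bondSq_le (n m : Fin 864) :
    bondSq (fun _ => 1) (atomInt n) (atomInt m) ≤ 3 * 2 ^ 114 := by
  have h : ∀ d, bond (fun _ => 1) (atomInt n) (atomInt m) d ^ 2 ≤ 2 ^ 114 := fun d => by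
    have := pow_le_pow_left₀ (abs_nonneg _) (abs_fcc_bond_le n m d) 2
    rwa [sq_abs, ← pow_mul] at this
  rw [bondSq]
  linarith [h 0, h 1, h 2]

theorem one_le_fcc_dotProduct {n m : Fin 864} (h : n ≠ m) :
    1 ≤ (fccApprox n - fccApprox m) ⬝ᵥ (fccApprox n - fccApprox m) := by
  rw [fcc_dotProduct_eq, one_le_div (by positivity)]
  exact_mod_cast atoms_separated h

/-- The rounded inverse of a squared bond length. -/
theorem floor_mul_bounds {X k : ℤ} (hX : 0 < X) :
    ((k * 10 ^ 32 / X : ℤ) : ℝ) * (X / 10 ^ 32) ≤ k ∧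
      (k : ℝ) - X / 10 ^ 32 ≤ ((k * 10 ^ 32 / X : ℤ) : ℝ) * (X / 10 ^ 32) := by
  have h1 := Int.ediv_mul_le (k * 10 ^ 32) hX.ne'
  have h2 := Int.lt_ediv_add_one_mul_self (k * 10 ^ 32) hX
  have h1' : ((k * 10 ^ 32 / X : ℤ) : ℝ) * X ≤ k * 10 ^ 32 := by exact_mod_cast h1
  have h2' : (k : ℝ) * 10 ^ 32 < (((k * 10 ^ 32 / X : ℤ) : ℝ) + 1) * X := by exact_mod_cast h2
  generalize ((k * 10 ^ 32 / X : ℤ) : ℝ) = y at *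
  generalize (X : ℝ) = x at *
  generalize (k : ℝ) = k at *
  have hc : (0 : ℝ) < 10 ^ 32 := by positivity
  generalize (10 : ℝ) ^ 32 = c at *
  constructor
  · rw [mul_div_assoc', div_le_iff₀ hc]
    exact h1'
  · rw [sub_le_iff_le_add, mul_div_assoc', ← add_div, le_div_iff₀ hc]
    linarith

/-- The displacements for which the curvature of the potential is controlled. -/
def NearFcc (p : AtomCloud 864) : Prop := sqNorm (p - fccApprox) ≤ (1 / 125000) ^ 2 / 2

theorem bondForm_zero (P P' : Fin 3 → ℤ) : bondForm P P' 0 = 0 := by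
  simp [bondForm]

theorem NearFcc.bond_le {p : AtomCloud 864} (hp : NearFcc p) {n m : Fin 864} (h : n ≠ m) :
    ((p - fccApprox) n - (p - fccApprox) m) ⬝ᵥ ((p - fccApprox) n - (p - fccApprox) m) ≤
      (1 / 125000) ^ 2 :=
  (dotProduct_sub_le_sqNorm _ h).trans (by unfold NearFcc at hp; linarith)

/-- The curvature bound is evaluated at the fixed bond of `fccApprox`, not at `p` or `q`, so that
one quadratic form serves all pairs of nearby clouds. -/
theorem NearFcc.pair_ge {p q : AtomCloud 864} (hp : NearFcc p) (hq : NearFcc q) (n m : Fin 864) :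
    ljPotential ((p n - p m) ⬝ᵥ (p n - p m)) + ljSlope (p n - p m) ((q - p) n - (q - p) m) +
      bondForm (atomInt n) (atomInt m) (fun d => (q - p) n d - (q - p) m d) /
        (2 ^ 256 * 10 ^ 32) / 2 ≤
      ljPotential ((q n - q m) ⬝ᵥ (q n - q m)) := by
  have hz : (fun d => (q - p) n d - (q - p) m d) = (q - p) n - (q - p) m := rfl
  rw [hz]
  by_cases h : n = m
  · subst h
    simp [ljSlope, bondForm_zero]
  set y := bondInv (fun _ => 1) (atomInt n) (atomInt m) with hy
  have hX : 0 < bondSq (fun _ => 1) (atomInt n) (atomInt m) :=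
    lt_of_lt_of_le (by positivity) (atoms_separated h)
  obtain ⟨f1, f2⟩ := floor_mul_bounds (k := 2 ^ 32) hX
  rw [← fcc_dotProduct_eq] at f1 f2
  -- Here `3 * 2 ^ 114 / 10 ^ 32 < 624`, and `624 / 2 ^ 32 < 1 / 5000000` makes the rounded inverse
  -- square accurate enough.
  have f3 : (fccApprox n - fccApprox m) ⬝ᵥ (fccApprox n - fccApprox m) ≤ 624 := by
    rw [fcc_dotProduct_eq, div_le_iff₀ (by positivity)]
    have : (bondSq (fun _ => 1) (atomInt n) (atomInt m) : ℝ) ≤ 3 * 2 ^ 114 := by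
      exact_mod_cast fcc_bondSq_le n m
    refine this.trans ?_
    norm_num
  have hy' : ((2 ^ 32 * 10 ^ 32 / bondSq (fun _ => 1) (atomInt n) (atomInt m) : ℤ) : ℝ) = y := rfl
  rw [hy'] at f1 f2
  push_cast at f1 f2
  rw [bondForm_eq _ _ _ (fccApprox n - fccApprox m) (y / 2 ^ 32) rfl (fcc_bond_eq n m)]
  have key := ljPotential_near_ge (τ := (y : ℝ) / 2 ^ 32) (one_le_fcc_dotProduct h) (hp.bond_le h)
    (hq.bond_le h) ?_ ?_
  · have e1 : fccApprox n - fccApprox m + ((p - fccApprox) n - (p - fccApprox) m) = p n - p m := by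
      simp only [Pi.sub_apply]
      abel
    have e2 : fccApprox n - fccApprox m + ((q - fccApprox) n - (q - fccApprox) m) = q n - q m := by
      simp only [Pi.sub_apply]
      abel
    have e3 : ((q - fccApprox) n - (q - fccApprox) m) - ((p - fccApprox) n - (p - fccApprox) m) =
        (q - p) n - (q - p) m := by
      simp only [Pi.sub_apply]
      abel
    rw [e1, e2, e3] at key
    rw [mul_div_cancel_left₀ _ (by positivity)]
    exact key
  · rw [div_mul_eq_mul_div, div_le_one (by positivity)]
    exact f1.trans (by norm_num)
  · rw [div_mul_eq_mul_div, le_div_iff₀ (by positivity)]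
    linarith

/-- The pairwise Taylor bounds add up to the lattice form of `q - p`, which controls `sqNorm (q -
p)` because this displacement is aligned. -/
theorem pairSum_strongly_convex {p q : AtomCloud 864} (hp : NearFcc p) (hq : NearFcc q)
    (h : Aligned (q - p)) :
    pairSum p + pairSlope p (q - p) + 1 / 5 * sqNorm (q - p) ≤ pairSum q := by
  have h1 := sum_le_sum fun n (_ : n ∈ (univ : Finset (Fin 864))) =>
    sum_le_sum fun m (_ : m ∈ (univ : Finset (Fin 864))) => hp.pair_ge hq n m
  simp only [sum_add_distrib, ← sum_div] at h1
  have h2 := h.form_bound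
  have h3 : 1 / 5 * sqNorm (q - p) ≤
      (∑ n, ∑ m, bondForm (atomInt n) (atomInt m) (fun d => (q - p) n d - (q - p) m d)) /
        (2 ^ 256 * 10 ^ 32) / 2 := by
    rw [← sqNorm_eq] at h2
    have h0 : 0 ≤ sqNorm (q - p) := sum_nonneg fun n _ => dotProduct_self_real_nonneg _
    generalize sqNorm (q - p) = S at *
    generalize (∑ n, ∑ m, bondForm (atomInt n) (atomInt m)
      (fun d => (q - p) n d - (q - p) m d)) = F at *
    rw [div_div, le_div_iff₀ (by positivity)]
    -- The certified constant is `3 * 10 ^ 11 * 2 ^ 66 / 10 ^ 32`, about 0.221.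
    have hc : 1 / 5 * (2 ^ 256 * 10 ^ 32) * S ≤ 300000000000 * 2 ^ 322 * S :=
      mul_le_mul_of_nonneg_right (by norm_num) h0
    linarith
  unfold pairSum pairSlope
  linarith

end StrongConvexity

/-! ### The gradient at the approximate minimizer. -/

section Gradient

open Finset Matrix

set_option exponentiation.threshold 5000

theorem pow_sub_pow_le {t s : ℝ} (hs : 0 ≤ s) (hst : s ≤ t) (ht : t ≤ 1) (k : ℕ) :
    t ^ k - s ^ k ≤ k * (t - s) := by
  induction k with
  | zero => simp
  | succ k ih =>
    have h1 : t ^ (k + 1) - s ^ (k + 1) = t * (t ^ k - s ^ k) + s ^ k * (t - s) := by ring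
    have h2 : 0 ≤ t ^ k - s ^ k := sub_nonneg.mpr (pow_le_pow_left₀ hs hst k)
    have h3 : s ^ k ≤ 1 := pow_le_one₀ hs (hst.trans ht)
    have h4 : 0 ≤ t - s := sub_nonneg.mpr hst
    rw [h1]
    push_cast
    nlinarith

/-- The constant `108 = 6 * 4 + 12 * 7` is a Lipschitz constant on the unit interval. -/
theorem abs_force_sub_le {t s : ℝ} (hs : 0 ≤ s) (hst : s ≤ t) (ht : t ≤ 1) :
    |(6 * t ^ 4 - 12 * t ^ 7) - (6 * s ^ 4 - 12 * s ^ 7)| ≤ 108 * (t - s) := by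
  have h4 := pow_sub_pow_le hs hst ht 4
  have h7 := pow_sub_pow_le hs hst ht 7
  have h4' := pow_le_pow_left₀ hs hst 4
  have h7' := pow_le_pow_left₀ hs hst 7
  push_cast at h4 h7
  rw [abs_le]
  constructor <;> linarith

/-- The force between two atoms of the relaxed block. -/
noncomputable def fccForce (n m : Fin 864) : ℝ :=
  6 * ((fccApprox n - fccApprox m) ⬝ᵥ (fccApprox n - fccApprox m))⁻¹ ^ 4 -
    12 * ((fccApprox n - fccApprox m) ⬝ᵥ (fccApprox n - fccApprox m))⁻¹ ^ 7

/-- Since `1620 = 108 * 15`: the inverse square is rounded by at most `2 ^ (-72)`, and coordinate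
differences are at most `2 ^ 57 / 10 ^ 16 < 15`. -/
theorem abs_fccForce_sub_le (n m : Fin 864) (d : Fin 3) :
    |fccForce n m * (fccApprox n - fccApprox m) d -
      (pairForce (bondInvFine (fun _ => 1) (atomInt n) (atomInt m)) : ℝ) *
        bond (fun _ => 1) (atomInt n) (atomInt m) d / (2 ^ 504 * 10 ^ 16)| ≤ 1620 / 2 ^ 72 := by
  by_cases h : n = m
  · subst h
    simp only [sub_self, Pi.zero_apply, mul_zero, bond, one_mul, Int.cast_zero, zero_div, abs_zero]
    positivity
  set y := bondInvFine (fun _ => 1) (atomInt n) (atomInt m) with hy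
  have hX : 0 < bondSq (fun _ => 1) (atomInt n) (atomInt m) :=
    lt_of_lt_of_le (by positivity) (atoms_separated h)
  have hy0 : (0 : ℝ) ≤ y := by exact_mod_cast bondInvFine_nonneg _ _ _
  obtain ⟨f1, f2⟩ := floor_mul_bounds (k := 2 ^ 72) hX
  rw [← fcc_dotProduct_eq] at f1 f2
  have hy' : ((2 ^ 72 * 10 ^ 32 / bondSq (fun _ => 1) (atomInt n) (atomInt m) : ℤ) : ℝ) = y := rfl
  rw [hy', Int.cast_pow, Int.cast_ofNat] at f1 f2
  have hR := one_le_fcc_dotProduct h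
  have hb : |(fccApprox n - fccApprox m) d| ≤ 15 := by
    have h57 : |(bond (fun _ => 1) (atomInt n) (atomInt m) d : ℝ)| ≤ 2 ^ 57 := by
      exact_mod_cast abs_fcc_bond_le n m d
    rw [fcc_bond_eq, abs_div, abs_of_pos (show (0 : ℝ) < 10 ^ 16 by positivity),
      div_le_iff₀ (by positivity)]
    exact h57.trans (by norm_num)
  have hp : (pairForce y : ℝ) * bond (fun _ => 1) (atomInt n) (atomInt m) d /
      (2 ^ 504 * 10 ^ 16) = (6 * (y / 2 ^ 72 : ℝ) ^ 4 - 12 * (y / 2 ^ 72 : ℝ) ^ 7) *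
        (fccApprox n - fccApprox m) d := by
    rw [fcc_bond_eq, pairForce]
    push_cast
    generalize (y : ℝ) = y
    ring
  rw [hp, fccForce, ← sub_mul, abs_mul]
  set R := (fccApprox n - fccApprox m) ⬝ᵥ (fccApprox n - fccApprox m) with hR'
  have hR0 : 0 < R := by linarith
  have hc : (0 : ℝ) < 2 ^ 72 := by positivity
  have k1 : (y : ℝ) / 2 ^ 72 ≤ R⁻¹ := by
    rw [div_le_iff₀ hc, inv_mul_eq_div, le_div_iff₀ hR0]
    exact f1
  have k2 : R⁻¹ - (y : ℝ) / 2 ^ 72 ≤ 1 / 2 ^ 72 := by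
    rw [sub_le_iff_le_add, ← add_div, inv_le_iff_one_le_mul₀ hR0, div_mul_eq_mul_div,
      one_le_div hc]
    linarith
  have k3 := abs_force_sub_le (div_nonneg hy0 hc.le) k1 (inv_le_one_of_one_le₀ hR)
  calc _ ≤ 108 * (1 / 2 ^ 72) * 15 :=
        mul_le_mul (k3.trans (mul_le_mul_of_nonneg_left k2 (by norm_num))) hb (abs_nonneg _)
          (by positivity)
    _ = 1620 / 2 ^ 72 := by ring

/-- The gradient of the energy at the relaxed block is small. -/
theorem abs_gradient_le (n : Fin 864) (d : Fin 3) :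
    |∑ m, fccForce n m * (fccApprox n - fccApprox m) d| ≤ 2 / 10 ^ 14 := by
  have h1 := abs_force_le n d
  have h2 : |∑ m, (fccForce n m * (fccApprox n - fccApprox m) d -
      (pairForce (bondInvFine (fun _ => 1) (atomInt n) (atomInt m)) : ℝ) *
        bond (fun _ => 1) (atomInt n) (atomInt m) d / (2 ^ 504 * 10 ^ 16))| ≤
      864 * (1620 / 2 ^ 72) := by
    refine (abs_sum_le_sum_abs _ _).trans ((sum_le_sum fun m _ => abs_fccForce_sub_le n m d).trans
      (le_of_eq ?_))
    simp
  rw [sum_sub_distrib, ← sum_div] at h2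
  generalize (∑ m, (pairForce (bondInvFine (fun _ => 1) (atomInt n) (atomInt m)) : ℝ) *
    bond (fun _ => 1) (atomInt n) (atomInt m) d) = F at *
  -- The certified force bound `2 ^ 511` is `2 ^ 7` in units of `2 ^ 504`.
  have h3 : |F / (2 ^ 504 * 10 ^ 16)| ≤ 128 / 10 ^ 16 := by
    rw [abs_div, abs_of_pos (show (0 : ℝ) < 2 ^ 504 * 10 ^ 16 by positivity),
      div_le_iff₀ (by positivity)]
    exact h1.trans (by norm_num)
  generalize F / (2 ^ 504 * 10 ^ 16) = f at *
  generalize (∑ m, fccForce n m * (fccApprox n - fccApprox m) d) = g at *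
  have h4 : (864 * (1620 / 2 ^ 72) : ℝ) ≤ 1 / 10 ^ 15 := by norm_num
  rw [abs_le] at *
  constructor <;> linarith

theorem fccForce_comm (n m : Fin 864) : fccForce m n = fccForce n m := by
  have : fccApprox m - fccApprox n = -(fccApprox n - fccApprox m) := by abel
  simp only [fccForce, this, neg_dotProduct, dotProduct_neg, neg_neg]

/-- Each ordered pair acts on both of its atoms, with opposite forces; exchanging the summation
indices merges the two contributions and gives the factor 2. -/
theorem pairSlope_fccApprox (u : AtomCloud 864) :
    pairSlope fccApprox u =
      2 * ∑ n, ∑ d, (∑ m, fccForce n m * (fccApprox n - fccApprox m) d) * u n d := by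
  have h1 : ∀ n, ∑ m, fccForce n m * ((fccApprox n - fccApprox m) ⬝ᵥ u n) =
      ∑ d, (∑ m, fccForce n m * (fccApprox n - fccApprox m) d) * u n d := by
    intro n
    simp only [dotProduct, mul_sum, sum_mul]
    rw [sum_comm]
    simp only [mul_assoc]
  have h2 : pairSlope fccApprox u =
      ∑ n, ∑ m, fccForce n m * ((fccApprox n - fccApprox m) ⬝ᵥ u n) +
        ∑ n, ∑ m, fccForce m n * ((fccApprox m - fccApprox n) ⬝ᵥ u m) := by
    rw [← sum_add_distrib]
    refine sum_congr rfl fun n _ => ?_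
    rw [← sum_add_distrib]
    refine sum_congr rfl fun m _ => ?_
    have h3 : ljSlope (fccApprox n - fccApprox m) (u n - u m) =
        fccForce n m * ((fccApprox n - fccApprox m) ⬝ᵥ (u n - u m)) := rfl
    have h4 : fccApprox m - fccApprox n = -(fccApprox n - fccApprox m) := by abel
    rw [h3, fccForce_comm, h4, dotProduct_sub, neg_dotProduct]
    ring
  rw [h2, sum_comm (f := fun n m => fccForce m n * ((fccApprox m - fccApprox n) ⬝ᵥ u m)), two_mul]
  simp only [h1]

/-- Cauchy–Schwarz over the `3 * 864 = 2592` coordinates. -/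
theorem sq_sum_abs_le (u : AtomCloud 864) : (∑ n, ∑ d, |u n d|) ^ 2 ≤ 2592 * sqNorm u := by
  have := sq_sum_le_card_mul_sum_sq (s := (univ : Finset (Fin 864 × Fin 3)))
    (f := fun x => |u x.1 x.2|)
  rw [sqNorm_eq]
  simp only [Fintype.sum_prod_type, sq_abs] at this
  refine this.trans (le_of_eq ?_)
  simp

theorem abs_pairSlope_fccApprox_le (u : AtomCloud 864) :
    |pairSlope fccApprox u| ≤ 4 / 10 ^ 14 * ∑ n, ∑ d, |u n d| := by
  rw [pairSlope_fccApprox, abs_mul, abs_two]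
  have : |∑ n, ∑ d, (∑ m, fccForce n m * (fccApprox n - fccApprox m) d) * u n d| ≤
      2 / 10 ^ 14 * ∑ n, ∑ d, |u n d| := by
    simp only [mul_sum]
    refine (abs_sum_le_sum_abs _ _).trans (sum_le_sum fun n _ => ?_)
    refine (abs_sum_le_sum_abs _ _).trans (sum_le_sum fun d _ => ?_)
    rw [abs_mul]
    exact mul_le_mul_of_nonneg_right (abs_gradient_le n d) (abs_nonneg _)
  linarith

/-- An aligned cloud near the relaxed block whose energy is not larger is very close to it. -/
theorem sqNorm_le_of_pairSum_le {p : AtomCloud 864} (hp : NearFcc p)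
    (h : Aligned (p - fccApprox)) (hE : pairSum p ≤ pairSum fccApprox) :
    sqNorm (p - fccApprox) ≤ (1.4797 / 10 ^ 11) ^ 2 := by
  have h0 : NearFcc fccApprox := by
    simp only [NearFcc, sub_self, sqNorm, Pi.zero_apply, zero_dotProduct, sum_const_zero]
    positivity
  have h1 := pairSum_strongly_convex h0 hp h
  have h2 := (abs_le.mp (abs_pairSlope_fccApprox_le (p - fccApprox))).1
  have h3 := sq_sum_abs_le (p - fccApprox)
  have h4 : 0 ≤ ∑ n, ∑ d, |(p - fccApprox) n d| :=
    sum_nonneg fun _ _ => sum_nonneg fun _ _ => abs_nonneg _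
  have h5 : 0 ≤ sqNorm (p - fccApprox) := sum_nonneg fun n _ => dotProduct_self_real_nonneg _
  generalize sqNorm (p - fccApprox) = S at *
  generalize pairSlope fccApprox (p - fccApprox) = L at *
  generalize (∑ n, ∑ d, |(p - fccApprox) n d|) = A at *
  -- Strong convexity without gain of energy gives `S / 5 ≤ 4 / 10 ^ 14 * A`. With `A ^ 2 ≤ 2592 *
  -- S` the distance `√S` is at most about `1.02 / 10 ^ 11`.
  have h6 : S ≤ 20 / 10 ^ 14 * A := by linarith
  have h7 : S ^ 2 ≤ (20 / 10 ^ 14) ^ 2 * 2592 * S := by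
    calc S ^ 2 ≤ (20 / 10 ^ 14 * A) ^ 2 := pow_le_pow_left₀ h5 h6 2
      _ = (20 / 10 ^ 14) ^ 2 * A ^ 2 := by ring
      _ ≤ (20 / 10 ^ 14) ^ 2 * (2592 * S) := mul_le_mul_of_nonneg_left h3 (by positivity)
      _ = _ := by ring
  rcases h5.eq_or_lt with h8 | h8
  · rw [← h8]
    positivity
  · have h9 : S ≤ (20 / 10 ^ 14) ^ 2 * 2592 := by
      rw [sq] at h7
      exact le_of_mul_le_mul_right h7 h8
    exact h9.trans (by norm_num)

end Gradient

/-! ### The minimizer on the slice and its uniqueness. -/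

section Minimizer

open Finset Matrix Filter Topology

theorem sum_Ioi_eq_half {N : ℕ} (f : Fin N → Fin N → ℝ) (hs : ∀ i j, f i j = f j i)
    (h0 : ∀ i, f i i = 0) : ∑ i, ∑ j ∈ Ioi i, f i j = 1 / 2 * ∑ i, ∑ j, f i j := by
  have h1 : ∀ i, ∑ j ∈ Ioi i, f i j = ∑ j, if i < j then f i j else 0 := by
    intro i
    rw [← sum_filter]
    congr 1
    ext j
    simp
  have h2 : ∑ i, ∑ j, f i j = ∑ i, ∑ j, ((if i < j then f i j else 0) +
      if j < i then f j i else 0) := by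
    refine sum_congr rfl fun i _ => sum_congr rfl fun j _ => ?_
    rcases lt_trichotomy i j with h | h | h
    · simp [h, h.not_gt]
    · simp [h, h0]
    · simp [h, h.not_gt, hs i j]
  simp only [sum_add_distrib] at h2
  rw [sum_comm (f := fun i j => if j < i then f j i else 0)] at h2
  simp only [h1, h2]
  ring

/-- Ordered pairs count every bond twice, and the diagonal terms vanish because `0⁻¹ = 0`. -/
theorem ljEnergy_eq_pairSum {N : ℕ} (p : AtomCloud N) : ljEnergy p = 2 / N * pairSum p := by
  have h : ∀ i j, 1 / atomDist p i j ^ 12 - 1 / atomDist p i j ^ 6 =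
      ljPotential ((p i - p j) ⬝ᵥ (p i - p j)) := by
    intro i j
    have h2 : atomDist p i j ^ 2 = (p i - p j) ⬝ᵥ (p i - p j) := by
      rw [atomDist, EuclideanSpace.real_norm_sq_eq]
      simp only [dotProduct, sq]
    rw [ljPotential, ← h2]
    simp only [inv_pow, ← pow_mul, one_div]
  unfold ljEnergy
  simp only [h]
  rw [sum_Ioi_eq_half, pairSum]
  · ring
  · intro i j
    have : p j - p i = -(p i - p j) := by abel
    rw [this, neg_dotProduct, dotProduct_neg, neg_neg]
  · intro i
    simp [ljPotential]

theorem isLocalMin_ljEnergy_iff {N : ℕ} (hN : N ≠ 0) (p : AtomCloud N) :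
    IsLocalMin ljEnergy p ↔ IsLocalMin pairSum p := by
  have hN' : (0 : ℝ) < 2 / N := by positivity
  refine eventually_congr (Eventually.of_forall fun q => ?_)
  rw [ljEnergy_eq_pairSum, ljEnergy_eq_pairSum, mul_le_mul_iff_right₀ hN']

/-- The image of a cloud under a rigid motion. -/
def rigidMove {N : ℕ} (A : Matrix (Fin 3) (Fin 3) ℝ) (c : Fin 3 → ℝ) (p : AtomCloud N) :
    AtomCloud N := fun n => A *ᵥ p n + c

theorem pairSum_rigidMove {N : ℕ} {A : Matrix (Fin 3) (Fin 3) ℝ}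
    (hA : A ∈ specialOrthogonalGroup (Fin 3) ℝ) (c : Fin 3 → ℝ) (p : AtomCloud N) :
    pairSum (rigidMove A c p) = pairSum p := by
  unfold pairSum rigidMove
  refine sum_congr rfl fun n _ => sum_congr rfl fun m _ => ?_
  rw [add_sub_add_right_eq_sub, ← mulVec_sub, dotProduct_mulVec_self hA]

theorem transpose_mem_specialOrthogonalGroup {A : Matrix (Fin 3) (Fin 3) ℝ}
    (hA : A ∈ specialOrthogonalGroup (Fin 3) ℝ) : Aᵀ ∈ specialOrthogonalGroup (Fin 3) ℝ := by
  rw [mem_specialOrthogonalGroup_iff, mem_orthogonalGroup_iff] at *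
  rw [transpose_transpose, det_transpose]
  exact ⟨mul_eq_one_comm.mp hA.1, hA.2⟩

theorem rigidMove_rigidMove_transpose {N : ℕ} {A : Matrix (Fin 3) (Fin 3) ℝ}
    (hA : A ∈ specialOrthogonalGroup (Fin 3) ℝ) (c : Fin 3 → ℝ) (p : AtomCloud N) :
    rigidMove Aᵀ (-(Aᵀ *ᵥ c)) (rigidMove A c p) = p := by
  have h : Aᵀ * A = 1 := (mem_orthogonalGroup_iff' (Fin 3) ℝ).mp hA.1
  funext n
  rw [rigidMove, rigidMove, mulVec_add, mulVec_mulVec, h, one_mulVec, add_neg_cancel_right]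

theorem IsLocalMin.rigidMove {N : ℕ} {A : Matrix (Fin 3) (Fin 3) ℝ}
    (hA : A ∈ specialOrthogonalGroup (Fin 3) ℝ) (c : Fin 3 → ℝ) {p : AtomCloud N}
    (hp : IsLocalMin pairSum p) : IsLocalMin pairSum (rigidMove A c p) := by
  have hc : Continuous (_root_.rigidMove (N := N) Aᵀ (-(Aᵀ *ᵥ c))) := by
    unfold _root_.rigidMove
    fun_prop
  have h := hc.tendsto (_root_.rigidMove A c p)
  rw [rigidMove_rigidMove_transpose hA] at h
  filter_upwards [h.eventually hp] with q hq
  rw [pairSum_rigidMove (transpose_mem_specialOrthogonalGroup hA)] at hq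
  rwa [pairSum_rigidMove hA]

theorem NearFcc.bond_pos {p : AtomCloud 864} (hp : NearFcc p) {n m : Fin 864} (h : n ≠ m) :
    0 < (p n - p m) ⬝ᵥ (p n - p m) := by
  have hD := one_le_fcc_dotProduct h
  have h0 : ((fccApprox n - fccApprox m) ⬝ᵥ (fccApprox n - fccApprox m))⁻¹ *
      ((fccApprox n - fccApprox m) ⬝ᵥ (fccApprox n - fccApprox m)) = 1 :=
    inv_mul_cancel₀ (by linarith)
  -- Only the positivity part is used, with the exact inverse as `τ` and the trivial direction.
  have := (ljCurvature_near_ge (z := 0) hD (hp.bond_le h) h0.le (by rw [h0]; norm_num)).1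
  have e1 : fccApprox n - fccApprox m + ((p - fccApprox) n - (p - fccApprox) m) = p n - p m := by
    simp only [Pi.sub_apply]
    abel
  rwa [e1] at this

theorem continuous_sqNorm_sub {N : ℕ} (r : AtomCloud N) :
    Continuous fun p : AtomCloud N => sqNorm (p - r) := by
  unfold sqNorm dotProduct
  fun_prop

theorem eventually_nearFcc {p : AtomCloud 864}
    (h : sqNorm (p - fccApprox) < (1 / 125000) ^ 2 / 2) : ∀ᶠ q in 𝓝 p, NearFcc q :=
  ((continuous_sqNorm_sub fccApprox).continuousAt.eventually_lt continuousAt_const h).mono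
    fun _ hq => hq.le

/-- The aligned clouds near the relaxed block. -/
def fccSlice : Set (AtomCloud 864) := {p | Aligned (p - fccApprox) ∧ NearFcc p}

theorem continuousOn_pairSum : ContinuousOn (pairSum (N := 864)) fccSlice := by
  unfold pairSum
  refine continuousOn_finsetSum _ fun n _ => continuousOn_finsetSum _ fun m _ => ?_
  by_cases h : n = m
  · subst h
    simp only [sub_self]
    exact continuousOn_const
  · have hc : ContinuousOn (fun p : AtomCloud 864 => ((p n - p m) ⬝ᵥ (p n - p m))⁻¹) fccSlice := by
      refine ContinuousOn.inv₀ ?_ fun p hp => (hp.2.bond_pos h).ne'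
      unfold dotProduct
      fun_prop
    exact (hc.pow 6).sub (hc.pow 3)

theorem abs_le_of_sqNorm_le {N : ℕ} {v : AtomCloud N} {r : ℝ} (hr : 0 ≤ r)
    (h : sqNorm v ≤ r ^ 2) (n : Fin N) (d : Fin 3) : |v n d| ≤ r := by
  refine abs_le_of_sq_le_sq (le_trans ?_ h) hr
  rw [sqNorm_eq]
  refine le_trans ?_ (single_le_sum (f := fun n => ∑ d, v n d ^ 2)
    (fun n _ => sum_nonneg fun d _ => sq_nonneg _) (mem_univ n))
  exact single_le_sum (f := fun d => v n d ^ 2) (fun d _ => sq_nonneg _) (mem_univ d)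

theorem norm_le_of_sqNorm_le {N : ℕ} {v : AtomCloud N} {r : ℝ} (hr : 0 ≤ r)
    (h : sqNorm v ≤ r ^ 2) : ‖v‖ ≤ r :=
  (pi_norm_le_iff_of_nonneg hr).mpr fun n => (pi_norm_le_iff_of_nonneg hr).mpr fun d =>
    abs_le_of_sqNorm_le hr h n d

theorem sqNorm_le_of_norm_le {v : AtomCloud 864} {r : ℝ} (h : ‖v‖ ≤ r) :
    sqNorm v ≤ 2592 * r ^ 2 := by
  rw [sqNorm_eq]
  have h1 : ∀ n d, v n d ^ 2 ≤ r ^ 2 := fun n d => by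
    rw [← sq_abs]
    exact pow_le_pow_left₀ (abs_nonneg _)
      (((norm_le_pi_norm (v n) d).trans (norm_le_pi_norm v n)).trans h) 2
  refine (sum_le_sum fun n _ => sum_le_sum fun d _ => h1 n d).trans (le_of_eq ?_)
  simp only [sum_const, card_univ, Fintype.card_fin, nsmul_eq_mul]
  push_cast
  ring

theorem isCompact_fccSlice : IsCompact fccSlice := by
  refine (isCompact_closedBall fccApprox 1).of_isClosed_subset ?_ ?_
  · have h1 : IsClosed {p : AtomCloud 864 | Aligned (p - fccApprox)} := by
      simp only [Aligned, Set.ofPred_and, Set.ofPred_forall]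
      refine (isClosed_iInter fun d => isClosed_eq ?_ continuous_const).inter
        (isClosed_iInter fun d => isClosed_eq ?_ continuous_const) <;> fun_prop
    have h2 : IsClosed {p : AtomCloud 864 | NearFcc p} :=
      isClosed_le (continuous_sqNorm_sub fccApprox) continuous_const
    exact h1.inter h2
  · intro p hp
    rw [mem_closedBall_iff_norm]
    exact norm_le_of_sqNorm_le zero_le_one (le_trans hp.2 (by norm_num))

theorem fccApprox_mem_fccSlice : fccApprox ∈ fccSlice := by
  constructor
  · simp [Aligned]
  · simp only [NearFcc, sub_self, sqNorm, Pi.zero_apply, zero_dotProduct, sum_const_zero]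
    positivity

theorem sum_fccApprox : ∑ n, fccApprox n = 0 := by
  funext d
  rw [Finset.sum_apply, Pi.zero_apply, sum_atoms]
  refine sum_eq_zero fun i hi => ?_
  simp only [fccApprox_eq, atomInt_atomAt (mem_range.mp hi), latticeAtom]
  rw [← sum_div, div_eq_zero_iff]
  left
  have h : ∀ ε : ℤ, ∀ e : Fin 3, ∑ g, bondSign ε g e = 0 := by
    intro ε e
    fin_cases e <;> simp [bondSign, Fin.sum_univ_four]
  rw [← Int.cast_sum, ← sum_mul, h, zero_mul, Int.cast_zero]

/-- Every cloud near the relaxed block can be moved rigidly to an aligned one. -/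
theorem exists_rigidMove_mem_fccSlice {q : AtomCloud 864} (hq : NearFcc q) :
    ∃ A ∈ specialOrthogonalGroup (Fin 3) ℝ, ∃ c : Fin 3 → ℝ, rigidMove A c q ∈ fccSlice := by
  obtain ⟨A, hA, c, h1, h2, h3⟩ := exists_rigid_alignment (by norm_num) fccApprox q sum_fccApprox
  refine ⟨A, hA, c, ⟨fun d => ?_, h2⟩, le_trans h3 hq⟩
  have := congrFun h1 d
  rwa [Finset.sum_apply] at this

theorem Aligned.sub {u v : AtomCloud 864} (hu : Aligned u) (hv : Aligned v) : Aligned (u - v) := by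
  constructor
  · intro d
    simp only [Pi.sub_apply, sum_sub_distrib, hu.1 d, hv.1 d, sub_self]
  · intro d
    rw [← sub_eq_zero.mpr ((hu.2 d).trans (hv.2 d).symm), ← sum_sub_distrib]
    refine sum_congr rfl fun n _ => ?_
    simp only [Pi.sub_apply]
    ring

theorem aligned_sub_of_mem {p q : AtomCloud 864} (hp : p ∈ fccSlice) (hq : q ∈ fccSlice) :
    Aligned (q - p) := by
  have := hq.1.sub hp.1
  rwa [sub_sub_sub_cancel_right] at this

theorem NearFcc.hasDerivAt_pairSum {q : AtomCloud 864} (hq : NearFcc q) (v : AtomCloud 864) :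
    HasDerivAt (fun s : ℝ => pairSum (q + s • v)) (pairSlope q v) 0 := by
  unfold pairSum pairSlope
  refine HasDerivAt.fun_sum fun n _ => HasDerivAt.fun_sum fun m _ => ?_
  by_cases h : n = m
  · subst h
    simp only [sub_self, ljSlope, dotProduct_zero, mul_zero]
    exact hasDerivAt_const _ _
  · have hx : ∀ s : ℝ, ((q + s • v) n - (q + s • v) m) ⬝ᵥ ((q + s • v) n - (q + s • v) m) =
        (q n - q m) ⬝ᵥ (q n - q m) + 2 * ((q n - q m) ⬝ᵥ (v n - v m)) * s +
          ((v n - v m) ⬝ᵥ (v n - v m)) * s ^ 2 := by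
      intro s
      have e : (q + s • v) n - (q + s • v) m = (q n - q m) + s • (v n - v m) := by
        simp only [Pi.add_apply, Pi.smul_apply, smul_sub]
        abel
      rw [e]
      generalize q n - q m = x
      generalize v n - v m = z
      simp only [add_dotProduct, dotProduct_add, smul_dotProduct, dotProduct_smul, smul_eq_mul,
        dotProduct_comm z x]
      ring
    simp only [hx]
    have hd : HasDerivAt (fun s : ℝ => (q n - q m) ⬝ᵥ (q n - q m) +
        2 * ((q n - q m) ⬝ᵥ (v n - v m)) * s + ((v n - v m) ⬝ᵥ (v n - v m)) * s ^ 2)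
        (2 * ((q n - q m) ⬝ᵥ (v n - v m))) 0 := by
      have := (((hasDerivAt_id' (0 : ℝ)).const_mul (2 * ((q n - q m) ⬝ᵥ (v n - v m)))).const_add
        ((q n - q m) ⬝ᵥ (q n - q m))).fun_add
        (((hasDerivAt_id' (0 : ℝ)).fun_pow 2).const_mul ((v n - v m) ⬝ᵥ (v n - v m)))
      simpa using this
    have := hasDerivAt_ljPotential hd (by simpa using (hq.bond_pos h).ne')
    simp only [mul_zero, add_zero, ne_eq, OfNat.ofNat_ne_zero, not_false_eq_true, zero_pow] at this
    refine this.congr_deriv ?_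
    rw [ljSlope]
    ring

/-- Bonds stay positive near `fccApprox`, so `pairSum` is differentiable along lines and Fermat's
criterion applies. -/
theorem pairSlope_eq_zero_of_isLocalMin {q : AtomCloud 864} (hq : NearFcc q)
    (h : IsLocalMin pairSum q) (v : AtomCloud 864) : pairSlope q v = 0 := by
  have hc : Tendsto (fun s : ℝ => q + s • v) (𝓝 0) (𝓝 q) := by
    have : Continuous fun s : ℝ => q + s • v := by fun_prop
    simpa using this.tendsto 0
  have hm : IsLocalMin (fun s : ℝ => pairSum (q + s • v)) 0 := by
    filter_upwards [hc.eventually h] with s hs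
    simpa using hs
  exact hm.hasDerivAt_eq_zero (hq.hasDerivAt_pairSum v)

theorem eq_of_sqNorm_sub_nonpos {N : ℕ} {p q : AtomCloud N} (h : sqNorm (p - q) ≤ 0) : p = q := by
  have := norm_le_of_sqNorm_le (v := p - q) le_rfl (by simpa using h)
  rwa [norm_le_zero_iff, sub_eq_zero] at this

end Minimizer

theorem mainTheorem8 :
    ∃ p : AtomCloud 864,
      IsLocalMin ljEnergy p ∧
      ‖p - fccApprox‖ ≤ 1.4797 * (10 : ℝ) ^ (-11 : ℤ) ∧
      ∀ q : AtomCloud 864,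
        IsLocalMin ljEnergy q →
        ‖q - fccApprox‖ ≤ 9.9994 * (10 : ℝ) ^ (-8 : ℤ) →
        RigidlyEquivalent p q := by
  obtain ⟨p, hp, hmin⟩ := isCompact_fccSlice.exists_isMinOn ⟨_, fccApprox_mem_fccSlice⟩
    continuousOn_pairSum
  have hS := sqNorm_le_of_pairSum_le hp.2 hp.1 (hmin fccApprox_mem_fccSlice)
  refine ⟨p, ?_, ?_, fun q hq hqn => ?_⟩
  · rw [isLocalMin_ljEnergy_iff (by norm_num)]
    -- The minimizer is far inside the ball, so a whole neighbourhood of it consists of near clouds.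
    -- Each of these has a rigid copy of the same energy in the slice, where `p` is minimal.
    have hnear := eventually_nearFcc (lt_of_le_of_lt hS (by norm_num))
    filter_upwards [hnear] with q hq
    obtain ⟨A, hA, c, hm⟩ := exists_rigidMove_mem_fccSlice hq
    rw [← pairSum_rigidMove hA c q]
    exact hmin hm
  · exact (norm_le_of_sqNorm_le (by norm_num) hS).trans (by norm_num)
  · rw [isLocalMin_ljEnergy_iff (by norm_num)] at hq
    -- A sup-norm distance of `9.9994 * 10 ^ (-8)` gives at most `2592` times its square, about
    -- `2.59 * 10 ^ (-11)`, below the admissible `3.2 * 10 ^ (-11)`.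
    have hqN : NearFcc q := (sqNorm_le_of_norm_le hqn).trans (by norm_num)
    obtain ⟨A, hA, c, hm⟩ := exists_rigidMove_mem_fccSlice hqN
    -- The expansion is made at the moved copy of `q`, whose slope vanishes. Since `p` has the least
    -- energy on the slice, the quadratic term must be zero.
    have h1 := pairSum_strongly_convex hm.2 hp.2 (aligned_sub_of_mem hm hp)
    rw [pairSlope_eq_zero_of_isLocalMin hm.2 (hq.rigidMove hA c)] at h1
    have h2 : pairSum p ≤ pairSum (rigidMove A c q) := hmin hm
    have h3 : p = rigidMove A c q := eq_of_sqNorm_sub_nonpos (by linarith)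
    refine ⟨A.transpose, transpose_mem_specialOrthogonalGroup hA, -(A.transpose.mulVec c), fun i => ?_⟩
    have h4 := congrFun (rigidMove_rigidMove_transpose hA c q) i
    rw [← h3] at h4
    exact h4.symm
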